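/- **Setting.** Let $(X_i,Y_i)$, $i\ge1$, be i.i.d. copies of $(X,Y)$ with values in $\mathbb R^{d_X}\times\mathbb R$. Let $F_Y$ be the distribution function of $Y$, assumed strictly increasing on the support $\mathcal Y$ of $Y$, with $0,1\in\mathcal Y$. Put $\mathcal T(y)=\frac{F_Y(y)-F_Y(0)}{F_Y(1)-F_Y(0)}$, $U_i=\mathcal T(Y_i)$ and $Z_i=(U_i,X_i)$. Let $\Theta\subset\mathbb R^{d}$, let $\Lambda_\theta:\mathbb R\to\mathbb R$ ($\theta\in\Theta$) be strictly increasing, let $C_1\subset(0,\infty)$, $C_2\subset\mathbb R$ and $\Upsilon=C_1\times C_2\times\Theta$. Let $w\ge0$ be a weight function with support $\mathcal Y_w$, and let $\hat h=\hat h_n$ be an estimator of $h$ (below) computed from $(X_i,Y_i)_{i\le n}$. For $\gamma=(c_1,c_2,\theta)$ put $$M(\gamma)=E\big[w(Y)(h(Y)c_1+c_2-\Lambda_\theta(Y))^2\big],\qquad T_n=\min_{\gamma\in\Upsilon}\sum_{j=1}^n w(Y_j)\big(\hat h(Y_j)c_1+c_2-\Lambda_\theta(Y_j)\big)^2 ,$$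 and let $d(\Lambda_\theta,h)=\inf_{c_1>0,\,c_2\in\mathbb R}M(c_1,c_2,\theta)$. **Assumptions.** * (A1) $C_1,C_2,\Theta$ are compact. * (A2) $w$ is continuous with compact support $\mathcal Y_w\subset\mathcal Y$. * (A3) For $y\in\mathcal Y_w$ the map $\theta\mapsto\Lambda_\theta(y)$ is twice differentiable on $\Theta$, and its first and second derivatives are continuous in $(y,\theta)\in\mathcal Y_w\times\Theta$. * (A4) There is a strictly increasing continuous $h:\mathbb R\to\mathbb R$ with $h(0)=0$, $h(1)=1$, unique on $\mathcal Y$, such that $h(Y)=g(X)+\varepsilon$ for some measurable $g$, where $E[\varepsilon]=0$ and $\varepsilon$ is independent of $X$. * (A6') $M$ has a unique minimizer $\gamma_0=(c_{1,0},c_{2,0},\theta_0)$ over $\Upsilon$, and $\gamma_0$ lies in the interior of $\Upsilon$; for all $\theta\ne\tilde\theta$ in $\Theta$, $\sup_{y\in\mathcal Y_w}\Big|\frac{\Lambda_\theta(y)-\Lambda_\theta(0)}{\Lambda_\theta(1)-\Lambda_\theta(0)}-\frac{\Lambda_{\tilde\theta}(y)-\Lambda_{\tilde\theta}(0)}{\Lambda_{\tilde\theta}(1)-\Lambda_{\tilde\theta}(0)}\Big|>0$.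 * (A7) The Hessian matrix of $M$ at $\gamma_0$ is positive definite. * (A8') For some function $\psi$, $\hat h(y)-h(y)=\frac1n\sum_{i=1}^n\psi(Z_i,\mathcal T(y))+o_P(n^{-1/2})$ uniformly in $y\in\mathcal Y_w$. With $F_S$ the distribution function of $h(Y)$ and $\mathcal T_S(s)=\frac{F_S(s)-F_S(0)}{F_S(1)-F_S(0)}$, there is $\mathcal U_0\supset\mathcal T_S(h(\mathcal Y_w))$ such that $\{z\mapsto\psi(z,t):t\in\mathcal U_0\}$ is a Donsker class with respect to the law of $Z_1$ and $E[\psi(Z_1,t)]=0$ for all $t\in\mathcal U_0$. Moreover $E[\psi(Z_1,U_2)^2]<\infty$. * With $\tilde R_i=h(Y_i)c_{1,0}+c_{2,0}-\Lambda_{\theta_0}(Y_i)$, and $\dot\Lambda_{\theta}$ (a row vector) and $\ddot\Lambda_{\theta}$ the gradient and the Hessian matrix of $\Lambda_\theta$ in $\theta$, the matrix $$\Gamma'=E\left[w(Y_1)\begin{pmatrix}h(Y_1)^2&h(Y_1)&-h(Y_1)\dot\Lambda_{\theta_0}(Y_1)\\ h(Y_1)&1&-\dot\Lambda_{\theta_0}(Y_1)\\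 -h(Y_1)\dot\Lambda_{\theta_0}(Y_1)^t&-\dot\Lambda_{\theta_0}(Y_1)^t&\dot\Lambda_{\theta_0}(Y_1)^t\dot\Lambda_{\theta_0}(Y_1)-\ddot\Lambda_{\theta_0}(Y_1)\tilde R_1\end{pmatrix}\right]$$ is positive definite. **Theorem.** Under these assumptions, $$n^{1/2}\big(T_n/n-M(\gamma_0)\big)\xrightarrow{\ \mathcal D\ }\mathcal N(0,\sigma^2),\qquad \sigma^2=\operatorname{Var}\big(w(Y_1)\tilde R_1^2+\delta(Z_1)\big),$$ where $\delta(Z_1)=2c_{1,0}\,E[w(Y_2)\psi(Z_1,U_2)\tilde R_2\mid Z_1]$. This yields an asymptotic test for relevant deviations from the parametric class. Let $\sigma^2>0$, let $\hat\sigma_n^2\to\sigma^2$ in probability, let $\eta\in\mathbb R$, and let $u_\alpha$ be the $\alpha$-quantile of $\mathcal N(0,1)$, $\alpha\in(0,1)$. Then: * if $H_0':\inf_{\theta\in\Theta}d(\Lambda_\theta,h)\ge\eta$ holds, then $\limsup_{n}P\big((T_n-n\eta)/(n\hat\sigma_n^2)^{1/2}<u_\alpha\big)\le\alpha$; * if $H_1':\inf_{\theta\in\Theta}d(\Lambda_\theta,h)<\eta$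 holds, and $C_1,C_2$ are large enough that $\min_{c_1\in C_1,c_2\in C_2}M(c_1,c_2,\theta)=d(\Lambda_\theta,h)$ for all $\theta\in\Theta$, then $P\big((T_n-n\eta)/(n\hat\sigma_n^2)^{1/2}<u_\alpha\big)\to1$. -/

import Mathlib

open MeasureTheory ProbabilityTheory Filter Topology Set
open scoped ENNReal NNReal

noncomputable section

namespace TransModel

/-! ### Donsker classes -/

/-- The space `ℓ^∞(ι)` of bounded real functions on the index set `ι`, with the sup norm. -/
abbrev EllInfty (ι : Type*) := lp (fun _ : ι => ℝ) ∞

instance instMeasurableSpaceEllInfty (ι : Type*) : MeasurableSpace (EllInfty ι) := borel _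

instance instBorelSpaceEllInfty (ι : Type*) : BorelSpace (EllInfty ι) := ⟨rfl⟩

/-- Outer expectation `E^* f` of a nonnegative, not necessarily measurable function. -/
def outerExpectation {α : Type*} [MeasurableSpace α] (μ : Measure α) (f : α → ℝ≥0∞) : ℝ≥0∞ :=
  ⨅ (g : α → ℝ≥0∞) (_ : Measurable g) (_ : ∀ x, f x ≤ g x), ∫⁻ x, g x ∂μ

/-- `F` is a Donsker class with respect to the probability measure `Q`: the empirical process
`√n (Q_n - Q)`, formed from `n` independent draws from `Q`, takes values in `ℓ^∞(F)` and
converges weakly there, in the sense of outer expectations, to a tight Borel probability measure.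
It suffices to test with nonnegative bounded continuous functions, since adding a constant to the
test function shifts both sides by this constant. -/
def IsDonsker {𝓩 : Type*} [MeasurableSpace 𝓩] (F : Set (𝓩 → ℝ)) (Q : Measure 𝓩) :
    Prop :=
  (∀ f ∈ F, Measurable f ∧ Integrable f Q) ∧
  ∃ G : (n : ℕ) → (Fin n → 𝓩) → EllInfty F,
    (∀ (n : ℕ) (z : Fin n → 𝓩) (f : F),
      G n z f = (Real.sqrt n)⁻¹ * ∑ i, (f.1 (z i) - ∫ x, f.1 x ∂Q)) ∧
    ∃ L : Measure (EllInfty F), IsProbabilityMeasure L ∧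
      IsTightMeasureSet ({L} : Set (Measure (EllInfty F))) ∧
      ∀ Φ : BoundedContinuousFunction (EllInfty F) ℝ≥0,
        Tendsto
          (fun n : ℕ => outerExpectation (Measure.pi fun _ : Fin n => Q)
            (fun z => (Φ (G n z) : ℝ≥0∞)))
          atTop (𝓝 (∫⁻ x, (Φ x : ℝ≥0∞) ∂L))

/-! ### The model -/

/-- The transformation model `h(Y) = g(X) + ε` with a regression function `g`, with `E ε = 0` and
with `ε` independent of `X`. -/
def ModelHolds {Ω : Type*} [MeasurableSpace Ω] (P : Measure Ω) {dX : ℕ}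
    (X : Ω → EuclideanSpace ℝ (Fin dX)) (Y : Ω → ℝ) (h : ℝ → ℝ) : Prop :=
  ∃ g : EuclideanSpace ℝ (Fin dX) → ℝ, Measurable g ∧
    Integrable (fun ω => h (Y ω) - g (X ω)) P ∧
    ∫ ω, (h (Y ω) - g (X ω)) ∂P = 0 ∧
    IndepFun X (fun ω => h (Y ω) - g (X ω)) P

/-- A continuous strictly increasing transformation with the identification conditions
`h(0) = 0`, `h(1) = 1` for which the transformation model holds. -/
def IsTransformation {Ω : Type*} [MeasurableSpace Ω] (P : Measure Ω) {dX : ℕ}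
    (X : Ω → EuclideanSpace ℝ (Fin dX)) (Y : Ω → ℝ) (h : ℝ → ℝ) : Prop :=
  StrictMono h ∧ Continuous h ∧ h 0 = 0 ∧ h 1 = 1 ∧ ModelHolds P X Y h

/-- For a real random variable with law `μ` and distribution function `F`, the map
`y ↦ (F(y) - F(0)) / (F(1) - F(0))`. -/
def normCDF (μ : Measure ℝ) (y : ℝ) : ℝ :=
  (cdf μ y - cdf μ 0) / (cdf μ 1 - cdf μ 0)

/-- `Z_i = (U_i, X_i)` with `U_i = 𝒯(Y_i)`, where `𝒯` is the normalized distribution function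
of `Y`. -/
def obsZ {Ω : Type*} [MeasurableSpace Ω] (P : Measure Ω) {dX : ℕ}
    (X : ℕ → Ω → EuclideanSpace ℝ (Fin dX)) (Y : ℕ → Ω → ℝ) (i : ℕ) (ω : Ω) :
    ℝ × EuclideanSpace ℝ (Fin dX) :=
  (normCDF (P.map (Y 0)) (Y i ω), X i ω)

/-- The first `n` observations `(X_i, Y_i)`. -/
def sample {Ω : Type*} {dX : ℕ} (X : ℕ → Ω → EuclideanSpace ℝ (Fin dX)) (Y : ℕ → Ω → ℝ)
    (n : ℕ) (ω : Ω) : Fin n → EuclideanSpace ℝ (Fin dX) × ℝ :=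
  fun i => (X i ω, Y i ω)

/-- For `y` in the set `S`, the function `θ ↦ Λ_θ(y)` is twice differentiable on `Θ`, with first
and second derivatives that are continuous in `(y, θ) ∈ S × Θ`. -/
def TwiceContDiffInParam {d : ℕ} (S : Set ℝ) (Θ : Set (EuclideanSpace ℝ (Fin d)))
    (Λ : EuclideanSpace ℝ (Fin d) → ℝ → ℝ) : Prop :=
  ∃ (D₁ : ℝ → EuclideanSpace ℝ (Fin d) → (EuclideanSpace ℝ (Fin d) →L[ℝ] ℝ))
    (D₂ : ℝ → EuclideanSpace ℝ (Fin d) →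
      (EuclideanSpace ℝ (Fin d) →L[ℝ] EuclideanSpace ℝ (Fin d) →L[ℝ] ℝ)),
    (∀ y ∈ S, ∀ θ ∈ Θ, HasFDerivWithinAt (fun t => Λ t y) (D₁ y θ) Θ θ) ∧
    (∀ y ∈ S, ∀ θ ∈ Θ, HasFDerivWithinAt (D₁ y) (D₂ y θ) Θ θ) ∧
    ContinuousOn (fun p : ℝ × EuclideanSpace ℝ (Fin d) => D₁ p.1 p.2) (S ×ˢ Θ) ∧
    ContinuousOn (fun p : ℝ × EuclideanSpace ℝ (Fin d) => D₂ p.1 p.2) (S ×ˢ Θ)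

/-! ### Criterion functions and test statistic -/

/-- The parameters `γ = (c₁, c₂, θ)`. -/
abbrev Param (d : ℕ) := ℝ × ℝ × EuclideanSpace ℝ (Fin d)

/-- `f(y) c₁ + c₂ - Λ_θ(y)`. -/
def resid {d : ℕ} (Λ : EuclideanSpace ℝ (Fin d) → ℝ → ℝ) (f : ℝ → ℝ) (γ : Param d) (y : ℝ) : ℝ :=
  f y * γ.1 + γ.2.1 - Λ γ.2.2 y

/-- `M(γ) = E[w(Y) (h(Y) c₁ + c₂ - Λ_θ(Y))²]`. -/
def popCriterion {Ω : Type*} [MeasurableSpace Ω] (P : Measure Ω) {d : ℕ} (Y : Ω → ℝ)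
    (w : ℝ → ℝ) (Λ : EuclideanSpace ℝ (Fin d) → ℝ → ℝ) (h : ℝ → ℝ) (γ : Param d) : ℝ :=
  ∫ ω, w (Y ω) * resid Λ h γ (Y ω) ^ 2 ∂P

/-- `M_n(γ) = ∑_{j ≤ n} w(Y_j) (f(Y_j) c₁ + c₂ - Λ_θ(Y_j))²`. -/
def empCriterion {n d : ℕ} (w : ℝ → ℝ) (Λ : EuclideanSpace ℝ (Fin d) → ℝ → ℝ)
    (y : Fin n → ℝ) (f : ℝ → ℝ) (γ : Param d) : ℝ :=
  ∑ j, w (y j) * resid Λ f γ (y j) ^ 2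

/-- The test statistic `T_n = min_{γ ∈ C₁ × C₂ × Θ} M_n(γ)`, where `hhat n D` is the estimator of
the transformation computed from the data `D`. -/
def testStat {Ω : Type*} {dX d : ℕ} (X : ℕ → Ω → EuclideanSpace ℝ (Fin dX)) (Y : ℕ → Ω → ℝ)
    (w : ℝ → ℝ) (Λ : EuclideanSpace ℝ (Fin d) → ℝ → ℝ)
    (C₁ C₂ : Set ℝ) (Θ : Set (EuclideanSpace ℝ (Fin d)))
    (hhat : (n : ℕ) → (Fin n → EuclideanSpace ℝ (Fin dX) × ℝ) → ℝ → ℝ) (n : ℕ) (ω : Ω) : ℝ :=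
  sInf (empCriterion w Λ (fun j : Fin n => Y j ω) (hhat n (sample X Y n ω)) '' (C₁ ×ˢ C₂ ×ˢ Θ))

/-- The squared distance `d(Λ_θ, h)`: the infimum of `E[w(Y) (h(Y) c₁ + c₂ - Λ_θ(Y))²]` over
`c₁ > 0` and `c₂ ∈ ℝ`. -/
def sqDist {Ω : Type*} [MeasurableSpace Ω] (P : Measure Ω) {d : ℕ} (Y : Ω → ℝ)
    (w : ℝ → ℝ) (Λ : EuclideanSpace ℝ (Fin d) → ℝ → ℝ) (h : ℝ → ℝ)
    (θ : EuclideanSpace ℝ (Fin d)) : ℝ :=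
  sInf ((fun c : ℝ × ℝ => popCriterion P Y w Λ h (c.1, c.2, θ)) '' (Ioi 0 ×ˢ univ))

/-! ### Derivative matrices -/

/-- Coordinate indices of `Param d`. -/
abbrev ParamIdx (d : ℕ) := Unit ⊕ Unit ⊕ Fin d

/-- The standard basis of `Param d`. -/
def paramBasis {d : ℕ} : ParamIdx d → Param d :=
  Sum.elim (fun _ => (1, 0, 0))
    (Sum.elim (fun _ => (0, 1, 0)) (fun k => (0, 0, EuclideanSpace.single k 1)))

/-- The Hessian matrix of second partial derivatives of `M` at `γ`. -/
def hessian {d : ℕ} (M : Param d → ℝ) (γ : Param d) : Matrix (ParamIdx d) (ParamIdx d) ℝ :=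
  Matrix.of fun i j =>
    lineDeriv ℝ (fun γ' => lineDeriv ℝ M γ' (paramBasis j)) γ (paramBasis i)

/-- The partial derivative of `Λ_θ(y)` with respect to `θ_k`. -/
def dotΛ {d : ℕ} (Λ : EuclideanSpace ℝ (Fin d) → ℝ → ℝ) (θ : EuclideanSpace ℝ (Fin d)) (y : ℝ)
    (k : Fin d) : ℝ :=
  lineDeriv ℝ (fun t => Λ t y) θ (EuclideanSpace.single k 1)

/-- The second partial derivative of `Λ_θ(y)` with respect to `θ_k` and `θ_l`. -/
def ddotΛ {d : ℕ} (Λ : EuclideanSpace ℝ (Fin d) → ℝ → ℝ) (θ : EuclideanSpace ℝ (Fin d)) (y : ℝ)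
    (k l : Fin d) : ℝ :=
  lineDeriv ℝ (fun t => dotΛ Λ t y l) θ (EuclideanSpace.single k 1)

/-- The vector `(h(y), 1, -∂_θ Λ_θ(y))`. -/
def scoreVec {d : ℕ} (Λ : EuclideanSpace ℝ (Fin d) → ℝ → ℝ) (h : ℝ → ℝ)
    (θ : EuclideanSpace ℝ (Fin d)) (y : ℝ) : ParamIdx d → ℝ :=
  Sum.elim (fun _ => h y) (Sum.elim (fun _ => 1) (fun k => -dotΛ Λ θ y k))

/-- The block matrix which is `∂²_θ Λ_θ(y)` in the `θ`-`θ` block and zero elsewhere. -/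
def curvBlock {d : ℕ} (Λ : EuclideanSpace ℝ (Fin d) → ℝ → ℝ) (θ : EuclideanSpace ℝ (Fin d))
    (y : ℝ) : ParamIdx d → ParamIdx d → ℝ
  | .inr (.inr k), .inr (.inr l) => ddotΛ Λ θ y k l
  | _, _ => 0

/-- The matrix `Γ'`: the expectation of `w(Y)` times the matrix with blocks
`h(Y)²`, `h(Y)`, `-h(Y) ∂Λ(Y)`, `1`, `-∂Λ(Y)` and `∂Λ(Y)ᵗ ∂Λ(Y) - ∂²Λ(Y) R̃`, where
`R̃ = h(Y) c₁ + c₂ - Λ_θ(Y)` and the derivatives are taken at the `θ` of `γ = (c₁, c₂, θ)`. -/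
def GammaPrime {Ω : Type*} [MeasurableSpace Ω] (P : Measure Ω) {d : ℕ} (Y : Ω → ℝ)
    (w : ℝ → ℝ) (Λ : EuclideanSpace ℝ (Fin d) → ℝ → ℝ) (h : ℝ → ℝ) (γ : Param d) :
    Matrix (ParamIdx d) (ParamIdx d) ℝ :=
  Matrix.of fun i j => ∫ ω, w (Y ω) *
    (scoreVec Λ h γ.2.2 (Y ω) i * scoreVec Λ h γ.2.2 (Y ω) j
      - curvBlock Λ γ.2.2 (Y ω) i j * resid Λ h γ (Y ω)) ∂P

/-! ### Asymptotic variance -/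

/-- `δ(Z₁) = 2 c₁ E[w(Y₂) ψ(Z₁, U₂) R̃₂ | Z₁]` with `R̃₂ = h(Y₂) c₁ + c₂ - Λ_θ(Y₂)`; the indices
`0` and `1` stand for the first and the second observation. -/
def delta {Ω : Type*} [MeasurableSpace Ω] (P : Measure Ω) {dX d : ℕ}
    (X : ℕ → Ω → EuclideanSpace ℝ (Fin dX)) (Y : ℕ → Ω → ℝ) (w : ℝ → ℝ)
    (Λ : EuclideanSpace ℝ (Fin d) → ℝ → ℝ) (h : ℝ → ℝ)
    (ψ : ℝ × EuclideanSpace ℝ (Fin dX) → ℝ → ℝ) (γ : Param d) (ω : Ω) : ℝ :=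
  2 * γ.1 *
    (P[fun ω' => w (Y 1 ω') * ψ (obsZ P X Y 0 ω') (obsZ P X Y 1 ω').1 * resid Λ h γ (Y 1 ω') |
      MeasurableSpace.comap (obsZ P X Y 0) inferInstance]) ω

/-- `σ² = Var(w(Y₁) R̃₁² + δ(Z₁))`. -/
def asympVar {Ω : Type*} [MeasurableSpace Ω] (P : Measure Ω) {dX d : ℕ}
    (X : ℕ → Ω → EuclideanSpace ℝ (Fin dX)) (Y : ℕ → Ω → ℝ) (w : ℝ → ℝ)
    (Λ : EuclideanSpace ℝ (Fin d) → ℝ → ℝ) (h : ℝ → ℝ)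
    (ψ : ℝ × EuclideanSpace ℝ (Fin dX) → ℝ → ℝ) (γ : Param d) : ℝ :=
  variance (fun ω => w (Y 0 ω) * resid Λ h γ (Y 0 ω) ^ 2 + delta P X Y w Λ h ψ γ ω) P

/-- The event that the test of `H₀' : min_θ d(Λ_θ, h) ≥ η` rejects, that is
`(T_n - n η) / (n σ̂²)^{1/2} < u`. -/
def rejects (η u T s2 : ℝ) (n : ℕ) : Prop :=
  (T - n * η) / Real.sqrt (n * s2) < u

end TransModel

end

/-! The statistic is asymptotically linear: up to `o_P(1)`, `√n (T_n/n - M(γ₀))` equals `n^{-1/2} ∑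
(W_i - M(γ₀))`, where `W_i` is `w R̃² + δ` at the i-th observation. The central limit theorem and
Slutsky's lemma then give the normal limit. Probabilistic estimates are phrased along a filter `whp
P` on `ℕ × Ω`, so that limits in probability obey the usual calculus of `Tendsto` and
`filter_upwards`.

Minimization costs nothing at the scale `√n`. Trivially `T_n` is at most the empirical criterion at
`γ₀`. Conversely, away from `γ₀` the empirical criterion is larger by uniqueness of the minimizer
and compactness (`IsIID.eventually_loss_ge`). Near `γ₀` the criterion is expanded to second order.
The score sum is centered by the first order condition, hence `O_P(√n)`. The quadratic term is at
least a multiple of `n ‖v‖²` because `Γ'` is positive definite, and the error of the estimator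
contributes `O_P(√n) ‖v‖`. Completing the square bounds the possible decrease by `C b_n²` for any
slowly diverging `b_n` (`LocalExpansion.eventually_sum_loss_ge`). Neither a rate for an empirical
minimizer nor its existence is needed.

At the fixed `γ₀` the criterion is a square in `ĥ - h`. The quadratic part is negligible by the
`√n`-rate of `ĥ`, which follows from the expansion and the Donsker property. After inserting the
expansion, the linear part is a `V`-statistic with kernel `w(y') R̃(y') ψ(z, 𝒯(y'))`, centered in
the first argument. Its projection is the `δ` term. Since `ψ(Z₁, U₁)` need not be integrable, the
diagonal is handled by truncation (`IsIID.tendsto_vStatistic`): where the diagonal is large, the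
sums over the first argument are controlled uniformly by the Donsker property, and elsewhere the
classical second moment bound for degenerate `U`-statistics applies.

For the tests, `inf_θ d(Λ_θ, h) ≤ M(γ₀)` always holds, with equality when `C₁` and `C₂` are large
enough. The level follows from the portmanteau theorem on a closed half line, and consistency from
`T_n/n → M(γ₀) < η`. -/

namespace TransModel

/-! ### Convergence in probability as convergence along a filter -/

section Whp

variable {Ω : Type*} [MeasurableSpace Ω] {P : Measure Ω}

/-- The filter on `ℕ × Ω` of the sequences of events whose complements have probability tending
to zero. Convergence in probability is convergence along this filter. -/
def whp (P : Measure Ω) : Filter (ℕ × Ω) where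
  sets := {S | Tendsto (fun n => P {ω | (n, ω) ∉ S}) atTop (𝓝 0)}
  univ_sets := by simp
  sets_of_superset {S T} hS hST :=
    tendsto_of_tendsto_of_tendsto_of_le_of_le tendsto_const_nhds hS (fun _ => zero_le)
      fun n => measure_mono fun ω hω hωS => hω (hST hωS)
  inter_sets {S T} hS hT := by
    have h := Tendsto.add hS hT
    rw [add_zero] at h
    refine tendsto_of_tendsto_of_tendsto_of_le_of_le tendsto_const_nhds h (fun _ => zero_le)
      fun n => (measure_mono ?_).trans (measure_union_le _ _)
    intro ω hω
    by_contra hc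
    simp only [mem_union, mem_ofPred_eq, not_or, not_not] at hc
    exact hω ⟨hc.1, hc.2⟩

lemma eventually_whp {p : ℕ × Ω → Prop} :
    (∀ᶠ x in whp P, p x) ↔ Tendsto (fun n => P {ω | ¬ p (n, ω)}) atTop (𝓝 0) := Iff.rfl

lemma tendsto_fst_whp : Tendsto Prod.fst (whp P) atTop := by
  intro S hS
  refine tendsto_const_nhds.congr' ?_
  filter_upwards [hS] with n hn
  simp [hn]

lemma eventually_whp_of_eventually {p : ℕ → Prop} (hp : ∀ᶠ n in atTop, p n) :
    ∀ᶠ x in whp P, p x.1 := tendsto_fst_whp.eventually hp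

lemma tendsto_whp_of_tendsto {α : Type*} {l : Filter α} {u : ℕ → α} (hu : Tendsto u atTop l) :
    Tendsto (fun x : ℕ × Ω => u x.1) (whp P) l := hu.comp tendsto_fst_whp

/-- The bridge between the filter calculus and Mathlib's convergence in measure. Both sides say that
`P(dist ≥ ε) → 0` for every `ε > 0`. -/
lemma tendsto_whp_iff_tendstoInMeasure {R : ℕ → Ω → ℝ} {c : ℝ} :
    Tendsto (fun x : ℕ × Ω => R x.1 x.2) (whp P) (𝓝 c) ↔
      TendstoInMeasure P R atTop fun _ => c := by
  rw [tendstoInMeasure_iff_dist, Metric.tendsto_nhds]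
  simp only [eventually_whp, not_lt]

lemma tendsto_whp_of_integral_abs {R : ℕ → Ω → ℝ}
    (hint : ∀ n, Integrable (R n) P) (h : Tendsto (fun n => ∫ ω, |R n ω| ∂P) atTop (𝓝 0)) :
    Tendsto (fun x : ℕ × Ω => R x.1 x.2) (whp P) (𝓝 0) := by
  rw [tendsto_whp_iff_tendstoInMeasure]
  refine tendstoInMeasure_of_tendsto_eLpNorm (p := 1) one_ne_zero
    (fun n => (hint n).aestronglyMeasurable) aestronglyMeasurable_const ?_
  have h1 : ∀ n, eLpNorm (R n - fun _ => 0) 1 P = ENNReal.ofReal (∫ ω, |R n ω| ∂P) := by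
    intro n
    rw [eLpNorm_one_eq_lintegral_enorm, ofReal_integral_eq_lintegral_ofReal (hint n).abs
      (Eventually.of_forall fun _ => abs_nonneg _)]
    refine lintegral_congr fun ω => ?_
    simp [Real.enorm_eq_ofReal_abs]
  simp_rw [h1]
  simpa using ENNReal.tendsto_ofReal h

lemma tendsto_whp_of_integral_sq {R : ℕ → Ω → ℝ}
    (hint : ∀ n, Integrable (fun ω => R n ω ^ 2) P)
    (h : Tendsto (fun n => ∫ ω, R n ω ^ 2 ∂P) atTop (𝓝 0)) :
    Tendsto (fun x : ℕ × Ω => R x.1 x.2) (whp P) (𝓝 0) := by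
  have h1 : Tendsto (fun x : ℕ × Ω => R x.1 x.2 ^ 2) (whp P) (𝓝 0) :=
    tendsto_whp_of_integral_abs (R := fun n ω => R n ω ^ 2) hint (by simpa using h)
  have h2 := (Real.continuous_sqrt.tendsto 0).comp h1
  rw [Real.sqrt_zero] at h2
  rw [tendsto_zero_iff_abs_tendsto_zero]
  exact h2.congr fun x => Real.sqrt_sq_eq_abs _

end Whp

/-! ### Sums and degenerate `U`-statistics of independent observations -/

/-- `V₀, V₁, …` are independent random variables with the common law `Q`. -/
structure IsIID {Ω 𝓧 : Type*} [MeasurableSpace Ω] [MeasurableSpace 𝓧] (P : Measure Ω)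
    (V : ℕ → Ω → 𝓧) (Q : Measure 𝓧) : Prop where
  meas : ∀ i, Measurable (V i)
  indep : iIndepFun V P
  law : ∀ i, P.map (V i) = Q

section IID

variable {Ω 𝓧 : Type*} [MeasurableSpace Ω] [MeasurableSpace 𝓧] {P : Measure Ω}
  {V : ℕ → Ω → 𝓧} {Q : Measure 𝓧}

lemma IsIID.measurePreserving (hV : IsIID P V Q) (i : ℕ) : MeasurePreserving (V i) P Q :=
  ⟨hV.meas i, hV.law i⟩

lemma IsIID.comp {𝓨 : Type*} [MeasurableSpace 𝓨] (hV : IsIID P V Q) {f : 𝓧 → 𝓨}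
    (hf : Measurable f) : IsIID P (fun i ω => f (V i ω)) (Q.map f) where
  meas i := hf.comp (hV.meas i)
  indep := hV.indep.comp (fun _ => f) fun _ => hf
  law i := by rw [← hV.law i, Measure.map_map hf (hV.meas i)]; rfl

/-- The indices `i, j, l` may coincide, so independence is taken between blocks of indices and the
triple is read off from the block. -/
lemma IsIID.indepFun_prod (hV : IsIID P V Q) {c i j l : ℕ} (hi : c ≠ i) (hj : c ≠ j)
    (hl : c ≠ l) : IndepFun (V c) (fun ω => (V i ω, V j ω, V l ω)) P := by
  have h := hV.indep.indepFun_finset {c} {i, j, l} (by simp [hi, hj, hl]) hV.meas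
  have h1 : Measurable fun x : (({c} : Finset ℕ) → 𝓧) => x ⟨c, by simp⟩ := measurable_pi_apply _
  have h2 : Measurable fun x : (({i, j, l} : Finset ℕ) → 𝓧) =>
      (x ⟨i, by simp⟩, x ⟨j, by simp⟩, x ⟨l, by simp⟩) := by fun_prop
  exact h.comp h1 h2

lemma IsIID.integrable_sq_sum (hV : IsIID P V Q) {f : 𝓧 → ℝ} (hf : Measurable f)
    (hf2 : Integrable (fun v => f v ^ 2) Q) (n : ℕ) :
    Integrable (fun ω => (∑ i ∈ Finset.range n, f (V i ω)) ^ 2) P := by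
  have hL : MemLp f 2 Q := (memLp_two_iff_integrable_sq hf.aestronglyMeasurable).2 hf2
  exact (memLp_finsetSum (Finset.range n) fun i _ =>
    hL.comp_measurePreserving (hV.measurePreserving i)).integrable_sq

variable [IsProbabilityMeasure P]

lemma IsIID.isProbabilityMeasure (hV : IsIID P V Q) : IsProbabilityMeasure Q := by
  rw [← hV.law 0]
  exact Measure.isProbabilityMeasure_map (hV.meas 0).aemeasurable

lemma IsIID.measurePreserving_prodMk (hV : IsIID P V Q) {i j : ℕ} (hij : i ≠ j) :
    MeasurePreserving (fun ω => (V i ω, V j ω)) P (Q.prod Q) := by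
  refine ⟨(hV.meas i).prodMk (hV.meas j), ?_⟩
  rw [(indepFun_iff_map_prod_eq_prod_map_map (hV.meas i).aemeasurable
    (hV.meas j).aemeasurable).1 (hV.indep.indepFun hij), hV.law, hV.law]

lemma IsIID.measurePreserving_pi (hV : IsIID P V Q) (n : ℕ) :
    MeasurePreserving (fun ω (i : Fin n) => V i ω) P (Measure.pi fun _ => Q) := by
  have := hV.isProbabilityMeasure
  refine ⟨measurable_pi_lambda _ fun i => hV.meas i, ?_⟩
  have h : iIndepFun (fun i : Fin n => V i) P := hV.indep.precomp Fin.val_injective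
  rw [(iIndepFun_iff_map_fun_eq_pi_map fun i : Fin n => (hV.meas i).aemeasurable).1 h]
  simp [hV.law]

/-- Fubini for the product law. No integrability is required, since a non-integrable `F` has
integral zero by convention. -/
lemma integral_eq_zero_of_indepFun {α β : Type*} [MeasurableSpace α] [MeasurableSpace β]
    {A : Ω → α} {B : Ω → β} (hA : Measurable A) (hB : Measurable B) (h : IndepFun A B P)
    {F : α × β → ℝ} (hF : Measurable F)
    (hF0 : ∀ b, ∫ a, F (a, b) ∂(P.map A) = 0) : ∫ ω, F (A ω, B ω) ∂P = 0 := by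
  have := Measure.isProbabilityMeasure_map (μ := P) hA.aemeasurable
  have := Measure.isProbabilityMeasure_map (μ := P) hB.aemeasurable
  have hmap := (indepFun_iff_map_prod_eq_prod_map_map hA.aemeasurable hB.aemeasurable).1 h
  have h1 : ∫ ω, F (A ω, B ω) ∂P = ∫ z, F z ∂((P.map A).prod (P.map B)) := by
    rw [← hmap, integral_map (hA.prodMk hB).aemeasurable hF.aestronglyMeasurable]
  rw [h1]
  by_cases hi : Integrable F ((P.map A).prod (P.map B))
  · rw [integral_prod_symm _ hi]
    simp [hF0]
  · exact integral_undef hi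

lemma IsIID.integral_sq_sum (hV : IsIID P V Q) {f : 𝓧 → ℝ} (hf : Measurable f)
    (hf2 : Integrable (fun v => f v ^ 2) Q) (hf0 : ∫ v, f v ∂Q = 0) (n : ℕ) :
    ∫ ω, (∑ i ∈ Finset.range n, f (V i ω)) ^ 2 ∂P = n * ∫ v, f v ^ 2 ∂Q := by
  have := hV.isProbabilityMeasure
  have hL : MemLp f 2 Q := (memLp_two_iff_integrable_sq hf.aestronglyMeasurable).2 hf2
  have hLi : ∀ i, MemLp (fun ω => f (V i ω)) 2 P :=
    fun i => hL.comp_measurePreserving (hV.measurePreserving i)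
  have h0 : ∀ i, ∫ ω, f (V i ω) ∂P = 0 := fun i => by
    rw [← hf0, ← hV.law i, integral_map (hV.meas i).aemeasurable hf.aestronglyMeasurable]
  have h2 : ∀ i, ∫ ω, f (V i ω) ^ 2 ∂P = ∫ v, f v ^ 2 ∂Q := fun i => by
    rw [← hV.law i, integral_map (hV.meas i).aemeasurable (hf.pow_const 2).aestronglyMeasurable]
  have hvar := IndepFun.variance_sum (s := Finset.range n) (fun i _ => hLi i)
    fun i _ j _ hij => (hV.indep.indepFun hij).comp hf hf
  have hS0 : ∫ ω, (∑ i ∈ Finset.range n, fun ω => f (V i ω)) ω ∂P = 0 := by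
    simp only [Finset.sum_apply]
    rw [integral_finsetSum _ fun i _ => (hLi i).integrable (by norm_num)]
    simp [h0]
  have hm : ∀ i, Measurable fun ω => f (V i ω) := fun i => hf.comp (hV.meas i)
  rw [variance_of_integral_eq_zero (Finset.aemeasurable_sum _ fun i _ => (hm i).aemeasurable)
    hS0] at hvar
  simp only [Finset.sum_apply] at hvar
  rw [hvar]
  simp [variance_of_integral_eq_zero (hm _).aemeasurable (h0 _), h2]

/-- The centered sum over a triangular array of functions is negligible after any scaling that
outweighs its standard deviation. -/
lemma IsIID.tendsto_smul_sum (hV : IsIID P V Q) {f : ℕ → 𝓧 → ℝ} (hf : ∀ n, Measurable (f n))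
    (hf2 : ∀ n, Integrable (fun v => f n v ^ 2) Q) (hf0 : ∀ n, ∫ v, f n v ∂Q = 0) {c : ℕ → ℝ}
    (hc : Tendsto (fun n => c n ^ 2 * n * ∫ v, f n v ^ 2 ∂Q) atTop (𝓝 0)) :
    Tendsto (fun x : ℕ × Ω => c x.1 * ∑ i ∈ Finset.range x.1, f x.1 (V i x.2)) (whp P) (𝓝 0) := by
  refine tendsto_whp_of_integral_sq
    (R := fun n ω => c n * ∑ i ∈ Finset.range n, f n (V i ω)) (fun n => ?_) ?_
  · simp only [mul_pow]
    exact (hV.integrable_sq_sum (hf n) (hf2 n) n).const_mul _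
  · simp only [mul_pow]
    refine hc.congr fun n => ?_
    rw [integral_const_mul, hV.integral_sq_sum (hf n) (hf2 n) (hf0 n)]
    ring

/-- Weak law of large numbers. -/
lemma IsIID.tendsto_mean (hV : IsIID P V Q) {f : 𝓧 → ℝ} (hf : Measurable f)
    (hf2 : Integrable (fun v => f v ^ 2) Q) :
    Tendsto (fun x : ℕ × Ω => (x.1 : ℝ)⁻¹ * ∑ i ∈ Finset.range x.1, f (V i x.2)) (whp P)
      (𝓝 (∫ v, f v ∂Q)) := by
  have := hV.isProbabilityMeasure
  have hL : MemLp f 2 Q := (memLp_two_iff_integrable_sq hf.aestronglyMeasurable).2 hf2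
  have hL' : MemLp (fun v => f v - ∫ v, f v ∂Q) 2 Q := hL.sub (memLp_const _)
  have h := hV.tendsto_smul_sum (f := fun _ v => f v - ∫ v, f v ∂Q) (c := fun n => (n : ℝ)⁻¹)
    (fun _ => hf.sub_const _) (fun _ => hL'.integrable_sq)
    (fun _ => by simp [integral_sub (hL.integrable (by norm_num)) (integrable_const _)]) (by
      have h1 := tendsto_inv_atTop_zero.comp (tendsto_natCast_atTop_atTop (R := ℝ))
      have h2 := h1.mul_const (∫ v, (f v - ∫ v, f v ∂Q) ^ 2 ∂Q)
      rw [zero_mul] at h2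
      refine h2.congr fun n => ?_
      rcases eq_or_ne (n : ℝ) 0 with hn | hn
      · simp [hn]
      · simp only [Function.comp_apply]; field_simp)
  have h1 := h.add_const (∫ v, f v ∂Q)
  rw [zero_add] at h1
  refine h1.congr' ?_
  filter_upwards [eventually_whp_of_eventually (eventually_ne_atTop 0)] with x hx
  have hx' : (x.1 : ℝ) ≠ 0 := by exact_mod_cast hx
  rw [Finset.sum_sub_distrib, mul_sub]
  simp [hx']

/-- As `{a, b}` differs from `{i, j}` and `a ≠ b`, one of `a`, `b` lies outside `{i, j}`. That
variable is independent of the three others, and integrating it out gives zero by degeneracy of the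
kernel. -/
lemma IsIID.integral_mul_eq_zero (hV : IsIID P V Q) {k : 𝓧 → 𝓧 → ℝ}
    (hk : Measurable (Function.uncurry k)) (h1 : ∀ z', ∫ z, k z z' ∂Q = 0)
    (h2 : ∀ z, ∫ z', k z z' ∂Q = 0) {i j a b : ℕ} (hab : a ≠ b)
    (hne : (a, b) ≠ (i, j)) (hne' : (b, a) ≠ (i, j)) :
    ∫ ω, k (V i ω) (V j ω) * k (V a ω) (V b ω) ∂P = 0 := by
  by_cases ha : a ≠ i ∧ a ≠ j
  · refine integral_eq_zero_of_indepFun (F := fun x : 𝓧 × 𝓧 × 𝓧 × 𝓧 =>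
      k x.2.1 x.2.2.1 * k x.1 x.2.2.2) (hV.meas a) ?_ (hV.indepFun_prod ha.1 ha.2 hab) ?_ ?_
    · exact (hV.meas i).prodMk ((hV.meas j).prodMk (hV.meas b))
    · exact (hk.comp (f := fun x : 𝓧 × 𝓧 × 𝓧 × 𝓧 => (x.2.1, x.2.2.1)) (by fun_prop)).mul
        (hk.comp (f := fun x : 𝓧 × 𝓧 × 𝓧 × 𝓧 => (x.1, x.2.2.2)) (by fun_prop))
    · intro z
      simp only [hV.law]
      rw [integral_const_mul, h1, mul_zero]
  · have hb : b ≠ i ∧ b ≠ j := by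
      simp only [ne_eq, Prod.mk.injEq] at hne hne'
      grind
    refine integral_eq_zero_of_indepFun (F := fun x : 𝓧 × 𝓧 × 𝓧 × 𝓧 =>
      k x.2.1 x.2.2.1 * k x.2.2.2 x.1) (hV.meas b) ?_ (hV.indepFun_prod hb.1 hb.2 hab.symm) ?_ ?_
    · exact (hV.meas i).prodMk ((hV.meas j).prodMk (hV.meas a))
    · exact (hk.comp (f := fun x : 𝓧 × 𝓧 × 𝓧 × 𝓧 => (x.2.1, x.2.2.1)) (by fun_prop)).mul
        (hk.comp (f := fun x : 𝓧 × 𝓧 × 𝓧 × 𝓧 => (x.2.2.2, x.1)) (by fun_prop))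
    · intro z
      simp only [hV.law]
      rw [integral_const_mul, h2, mul_zero]

lemma IsIID.memLp_kernel (hV : IsIID P V Q) {k : 𝓧 → 𝓧 → ℝ}
    (hk : Measurable (Function.uncurry k))
    (hk2 : Integrable (fun z : 𝓧 × 𝓧 => k z.1 z.2 ^ 2) (Q.prod Q)) {i j : ℕ} (hij : i ≠ j) :
    MemLp (fun ω => k (V i ω) (V j ω)) 2 P :=
  ((memLp_two_iff_integrable_sq hk.aestronglyMeasurable).2 hk2).comp_measurePreserving
    (hV.measurePreserving_prodMk hij)

lemma IsIID.integral_sq_kernel (hV : IsIID P V Q) {k : 𝓧 → 𝓧 → ℝ}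
    (hk : Measurable (Function.uncurry k)) {i j : ℕ} (hij : i ≠ j) :
    ∫ ω, k (V i ω) (V j ω) ^ 2 ∂P = ∫ z, k z.1 z.2 ^ 2 ∂(Q.prod Q) := by
  have h := hV.measurePreserving_prodMk hij
  have hm : Measurable fun z : 𝓧 × 𝓧 => k z.1 z.2 ^ 2 := hk.pow_const 2
  rw [← h.map_eq, integral_map h.measurable.aemeasurable hm.aestronglyMeasurable]

lemma IsIID.integrable_sq_offDiag (hV : IsIID P V Q) {k : 𝓧 → 𝓧 → ℝ}
    (hk : Measurable (Function.uncurry k))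
    (hk2 : Integrable (fun z : 𝓧 × 𝓧 => k z.1 z.2 ^ 2) (Q.prod Q)) (n : ℕ) :
    Integrable (fun ω => (∑ p ∈ (Finset.range n).offDiag, k (V p.1 ω) (V p.2 ω)) ^ 2) P :=
  (memLp_finsetSum _ fun _ hp =>
    hV.memLp_kernel hk hk2 (Finset.mem_offDiag.1 hp).2.2).integrable_sq

/-- The second moment of a completely degenerate `U`-statistic. -/
lemma IsIID.integral_sq_offDiag_le (hV : IsIID P V Q) {k : 𝓧 → 𝓧 → ℝ}
    (hk : Measurable (Function.uncurry k))
    (hk2 : Integrable (fun z : 𝓧 × 𝓧 => k z.1 z.2 ^ 2) (Q.prod Q))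
    (h1 : ∀ z', ∫ z, k z z' ∂Q = 0) (h2 : ∀ z, ∫ z', k z z' ∂Q = 0) (n : ℕ) :
    ∫ ω, (∑ p ∈ (Finset.range n).offDiag, k (V p.1 ω) (V p.2 ω)) ^ 2 ∂P ≤
      2 * n ^ 2 * ∫ z, k z.1 z.2 ^ 2 ∂(Q.prod Q) := by
  set S := (Finset.range n).offDiag with hS
  set I := ∫ z, k z.1 z.2 ^ 2 ∂(Q.prod Q) with hI
  have hI0 : 0 ≤ I := integral_nonneg fun _ => sq_nonneg _
  have hne : ∀ p ∈ S, p.1 ≠ p.2 := fun p hp => (Finset.mem_offDiag.1 hp).2.2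
  have hint : ∀ p ∈ S, ∀ q ∈ S, Integrable
      (fun ω => k (V p.1 ω) (V p.2 ω) * k (V q.1 ω) (V q.2 ω)) P := fun p hp q hq =>
    (hV.memLp_kernel hk hk2 (hne p hp)).integrable_mul (hV.memLp_kernel hk hk2 (hne q hq))
  have hbound : ∀ p ∈ S, ∀ q ∈ S,
      ∫ ω, k (V p.1 ω) (V p.2 ω) * k (V q.1 ω) (V q.2 ω) ∂P ≤ I := by
    intro p hp q hq
    have hp2 := (hV.memLp_kernel hk hk2 (hne p hp)).integrable_sq
    have hq2 := (hV.memLp_kernel hk hk2 (hne q hq)).integrable_sq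
    have : ∫ ω, k (V p.1 ω) (V p.2 ω) * k (V q.1 ω) (V q.2 ω) ∂P ≤
        ∫ ω, (k (V p.1 ω) (V p.2 ω) ^ 2 + k (V q.1 ω) (V q.2 ω) ^ 2) / 2 ∂P := by
      refine integral_mono (hint p hp q hq) ((hp2.add hq2).div_const 2) fun ω => ?_
      have := sq_nonneg (k (V p.1 ω) (V p.2 ω) - k (V q.1 ω) (V q.2 ω))
      simp only
      linarith
    refine this.trans_eq ?_
    rw [integral_div, integral_add hp2 hq2, hV.integral_sq_kernel hk (hne p hp),
      hV.integral_sq_kernel hk (hne q hq)]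
    ring
  -- A pair is correlated only with itself and with its swap, which is the source of the factor 2.
  have hrow : ∀ p ∈ S, ∑ q ∈ S,
      ∫ ω, k (V p.1 ω) (V p.2 ω) * k (V q.1 ω) (V q.2 ω) ∂P ≤ 2 * I := by
    intro p hp
    calc ∑ q ∈ S, ∫ ω, k (V p.1 ω) (V p.2 ω) * k (V q.1 ω) (V q.2 ω) ∂P
        ≤ ∑ q ∈ S, if q = p ∨ q = p.swap then I else 0 := by
          refine Finset.sum_le_sum fun q hq => ?_
          split_ifs with hpq
          · exact hbound p hp q hq
          · refine (hV.integral_mul_eq_zero hk h1 h2 (hne q hq) ?_ ?_).le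
            · exact fun h => hpq (Or.inl h)
            · exact fun h => hpq (Or.inr (by rw [← Prod.swap_swap q]; exact congrArg _ h))
      _ = ((S.filter fun q => q = p ∨ q = p.swap).card : ℝ) * I := by
          rw [← Finset.sum_filter, Finset.sum_const, nsmul_eq_mul]
      _ ≤ 2 * I := by
          refine mul_le_mul_of_nonneg_right ?_ hI0
          have : (S.filter fun q => q = p ∨ q = p.swap).card ≤ 2 :=
            (Finset.card_le_card (t := {p, p.swap}) fun q hq => by
              simpa using (Finset.mem_filter.1 hq).2).trans Finset.card_le_two
          exact_mod_cast this
  calc ∫ ω, (∑ p ∈ S, k (V p.1 ω) (V p.2 ω)) ^ 2 ∂P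
      = ∑ p ∈ S, ∑ q ∈ S, ∫ ω, k (V p.1 ω) (V p.2 ω) * k (V q.1 ω) (V q.2 ω) ∂P := by
        simp_rw [sq, Finset.sum_mul_sum]
        rw [integral_finsetSum _ fun p hp => integrable_finsetSum _ fun q hq => hint p hp q hq]
        exact Finset.sum_congr rfl fun p hp => integral_finsetSum _ fun q hq => hint p hp q hq
    _ ≤ ∑ p ∈ S, 2 * I := Finset.sum_le_sum hrow
    _ = S.card * (2 * I) := by rw [Finset.sum_const, nsmul_eq_mul]
    _ ≤ n ^ 2 * (2 * I) := by
        refine mul_le_mul_of_nonneg_right ?_ (by positivity)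
        have : S.card ≤ n ^ 2 := by rw [hS, Finset.offDiag_card, Finset.card_range, sq]; omega
        exact_mod_cast this
    _ = 2 * n ^ 2 * I := by ring

end IID

end TransModel

namespace TransModel

/-! ### A `V`-statistic with a non-integrable diagonal -/

/-- A square integrable kernel that is centered in its first argument. -/
structure IsCenteredKernel {𝓧 : Type*} [MeasurableSpace 𝓧] (Q : Measure 𝓧)
    (k : 𝓧 → 𝓧 → ℝ) : Prop where
  meas : Measurable (Function.uncurry k)
  sq_int : Integrable (fun z : 𝓧 × 𝓧 => k z.1 z.2 ^ 2) (Q.prod Q)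
  int_left : ∀ z', Integrable (fun z => k z z') Q
  centered : ∀ z', ∫ z, k z z' ∂Q = 0

section Kernel

variable {𝓧 : Type*} [MeasurableSpace 𝓧] {Q : Measure 𝓧}
  {k : 𝓧 → 𝓧 → ℝ}

/-- Jensen's inequality, from nonnegativity of the variance. Measurability of `f` is not assumed; if
`f` is not integrable, the left side is zero. -/
lemma sq_integral_le_integral_sq {α : Type*} [MeasurableSpace α] {μ : Measure α}
    [IsProbabilityMeasure μ] {f : α → ℝ} (hf : Integrable (fun a => f a ^ 2) μ) :
    (∫ a, f a ∂μ) ^ 2 ≤ ∫ a, f a ^ 2 ∂μ := by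
  by_cases hi : Integrable f μ
  · set c := ∫ a, f a ∂μ with hc
    have h0 : 0 ≤ ∫ a, (f a ^ 2 - 2 * c * f a + c ^ 2) ∂μ :=
      integral_nonneg fun a => by
        have : f a ^ 2 - 2 * c * f a + c ^ 2 = (f a - c) ^ 2 := by ring
        simp only [Pi.zero_apply, this]
        positivity
    have hs : Integrable (fun a => f a ^ 2 - 2 * c * f a) μ := hf.sub (hi.const_mul _)
    rw [integral_add hs (integrable_const _),
      integral_sub hf (hi.const_mul _), integral_const_mul, ← hc] at h0
    simp at h0
    nlinarith
  · rw [integral_undef hi]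
    simpa using integral_nonneg fun a => sq_nonneg (f a)

namespace IsCenteredKernel

lemma memLp (hk : IsCenteredKernel Q k) : MemLp (Function.uncurry k) 2 (Q.prod Q) :=
  (memLp_two_iff_integrable_sq hk.meas.aestronglyMeasurable).2 hk.sq_int

/-- A factor depending on the second argument alone does not disturb centering in the first. This is
why the truncation below is made in the second argument. -/
lemma mul_right (hk : IsCenteredKernel Q k) {g : 𝓧 → ℝ} (hg : Measurable g) {C : ℝ}
    (hg1 : ∀ z, |g z| ≤ C) : IsCenteredKernel Q fun z z' => g z' * k z z' where
  meas := (hg.comp measurable_snd).mul hk.meas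
  sq_int := by
    refine (hk.sq_int.const_mul (C ^ 2)).mono'
      (((hg.comp measurable_snd).mul hk.meas).pow_const 2).aestronglyMeasurable
      (Eventually.of_forall fun z => ?_)
    have : g z.2 ^ 2 ≤ C ^ 2 := sq_le_sq' (abs_le.1 (hg1 _)).1 (abs_le.1 (hg1 _)).2
    simp only [mul_pow]
    rw [Real.norm_of_nonneg (by positivity)]
    gcongr
  int_left z' := (hk.int_left z').const_mul _
  centered z' := by rw [integral_const_mul, hk.centered, mul_zero]

variable [IsProbabilityMeasure Q]

lemma integrable (hk : IsCenteredKernel Q k) : Integrable (Function.uncurry k) (Q.prod Q) :=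
  hk.memLp.integrable (by norm_num)

lemma measurable_integral (hk : IsCenteredKernel Q k) : Measurable fun z => ∫ z', k z z' ∂Q :=
  (hk.meas.stronglyMeasurable.integral_prod_right (ν := Q)).measurable

lemma sq_integral_ae_le (hk : IsCenteredKernel Q k) :
    ∀ᵐ z ∂Q, (∫ z', k z z' ∂Q) ^ 2 ≤ ∫ z', k z z' ^ 2 ∂Q := by
  filter_upwards [hk.sq_int.prod_right_ae] with z hz
  exact sq_integral_le_integral_sq hz

lemma integrable_sq_integral (hk : IsCenteredKernel Q k) :
    Integrable (fun z => (∫ z', k z z' ∂Q) ^ 2) Q := by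
  refine hk.sq_int.integral_prod_left.mono'
    (hk.measurable_integral.pow_const 2).aestronglyMeasurable ?_
  filter_upwards [hk.sq_integral_ae_le] with z hz
  rwa [Real.norm_of_nonneg (sq_nonneg _)]

lemma integral_sq_integral_le (hk : IsCenteredKernel Q k) :
    ∫ z, (∫ z', k z z' ∂Q) ^ 2 ∂Q ≤ ∫ z, k z.1 z.2 ^ 2 ∂(Q.prod Q) := by
  rw [integral_prod _ hk.sq_int]
  exact integral_mono_ae hk.integrable_sq_integral hk.sq_int.integral_prod_left
    hk.sq_integral_ae_le

/-- The projection is again centered: exchange the integrals and use centering in the first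
argument. -/
lemma integral_integral (hk : IsCenteredKernel Q k) : ∫ z, ∫ z', k z z' ∂Q ∂Q = 0 := by
  have h1 := integral_prod _ hk.integrable
  have h2 := integral_prod_symm _ hk.integrable
  simp only [Function.uncurry_apply_pair, hk.centered, integral_zero] at h1 h2
  rw [← h1, h2]

/-- From `(a - b)² ≤ 2a² + 2b²` and the fact that projection contracts the `L²` norm; hence the
constant 4. -/
lemma memLp_sub (hk : IsCenteredKernel Q k) :
    Integrable (fun z : 𝓧 × 𝓧 => (k z.1 z.2 - ∫ z', k z.1 z' ∂Q) ^ 2) (Q.prod Q) ∧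
    ∫ z, (k z.1 z.2 - ∫ z', k z.1 z' ∂Q) ^ 2 ∂(Q.prod Q) ≤
      4 * ∫ z, k z.1 z.2 ^ 2 ∂(Q.prod Q) := by
  have hD : Integrable (fun z : 𝓧 × 𝓧 => (∫ z', k z.1 z' ∂Q) ^ 2) (Q.prod Q) :=
    hk.integrable_sq_integral.comp_fst Q
  have hDi : ∫ z : 𝓧 × 𝓧, (∫ z', k z.1 z' ∂Q) ^ 2 ∂(Q.prod Q) =
      ∫ z, (∫ z', k z z' ∂Q) ^ 2 ∂Q := by
    rw [integral_prod _ hD]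
    simp
  have hle : ∀ z : 𝓧 × 𝓧, (k z.1 z.2 - ∫ z', k z.1 z' ∂Q) ^ 2 ≤
      2 * k z.1 z.2 ^ 2 + 2 * (∫ z', k z.1 z' ∂Q) ^ 2 := fun z => by
    nlinarith [sq_nonneg (k z.1 z.2 + ∫ z', k z.1 z' ∂Q)]
  have hI := (hk.sq_int.const_mul 2).add (hD.const_mul 2)
  have hint : Integrable (fun z : 𝓧 × 𝓧 => (k z.1 z.2 - ∫ z', k z.1 z' ∂Q) ^ 2) (Q.prod Q) := by
    refine hI.mono' ((hk.meas.sub (hk.measurable_integral.comp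
      measurable_fst)).pow_const 2).aestronglyMeasurable (Eventually.of_forall fun z => ?_)
    rw [Real.norm_of_nonneg (sq_nonneg _)]
    exact hle z
  refine ⟨hint, (integral_mono hint hI hle).trans ?_⟩
  simp only [Pi.add_apply]
  rw [integral_add (hk.sq_int.const_mul 2) (hD.const_mul 2), integral_const_mul,
    integral_const_mul, hDi]
  linarith [hk.integral_sq_integral_le]

/-- Subtracting the projection keeps the kernel centered in the first argument, because the
projection has mean zero. With `integral_sub_right` the difference is completely degenerate. -/
lemma integral_sub_left (hk : IsCenteredKernel Q k) (z' : 𝓧) :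
    ∫ z, (k z z' - ∫ z'', k z z'' ∂Q) ∂Q = 0 := by
  have hi : Integrable (fun z => ∫ z'', k z z'' ∂Q) Q := hk.integrable.integral_prod_left
  rw [integral_sub (hk.int_left z') hi, hk.centered, zero_sub, neg_eq_zero]
  exact hk.integral_integral

/-- Valid for every `z`, not only almost every one: if the section at `z` is not integrable, its
integral is zero by convention, and so is that of the difference. -/
lemma integral_sub_right (z : 𝓧) : ∫ z', (k z z' - ∫ z'', k z z'' ∂Q) ∂Q = 0 := by
  by_cases hi : Integrable (fun z' => k z z') Q
  · rw [integral_sub hi (integrable_const _)]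
    simp
  · rw [integral_undef hi]
    simpa using integral_undef hi

end IsCenteredKernel

end Kernel

lemma sum_sum_eq_offDiag {n : ℕ} (F : ℕ → ℕ → ℝ) :
    ∑ i ∈ Finset.range n, ∑ j ∈ Finset.range n, F i j =
      ∑ i ∈ Finset.range n, F i i + ∑ p ∈ (Finset.range n).offDiag, F p.1 p.2 := by
  rw [← Finset.sum_product', ← Finset.diag_union_offDiag,
    Finset.sum_union (Finset.disjoint_diag_offDiag _), Finset.sum_diag]

/-- Each index occurs `n - 1` times as a first component, not `n` times; the missing copy of the
projection has to be shown negligible in `IsIID.tendsto_vStatistic`. -/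
lemma sum_offDiag_fst {n : ℕ} (f : ℕ → ℝ) :
    ∑ p ∈ (Finset.range n).offDiag, f p.1 = (n - 1) * ∑ i ∈ Finset.range n, f i := by
  have h := sum_sum_eq_offDiag (n := n) fun i _ => f i
  simp only [Finset.sum_const, Finset.card_range, nsmul_eq_mul, ← Finset.mul_sum] at h
  linarith

section VStat

variable {Ω 𝓧 : Type*} [MeasurableSpace Ω] [MeasurableSpace 𝓧] {P : Measure Ω}
  [IsProbabilityMeasure P] {V : ℕ → Ω → 𝓧} {Q : Measure 𝓧}

lemma tendsto_inv_natCast_mul (C : ℝ) : Tendsto (fun n : ℕ => (n : ℝ)⁻¹ * C) atTop (𝓝 0) := by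
  simpa using (tendsto_inv_atTop_zero.comp (tendsto_natCast_atTop_atTop (R := ℝ))).mul_const C

lemma tendsto_sqrt_natCast : Tendsto (fun n : ℕ => √(n : ℝ)) atTop atTop :=
  Real.tendsto_sqrt_atTop.comp tendsto_natCast_atTop_atTop

/-- For a degenerate `U`-statistic the projection is the sum of the conditional expectations. -/
lemma IsIID.tendsto_offDiag (hV : IsIID P V Q) [IsProbabilityMeasure Q] {k : ℕ → 𝓧 → 𝓧 → ℝ}
    (hk : ∀ n, IsCenteredKernel Q (k n)) {C : ℝ}
    (hC : ∀ n, ∫ z, k n z.1 z.2 ^ 2 ∂(Q.prod Q) ≤ C) :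
    Tendsto (fun x : ℕ × Ω => (x.1 : ℝ)⁻¹ * (√x.1)⁻¹ *
      ∑ p ∈ (Finset.range x.1).offDiag,
        (k x.1 (V p.1 x.2) (V p.2 x.2) - ∫ z', k x.1 (V p.1 x.2) z' ∂Q)) (whp P) (𝓝 0) := by
  have hHm : ∀ n, Measurable (Function.uncurry fun z z' => k n z z' - ∫ z'', k n z z'' ∂Q) :=
    fun n => (hk n).meas.sub ((hk n).measurable_integral.comp measurable_fst)
  refine tendsto_whp_of_integral_sq (R := fun n ω => (n : ℝ)⁻¹ * (√n)⁻¹ *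
      ∑ p ∈ (Finset.range n).offDiag,
        (k n (V p.1 ω) (V p.2 ω) - ∫ z', k n (V p.1 ω) z' ∂Q)) (fun n => ?_) ?_
  · simp_rw [mul_pow _ (∑ p ∈ _, _)]
    exact (hV.integrable_sq_offDiag (k := fun z z' => k n z z' - ∫ z'', k n z z'' ∂Q)
      (hHm n) (hk n).memLp_sub.1 n).const_mul _
  -- The second moment is at most `n⁻³ · 2n² · 4C = 8C/n`, combining the degenerate `U`-statistic
  -- bound with the factor 4 from `memLp_sub`.
  · refine squeeze_zero (fun n => integral_nonneg fun ω => sq_nonneg _) (fun n => ?_)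
      (tendsto_inv_natCast_mul (8 * C))
    simp_rw [mul_pow _ (∑ p ∈ _, _)]
    rw [integral_const_mul]
    have h1 := hV.integral_sq_offDiag_le (k := fun z z' => k n z z' - ∫ z'', k n z z'' ∂Q)
      (hHm n) (hk n).memLp_sub.1 (hk n).integral_sub_left
      (fun z => IsCenteredKernel.integral_sub_right z) n
    have h2 := (hk n).memLp_sub.2
    rcases eq_or_ne (n : ℝ) 0 with hn | hn
    · simp [hn]
    calc ((n : ℝ)⁻¹ * (√n)⁻¹) ^ 2 * _
        ≤ ((n : ℝ)⁻¹ * (√n)⁻¹) ^ 2 * (2 * n ^ 2 * (4 * C)) := by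
          refine mul_le_mul_of_nonneg_left (h1.trans ?_) (sq_nonneg _)
          exact mul_le_mul_of_nonneg_left (h2.trans (by linarith [hC n])) (by positivity)
      _ = (n : ℝ)⁻¹ * (8 * C) := by
          rw [mul_pow, inv_pow, inv_pow, Real.sq_sqrt (Nat.cast_nonneg n)]
          field_simp
          ring

/-- A `V`-statistic whose kernel is centered in the first argument, and for which the sums over
the first argument are uniformly of the order `√n`, is asymptotically linear. No integrability of
the kernel on the diagonal is required. -/
lemma IsIID.tendsto_vStatistic (hV : IsIID P V Q) {k : 𝓧 → 𝓧 → ℝ} (hk : IsCenteredKernel Q k)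
    (hsup : ∀ b : ℕ → ℝ, Tendsto b atTop atTop → ∀ᶠ x in whp P, ∀ z',
      |∑ i ∈ Finset.range x.1, k (V i x.2) z'| ≤ b x.1 * √x.1) :
    Tendsto (fun x : ℕ × Ω =>
      (x.1 : ℝ)⁻¹ * (√x.1)⁻¹ *
        ∑ i ∈ Finset.range x.1, ∑ j ∈ Finset.range x.1, k (V i x.2) (V j x.2)
      - (√x.1)⁻¹ * ∑ i ∈ Finset.range x.1, ∫ z', k (V i x.2) z' ∂Q) (whp P) (𝓝 0) := by
  have hQ := hV.isProbabilityMeasure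
  set I := ∫ z, k z.1 z.2 ^ 2 ∂(Q.prod Q) with hI
  have hdiag : Measurable fun v => k v v := hk.meas.comp (measurable_id.prodMk measurable_id)
  -- The truncation level `n^{1/4}` diverges, so the discarded part of the kernel vanishes in the
  -- limit. It also satisfies `m n / √n → 0`, so a diagonal bounded by `m n` is negligible.
  set m : ℕ → ℝ := fun n => √√n with hm
  have hm_top : Tendsto m atTop atTop := Real.tendsto_sqrt_atTop.comp tendsto_sqrt_natCast
  set B : ℕ → Set 𝓧 := fun n => {v | m n < |k v v|} with hB
  have hBm : ∀ n, MeasurableSet (B n) := fun n => measurableSet_lt measurable_const hdiag.abs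
  set g₂ : ℕ → 𝓧 → ℝ := fun n => (B n).indicator 1 with hg₂
  have hg₂m : ∀ n, Measurable (g₂ n) := fun n => measurable_one.indicator (hBm n)
  have hg₂0 : ∀ n v, 0 ≤ g₂ n v := fun n v => indicator_nonneg (fun _ _ => zero_le_one) v
  have hg₂1 : ∀ n v, g₂ n v ≤ 1 := fun n v => indicator_le_self' (fun _ _ => zero_le_one) v
  have hg₂lim : ∀ v, ∀ᶠ n in atTop, g₂ n v = 0 := fun v => by
    filter_upwards [hm_top.eventually_ge_atTop |k v v|] with n hn
    simp [hg₂, hB, hn]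
  have hk₁ : ∀ n, IsCenteredKernel Q fun z z' => (1 - g₂ n z') * k z z' := fun n =>
    hk.mul_right (measurable_const.sub (hg₂m n)) (C := 1) fun z => by
      rw [abs_le]; constructor <;> linarith [hg₂0 n z, hg₂1 n z]
  have hk₂ : ∀ n, IsCenteredKernel Q fun z z' => g₂ n z' * k z z' := fun n =>
    hk.mul_right (hg₂m n) (C := 1) fun z => by
      rw [abs_le]; constructor <;> linarith [hg₂0 n z, hg₂1 n z]
  have hI₁ : ∀ n, ∫ z : 𝓧 × 𝓧, ((1 - g₂ n z.2) * k z.1 z.2) ^ 2 ∂(Q.prod Q) ≤ I := fun n => by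
    refine integral_mono (hk₁ n).sq_int hk.sq_int fun z => ?_
    simp only [mul_pow]
    refine mul_le_of_le_one_left (sq_nonneg _) ?_
    have := hg₂0 n z.2
    have := hg₂1 n z.2
    nlinarith
  have hI₂ : Tendsto (fun n => ∫ z : 𝓧 × 𝓧, (g₂ n z.2 * k z.1 z.2) ^ 2 ∂(Q.prod Q)) atTop
      (𝓝 0) := by
    have := tendsto_integral_of_dominated_convergence (μ := Q.prod Q) (f := fun _ => (0 : ℝ))
      (F := fun n (z : 𝓧 × 𝓧) => (g₂ n z.2 * k z.1 z.2) ^ 2) (fun z => k z.1 z.2 ^ 2)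
      (fun n => ((hk₂ n).meas.pow_const 2).aestronglyMeasurable) hk.sq_int
      (fun n => Eventually.of_forall fun z => by
        rw [Real.norm_of_nonneg (sq_nonneg _), mul_pow]
        refine mul_le_of_le_one_left (sq_nonneg _) ?_
        have := hg₂0 n z.2
        have := hg₂1 n z.2
        nlinarith)
      (Eventually.of_forall fun z => tendsto_const_nhds.congr' (by
        filter_upwards [hg₂lim z.2] with n hn
        simp [hn]))
    simpa using this
  set p : ℕ → ℝ := fun n => ∫ v, g₂ n v ∂Q with hp
  have hg₂i : ∀ n, Integrable (g₂ n) Q := fun n =>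
    (integrable_const (1 : ℝ)).mono' (hg₂m n).aestronglyMeasurable
      (Eventually.of_forall fun v => by
        rw [Real.norm_of_nonneg (hg₂0 n v)]; exact hg₂1 n v)
  have hp0 : ∀ n, 0 ≤ p n := fun n => integral_nonneg (hg₂0 n)
  have hp_lim : Tendsto p atTop (𝓝 0) := by
    have := tendsto_integral_of_dominated_convergence (μ := Q) (f := fun _ => (0 : ℝ))
      (F := g₂) (fun _ => (1 : ℝ)) (fun n => (hg₂m n).aestronglyMeasurable)
      (integrable_const _) (fun n => Eventually.of_forall fun v => by
        rw [Real.norm_of_nonneg (hg₂0 n v)]; exact hg₂1 n v)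
      (Eventually.of_forall fun v => tendsto_const_nhds.congr' (by
        filter_upwards [hg₂lim v] with n hn
        exact hn.symm))
    simpa using this
  -- The summand `1/(n+1)` only makes `q n` positive. Then `b n = q n ^ (-1/2)` diverges while `b n
  -- * p n ≤ √(q n) → 0`; a rate tuned to `p` is available because `hsup` holds for every diverging
  -- sequence.
  set q : ℕ → ℝ := fun n => p n + 1 / ((n : ℝ) + 1) with hq
  have hq0 : ∀ n, 0 < q n := fun n => add_pos_of_nonneg_of_pos (hp0 n) (by positivity)
  have hq_lim : Tendsto q atTop (𝓝 0) := by
    have := hp_lim.add (tendsto_one_div_add_atTop_nhds_zero_nat (𝕜 := ℝ))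
    rwa [add_zero] at this
  have hsq_lim : Tendsto (fun n => √(q n)) atTop (𝓝 0) := by
    have := (Real.continuous_sqrt.tendsto 0).comp hq_lim
    rwa [Real.sqrt_zero] at this
  set b : ℕ → ℝ := fun n => (√(q n))⁻¹ with hb
  have hb0 : ∀ n, 0 ≤ b n := fun n => by positivity
  have hb_top : Tendsto b atTop atTop :=
    tendsto_inv_nhdsGT_zero.comp (tendsto_nhdsWithin_iff.2
      ⟨hsq_lim, Eventually.of_forall fun n => Real.sqrt_pos.2 (hq0 n)⟩)
  have hbp : Tendsto (fun n => b n * p n) atTop (𝓝 0) := by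
    refine squeeze_zero (fun n => mul_nonneg (hb0 n) (hp0 n)) (fun n => ?_) hsq_lim
    have h1 : p n ≤ q n := le_add_of_nonneg_right (by positivity)
    have h2 : 0 < √(q n) := Real.sqrt_pos.2 (hq0 n)
    calc b n * p n ≤ (√(q n))⁻¹ * q n := by gcongr
      _ = √(q n) := by
        rw [inv_mul_eq_div, div_eq_iff h2.ne', Real.mul_self_sqrt (hq0 n).le]
  -- the part of the kernel with a large diagonal
  have hE₁ : Tendsto (fun x : ℕ × Ω => (x.1 : ℝ)⁻¹ * (√x.1)⁻¹ * ∑ i ∈ Finset.range x.1,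
      ∑ j ∈ Finset.range x.1, g₂ x.1 (V j x.2) * k (V i x.2) (V j x.2)) (whp P) (𝓝 0) := by
    have hF : Tendsto (fun x : ℕ × Ω => b x.1 * ((x.1 : ℝ)⁻¹ *
        ∑ j ∈ Finset.range x.1, g₂ x.1 (V j x.2))) (whp P) (𝓝 0) := by
      have hgP : ∀ n j, Integrable (fun ω => g₂ n (V j ω)) P := fun n j =>
        (hV.measurePreserving j).integrable_comp_of_integrable (hg₂i n)
      have hgE : ∀ n j, ∫ ω, g₂ n (V j ω) ∂P = p n := fun n j => by
        simp only [hp]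
        rw [← hV.law j, integral_map (hV.meas j).aemeasurable (hg₂m n).aestronglyMeasurable]
      refine tendsto_whp_of_integral_abs (R := fun n ω => b n * ((n : ℝ)⁻¹ *
        ∑ j ∈ Finset.range n, g₂ n (V j ω))) (fun n => ?_) ?_
      · exact ((integrable_finsetSum _ fun j _ => hgP n j).const_mul _).const_mul _
      · refine squeeze_zero (fun n => integral_nonneg fun _ => abs_nonneg _) (fun n => ?_) hbp
        have h0 : ∀ ω, 0 ≤ b n * ((n : ℝ)⁻¹ * ∑ j ∈ Finset.range n, g₂ n (V j ω)) := fun ω =>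
          mul_nonneg (hb0 n) (mul_nonneg (by positivity)
            (Finset.sum_nonneg fun j _ => hg₂0 n _))
        simp_rw [abs_of_nonneg (h0 _)]
        rw [integral_const_mul, integral_const_mul, integral_finsetSum _ fun j _ => hgP n j]
        simp only [hgE, Finset.sum_const, Finset.card_range, nsmul_eq_mul]
        refine mul_le_mul_of_nonneg_left ?_ (hb0 n)
        rw [← mul_assoc]
        exact mul_le_of_le_one_left (hp0 n) inv_mul_le_one
    refine squeeze_zero_norm' ?_ hF
    filter_upwards [hsup b hb_top] with x hx
    -- The inner sum now runs over the first argument. The bound `hsup` is uniform in `z'`, so it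
    -- may be used at `z' = V j`, although this point depends on the same sample.
    rw [Finset.sum_comm]
    simp_rw [← Finset.mul_sum]
    rw [norm_mul, Real.norm_of_nonneg (by positivity), Real.norm_eq_abs]
    have h1 : |∑ j ∈ Finset.range x.1, g₂ x.1 (V j x.2) *
        ∑ i ∈ Finset.range x.1, k (V i x.2) (V j x.2)| ≤
        ∑ j ∈ Finset.range x.1, g₂ x.1 (V j x.2) * (b x.1 * √x.1) := by
      refine (Finset.abs_sum_le_sum_abs _ _).trans (Finset.sum_le_sum fun j _ => ?_)
      rw [abs_mul, abs_of_nonneg (hg₂0 _ _)]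
      exact mul_le_mul_of_nonneg_left (hx _) (hg₂0 _ _)
    refine (mul_le_mul_of_nonneg_left h1 (by positivity)).trans ?_
    rw [← Finset.sum_mul]
    have h2 : (√(x.1 : ℝ))⁻¹ * √x.1 ≤ 1 := inv_mul_le_one
    have h3 : 0 ≤ b x.1 * ((x.1 : ℝ)⁻¹ * ∑ j ∈ Finset.range x.1, g₂ x.1 (V j x.2)) :=
      mul_nonneg (hb0 _) (mul_nonneg (by positivity) (Finset.sum_nonneg fun j _ => hg₂0 _ _))
    calc _ = ((√(x.1 : ℝ))⁻¹ * √x.1) *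
          (b x.1 * ((x.1 : ℝ)⁻¹ * ∑ j ∈ Finset.range x.1, g₂ x.1 (V j x.2))) := by ring
      _ ≤ _ := mul_le_of_le_one_left h3 h2
  -- the diagonal of the remaining part
  have hE₂ : Tendsto (fun x : ℕ × Ω => (x.1 : ℝ)⁻¹ * (√x.1)⁻¹ * ∑ i ∈ Finset.range x.1,
      (1 - g₂ x.1 (V i x.2)) * k (V i x.2) (V i x.2)) (whp P) (𝓝 0) := by
    have hlim : Tendsto (fun n : ℕ => (m n)⁻¹) atTop (𝓝 0) := tendsto_inv_atTop_zero.comp hm_top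
    refine squeeze_zero_norm (fun x => ?_) (tendsto_whp_of_tendsto (P := P) hlim)
    have h1 : |∑ i ∈ Finset.range x.1, (1 - g₂ x.1 (V i x.2)) * k (V i x.2) (V i x.2)| ≤
        x.1 * m x.1 := by
      refine (Finset.abs_sum_le_sum_abs _ _).trans ((Finset.sum_le_sum (g := fun _ => m x.1)
        fun i _ => ?_).trans_eq (by simp))
      by_cases hi : V i x.2 ∈ B x.1
      · simp [hg₂, hi, hm]
      · simpa [hg₂, hi] using not_lt.1 hi
    rw [norm_mul, Real.norm_of_nonneg (by positivity), Real.norm_eq_abs]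
    rcases eq_or_ne x.1 0 with hn | hn
    · simp [hn, hm]
    have hn' : (0 : ℝ) < x.1 := by positivity
    refine (mul_le_mul_of_nonneg_left h1 (by positivity)).trans_eq ?_
    have hs : √(x.1 : ℝ) = m x.1 * m x.1 := (Real.mul_self_sqrt (Real.sqrt_nonneg _)).symm
    have hmp : 0 < m x.1 := Real.sqrt_pos.2 (Real.sqrt_pos.2 hn')
    rw [hs]
    field_simp
  -- Off the diagonal, the truncated kernel minus its projection is degenerate, with second moments
  -- bounded by `I` uniformly in `n`.
  have hE₃ := hV.tendsto_offDiag hk₁ hI₁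
  have hdsub : ∀ n, (fun z => (∫ z', (1 - g₂ n z') * k z z' ∂Q) - ∫ z', k z z' ∂Q) =ᵐ[Q]
      fun z => - ∫ z', g₂ n z' * k z z' ∂Q := fun n => by
    filter_upwards [hk.integrable.prod_right_ae, (hk₁ n).integrable.prod_right_ae] with z h1 h2
    simp only [Function.uncurry_apply_pair] at h1 h2
    rw [← integral_sub h2 h1, ← integral_neg]
    refine integral_congr_ae (Eventually.of_forall fun z' => ?_)
    ring
  -- Truncation does not change the projection asymptotically: the difference is the projection of
  -- the discarded part, whose `L²` norm tends to zero by `hI₂`.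
  have hE₄ := hV.tendsto_smul_sum (c := fun n => (√(n : ℝ))⁻¹)
    (f := fun n z => (∫ z', (1 - g₂ n z') * k z z' ∂Q) - ∫ z', k z z' ∂Q)
    (fun n => (hk₁ n).measurable_integral.sub hk.measurable_integral)
    (fun n => (integrable_congr ((hdsub n).mono fun z hz => by simp only [hz, neg_sq])).2
      (hk₂ n).integrable_sq_integral)
    (fun n => by
      rw [integral_congr_ae (hdsub n), integral_neg, (hk₂ n).integral_integral, neg_zero]) (by
      refine squeeze_zero (fun n => mul_nonneg (by positivity)
        (integral_nonneg fun _ => sq_nonneg _)) (fun n => ?_) hI₂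
      have h1 : ∫ z, ((∫ z', (1 - g₂ n z') * k z z' ∂Q) - ∫ z', k z z' ∂Q) ^ 2 ∂Q ≤
          ∫ z : 𝓧 × 𝓧, (g₂ n z.2 * k z.1 z.2) ^ 2 ∂(Q.prod Q) := by
        refine (integral_congr_ae ((hdsub n).mono fun z hz => ?_)).trans_le
          (hk₂ n).integral_sq_integral_le
        simp only [hz, neg_sq]
      refine (mul_le_of_le_one_left (integral_nonneg fun _ => sq_nonneg _) ?_).trans h1
      rw [inv_pow, Real.sq_sqrt (Nat.cast_nonneg n)]
      exact inv_mul_le_one)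
  -- The copy of the projection missing from the off-diagonal sum, which contains only `n - 1` of
  -- them.
  have hE₅ := hV.tendsto_smul_sum (c := fun n => (n : ℝ)⁻¹ * (√(n : ℝ))⁻¹)
    (f := fun n z => ∫ z', (1 - g₂ n z') * k z z' ∂Q)
    (fun n => (hk₁ n).measurable_integral) (fun n => (hk₁ n).integrable_sq_integral)
    (fun n => (hk₁ n).integral_integral) (by
      refine squeeze_zero (fun n => mul_nonneg (by positivity)
        (integral_nonneg fun _ => sq_nonneg _)) (fun n => ?_) (tendsto_inv_natCast_mul I)
      have h1 := (hk₁ n).integral_sq_integral_le.trans (hI₁ n)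
      have hI0 : 0 ≤ I := integral_nonneg fun _ => sq_nonneg _
      rcases eq_or_ne n 0 with hn | hn
      · simp [hn]
      have hn1 : (1 : ℝ) ≤ n := by exact_mod_cast Nat.one_le_iff_ne_zero.2 hn
      rw [mul_pow, inv_pow, inv_pow, Real.sq_sqrt (Nat.cast_nonneg n)]
      refine (mul_le_mul_of_nonneg_left h1 (by positivity)).trans
        (mul_le_mul_of_nonneg_right ?_ hI0)
      field_simp
      exact hn1)
  have hsum := ((((hE₁.add hE₂).add hE₃).add hE₄).sub hE₅)
  simp only [add_zero, sub_zero] at hsum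
  refine hsum.congr' ?_
  filter_upwards [eventually_whp_of_eventually (eventually_ne_atTop 0)] with x hx
  have hx' : (x.1 : ℝ) ≠ 0 := by exact_mod_cast hx
  have hdec : ∑ i ∈ Finset.range x.1, ∑ j ∈ Finset.range x.1, k (V i x.2) (V j x.2) =
      ∑ i ∈ Finset.range x.1, ∑ j ∈ Finset.range x.1, g₂ x.1 (V j x.2) * k (V i x.2) (V j x.2)
      + ∑ i ∈ Finset.range x.1, ∑ j ∈ Finset.range x.1,
        (1 - g₂ x.1 (V j x.2)) * k (V i x.2) (V j x.2) := by
    simp only [← Finset.sum_add_distrib]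
    refine Finset.sum_congr rfl fun i _ => Finset.sum_congr rfl fun j _ => by ring
  rw [hdec, sum_sum_eq_offDiag fun i j => (1 - g₂ x.1 (V j x.2)) * k (V i x.2) (V j x.2),
    Finset.sum_sub_distrib, Finset.sum_sub_distrib,
    sum_offDiag_fst fun i => ∫ z', (1 - g₂ x.1 z') * k (V i x.2) z' ∂Q]
  field_simp
  ring

end VStat

end TransModel

namespace TransModel

/-! ### Donsker classes: the empirical process is bounded in probability -/

/-- The continuous function `x ↦ min (‖x‖ - m)⁺ 1` with values in `[0, 1]`. -/
noncomputable def normExcess {E : Type*} [SeminormedAddCommGroup E] (m : ℕ) :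
    BoundedContinuousFunction E ℝ≥0 :=
  BoundedContinuousFunction.mkOfBound
    ⟨fun x => Real.toNNReal (min (‖x‖ - m) 1), by fun_prop⟩ 1 fun x y => by
      have h1 : ∀ z : E, ((min (‖z‖ - m) 1).toNNReal : ℝ) ≤ 1 := fun z => by
        rw [Real.coe_toNNReal']; exact max_le (min_le_right _ _) zero_le_one
      have h0 : ∀ z : E, (0 : ℝ) ≤ ((min (‖z‖ - m) 1).toNNReal : ℝ) := fun z => NNReal.coe_nonneg _
      rw [NNReal.dist_eq, abs_le]
      simp only [ContinuousMap.coe_mk]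
      constructor <;> linarith [h1 x, h1 y, h0 x, h0 y]

lemma normExcess_apply {E : Type*} [SeminormedAddCommGroup E] (m : ℕ) (x : E) :
    normExcess m x = Real.toNNReal (min (‖x‖ - m) 1) := rfl

/-- At a fixed point the function vanishes once `m ≥ ‖x‖`, so dominated convergence applies. -/
lemma tendsto_lintegral_normExcess {E : Type*} [SeminormedAddCommGroup E] [MeasurableSpace E]
    [BorelSpace E] (L : Measure E) [IsFiniteMeasure L] :
    Tendsto (fun m : ℕ => ∫⁻ x, (normExcess m x : ℝ≥0∞) ∂L) atTop (𝓝 0) := by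
  have h := tendsto_lintegral_of_dominated_convergence (μ := L)
    (F := fun (m : ℕ) (x : E) => (normExcess m x : ℝ≥0∞)) (f := fun _ => 0) (fun _ => 1)
    (fun m => (normExcess m).continuous.measurable.coe_nnreal_ennreal)
    (fun m => Eventually.of_forall fun x => by
      simp only [normExcess_apply]
      exact_mod_cast Real.toNNReal_le_one.2 (min_le_right _ _))
    (by simp) (Eventually.of_forall fun x => tendsto_const_nhds.congr' (by
      filter_upwards [eventually_ge_atTop ⌈‖x‖⌉₊] with m hm
      have : ‖x‖ - m ≤ 0 := by linarith [Nat.ceil_le.1 hm]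
      simp [normExcess_apply, Real.toNNReal_of_nonpos ((min_le_left _ _).trans this)]))
  simpa using h

/-- The empirical process of a Donsker class is uniformly bounded in probability. -/
lemma IsDonsker.eventually_abs_sum_le {Ω 𝓩 : Type*} [MeasurableSpace Ω] [MeasurableSpace 𝓩]
    {P : Measure Ω} [IsProbabilityMeasure P] {Z : ℕ → Ω → 𝓩} {Q : Measure 𝓩} {F : Set (𝓩 → ℝ)}
    (hF : IsDonsker F Q) (hZ : IsIID P Z Q) {b : ℕ → ℝ} (hb : Tendsto b atTop atTop) :
    ∀ᶠ x in whp P, ∀ f ∈ F,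
      |∑ i ∈ Finset.range x.1, (f (Z i x.2) - ∫ z, f z ∂Q)| ≤ b x.1 * √x.1 := by
  obtain ⟨-, G, hG, L, hL, -, hlim⟩ := hF
  rw [eventually_whp, ENNReal.tendsto_nhds_zero]
  intro ε hε
  -- A single test function suffices: `m` is chosen for the limit law, and weak convergence carries
  -- the bound `ε` over to the outer expectations for large `n`.
  obtain ⟨m, hm⟩ := ((tendsto_lintegral_normExcess L).eventually_lt_const hε).exists
  filter_upwards [(hlim (normExcess m)).eventually_lt_const hm, hb.eventually_ge_atTop (m + 1),
    eventually_gt_atTop 0] with n hn hbn hn0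
  have hpi := hZ.measurePreserving_pi n
  have hlt : P ((fun ω (i : Fin n) => Z i ω) ⁻¹'
      {z | 1 ≤ ((normExcess m (G n z) : ℝ≥0) : ℝ≥0∞)}) < ε := by
    -- The sup norm of the empirical process need not be measurable. A measurable majorant with
    -- integral below `ε` allows Markov's inequality.
    simp only [outerExpectation, iInf_lt_iff] at hn
    obtain ⟨g, hg, hfg, hlt⟩ := hn
    calc _ ≤ P ((fun ω (i : Fin n) => Z i ω) ⁻¹' {z | 1 ≤ g z}) :=
          measure_mono fun ω hω => le_trans hω (hfg _)
      _ = (Measure.pi fun _ : Fin n => Q) {z | 1 ≤ g z} :=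
          hpi.measure_preimage (measurableSet_le measurable_const hg).nullMeasurableSet
      _ ≤ ∫⁻ z, g z ∂(Measure.pi fun _ : Fin n => Q) := by
          simpa using mul_meas_ge_le_lintegral hg 1
      _ < ε := hlt
  refine (measure_mono fun ω hω => ?_).trans hlt.le
  simp only [mem_ofPred_eq, not_forall, not_le] at hω
  obtain ⟨f, hf, hlt⟩ := hω
  have hsn : 0 < √(n : ℝ) := Real.sqrt_pos.2 (by exact_mod_cast hn0)
  -- The value at one member of the class is at most the sup norm, and beyond norm `m + 1` the test
  -- function equals 1.
  have h1 : (m : ℝ) + 1 < ‖G n fun i => Z i ω‖ := by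
    refine lt_of_lt_of_le ?_ (lp.norm_apply_le_norm ENNReal.top_ne_zero
      (G n fun i => Z i ω) ⟨f, hf⟩)
    rw [hG, Real.norm_eq_abs, abs_mul, abs_inv, abs_of_pos hsn, lt_inv_mul_iff₀ hsn]
    rw [Finset.sum_range] at hlt
    refine lt_of_le_of_lt ?_ hlt
    rw [mul_comm]
    gcongr
  simp only [mem_preimage, mem_ofPred_eq, normExcess_apply]
  rw [min_eq_right (by linarith)]
  simp

end TransModel

namespace TransModel

/-! ### Bounded measurable functions -/

/-- `f` is measurable and bounded. -/
def IsBddMeas {α : Type*} [MeasurableSpace α] (f : α → ℝ) : Prop :=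
  Measurable f ∧ ∃ C, ∀ a, |f a| ≤ C

namespace IsBddMeas

variable {α : Type*} [MeasurableSpace α] {f g : α → ℝ}

lemma const (c : ℝ) : IsBddMeas fun _ : α => c := ⟨measurable_const, |c|, fun _ => le_rfl⟩

lemma add (hf : IsBddMeas f) (hg : IsBddMeas g) : IsBddMeas fun a => f a + g a := by
  obtain ⟨hf, C, hC⟩ := hf
  obtain ⟨hg, D, hD⟩ := hg
  exact ⟨hf.add hg, C + D, fun a => (abs_add_le _ _).trans (add_le_add (hC a) (hD a))⟩

lemma mul (hf : IsBddMeas f) (hg : IsBddMeas g) : IsBddMeas fun a => f a * g a := by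
  obtain ⟨hf, C, hC⟩ := hf
  obtain ⟨hg, D, hD⟩ := hg
  refine ⟨hf.mul hg, C * D, fun a => ?_⟩
  rw [abs_mul]
  exact mul_le_mul (hC a) (hD a) (abs_nonneg _) ((abs_nonneg _).trans (hC a))

lemma sub (hf : IsBddMeas f) (hg : IsBddMeas g) : IsBddMeas fun a => f a - g a := by
  simpa [sub_eq_add_neg] using hf.add ((const (-1)).mul hg)

lemma sq (hf : IsBddMeas f) : IsBddMeas fun a => f a ^ 2 := by
  simpa only [pow_two] using hf.mul hf

lemma integrable (hf : IsBddMeas f) (μ : Measure α) [IsFiniteMeasure μ] : Integrable f μ := by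
  obtain ⟨hf, C, hC⟩ := hf
  exact (integrable_const C).mono' hf.aestronglyMeasurable (Eventually.of_forall hC)

lemma comp {β : Type*} [MeasurableSpace β] (hf : IsBddMeas f) {u : β → α} (hu : Measurable u) :
    IsBddMeas fun b => f (u b) :=
  ⟨hf.1.comp hu, hf.2.imp fun _ hC b => hC (u b)⟩

lemma exists_pos_bound (hf : IsBddMeas f) : ∃ C, 0 < C ∧ ∀ a, |f a| ≤ C := by
  obtain ⟨-, C, hC⟩ := hf
  exact ⟨max C 1, by positivity, fun a => (hC a).trans (le_max_left _ _)⟩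

end IsBddMeas

lemma isBddMeas_indicator_of_continuousOn {K : Set ℝ} (hK : IsCompact K) {f : ℝ → ℝ}
    (hf : ContinuousOn f K) : IsBddMeas (K.indicator f) := by
  obtain ⟨C, hC⟩ := hK.exists_bound_of_continuousOn hf
  refine ⟨?_, max C 0, fun y => ?_⟩
  · classical
    rw [← piecewise_eq_indicator]
    exact hf.measurable_piecewise continuousOn_const hK.measurableSet
  · by_cases hy : y ∈ K
    · simpa [hy] using Or.inl (hC y hy)
    · simp [hy]

/-- Meant for `Λ θ`, which is monotone in `y` but not assumed continuous in `y`. On `K` the values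
lie between those at a lower and an upper bound of `K`. -/
lemma isBddMeas_indicator_of_monotone {K : Set ℝ} (hK : IsCompact K) {f : ℝ → ℝ}
    (hf : Monotone f) : IsBddMeas (K.indicator f) := by
  refine ⟨hf.measurable.indicator hK.measurableSet, ?_⟩
  obtain ⟨a, ha⟩ := hK.bddBelow
  obtain ⟨b, hb⟩ := hK.bddAbove
  refine ⟨max |f a| |f b|, fun y => ?_⟩
  by_cases hy : y ∈ K
  · rw [indicator_of_mem hy]
    exact abs_le_max_abs_abs (hf (ha hy)) (hf (hb hy))
  · simp [hy]

/-! ### Infima over a parameter set -/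

section Infimum

variable {α E : Type*} [PseudoMetricSpace E] [SecondCountableTopology E]

/-- By continuity in the parameter, the infimum may be taken over a countable dense subset of `S`.
-/
lemma measurable_sInf_image [MeasurableSpace α] {S : Set E} {f : E → α → ℝ}
    (hf : ∀ γ ∈ S, Measurable (f γ)) (hc : ∀ a, ContinuousOn (fun γ => f γ a) S)
    (hb : ∀ a, BddBelow ((fun γ => f γ a) '' S)) :
    Measurable fun a => sInf ((fun γ => f γ a) '' S) := by
  rcases S.eq_empty_or_nonempty with rfl | hne
  · simp
  obtain ⟨D, hDS, hDc, hSD⟩ := (TopologicalSpace.IsSeparable.of_separableSpace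
    S).exists_countable_dense_subset
  have hDne : D.Nonempty := closure_nonempty_iff.1 (hne.mono hSD)
  have heq : ∀ a, sInf ((fun γ => f γ a) '' S) = sInf ((fun γ => f γ a) '' D) := by
    intro a
    refine le_antisymm (csInf_le_csInf (hb a) (hDne.image _) (image_mono hDS))
      (le_csInf (hne.image _) ?_)
    rintro _ ⟨γ, hγ, rfl⟩
    have : (𝓝[D] γ).NeBot := mem_closure_iff_nhdsWithin_neBot.1 (hSD hγ)
    refine ge_of_tendsto ((hc a γ hγ).mono_left (nhdsWithin_mono _ hDS)) ?_
    filter_upwards [self_mem_nhdsWithin] with γ' hγ'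
    exact csInf_le ((hb a).mono (image_mono hDS)) (mem_image_of_mem _ hγ')
  simp_rw [heq]
  exact Measurable.sInf hDc fun γ hγ => hf γ (hDS hγ)

/-- Away from the unique minimizer of the expected loss, the empirical loss exceeds the minimal
expected loss by a fixed amount. -/
lemma IsIID.eventually_loss_ge {Ω 𝓧 : Type*} [MeasurableSpace Ω] [MeasurableSpace 𝓧]
    {P : Measure Ω} [IsProbabilityMeasure P] {V : ℕ → Ω → 𝓧} {Q : Measure 𝓧} (hV : IsIID P V Q)
    {S : Set E} (hS : IsCompact S) {ℓ : E → 𝓧 → ℝ} (hℓ : ∀ γ ∈ S, IsBddMeas (ℓ γ))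
    (hℓ0 : ∀ γ v, 0 ≤ ℓ γ v) (hℓc : ∀ v, ContinuousOn (fun γ => ℓ γ v) S) {γ₀ : E} {ρ : ℝ}
    (hmin : ∀ γ ∈ S, ρ ≤ dist γ γ₀ → ∫ v, ℓ γ₀ v ∂Q < ∫ v, ℓ γ v ∂Q) :
    ∃ c, 0 < c ∧ ∀ᶠ x in whp P, ∀ γ ∈ S, ρ ≤ dist γ γ₀ →
      ∫ v, ℓ γ₀ v ∂Q + c ≤ (x.1 : ℝ)⁻¹ * ∑ i ∈ Finset.range x.1, ℓ γ (V i x.2) := by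
  have hQ := hV.isProbabilityMeasure
  have hS' : IsCompact (S ∩ {γ | ρ ≤ dist γ γ₀}) :=
    hS.inter_right (isClosed_le continuous_const (continuous_id.dist continuous_const))
  suffices H : ∃ c, 0 < c ∧ ∀ᶠ x in whp P, ∀ γ ∈ S ∩ {γ | ρ ≤ dist γ γ₀},
      ∫ v, ℓ γ₀ v ∂Q + c ≤ (x.1 : ℝ)⁻¹ * ∑ i ∈ Finset.range x.1, ℓ γ (V i x.2) by
    obtain ⟨c, hc, h⟩ := H
    exact ⟨c, hc, h.mono fun x hx γ hγ hd => hx γ ⟨hγ, hd⟩⟩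
  -- Wald's argument: the property passes to subsets and finite unions, so by compactness it is
  -- enough to find a good neighbourhood of each point.
  refine hS'.induction_on (p := fun A => ∃ c, 0 < c ∧ ∀ᶠ x in whp P, ∀ γ ∈ A,
      ∫ v, ℓ γ₀ v ∂Q + c ≤ (x.1 : ℝ)⁻¹ * ∑ i ∈ Finset.range x.1, ℓ γ (V i x.2)) ?_ ?_ ?_ ?_
  · exact ⟨1, one_pos, by simp⟩
  · rintro A B hAB ⟨c, hc, h⟩
    exact ⟨c, hc, h.mono fun x hx γ hγ => hx γ (hAB hγ)⟩
  · rintro A B ⟨c, hc, h⟩ ⟨c', hc', h'⟩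
    refine ⟨min c c', lt_min hc hc', ?_⟩
    filter_upwards [h, h'] with x hx hx' γ hγ
    rcases hγ with hγ | hγ
    · exact (add_le_add_right (min_le_left _ _) _).trans (hx γ hγ)
    · exact (add_le_add_right (min_le_right _ _) _).trans (hx' γ hγ)
  · rintro γ ⟨hγS, hγd⟩
    set U : ℕ → Set E := fun m => S ∩ Metric.closedBall γ (1 / ((m : ℝ) + 1)) with hU
    -- The pointwise infimum of the loss over a small ball. The law of large numbers for this one
    -- function bounds all averages over the ball from below, so no uniform law is needed.
    set g : ℕ → 𝓧 → ℝ := fun m v => sInf ((fun γ' => ℓ γ' v) '' U m) with hg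
    have hγU : ∀ m, γ ∈ U m := fun m => ⟨hγS, Metric.mem_closedBall_self (by positivity)⟩
    have hbdd : ∀ m v, BddBelow ((fun γ' => ℓ γ' v) '' U m) := fun m v =>
      ⟨0, by rintro _ ⟨γ', -, rfl⟩; exact hℓ0 γ' v⟩
    have hgle : ∀ m v, ∀ γ' ∈ U m, g m v ≤ ℓ γ' v := fun m v γ' hγ' =>
      csInf_le (hbdd m v) (mem_image_of_mem _ hγ')
    have hg0 : ∀ m v, 0 ≤ g m v := fun m v => le_csInf (⟨γ, hγU m⟩ |> Nonempty.image _) (by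
      rintro _ ⟨γ', -, rfl⟩; exact hℓ0 γ' v)
    obtain ⟨C, hC0, hC⟩ := (hℓ γ hγS).exists_pos_bound
    have hgm : ∀ m, IsBddMeas (g m) := fun m =>
      ⟨measurable_sInf_image (fun γ' hγ' => (hℓ γ' hγ'.1).1)
        (fun v => (hℓc v).mono inter_subset_left) (hbdd m), C, fun v => by
          rw [abs_of_nonneg (hg0 m v)]
          exact (hgle m v γ (hγU m)).trans ((le_abs_self _).trans (hC v))⟩
    have hlim : Tendsto (fun m => ∫ v, g m v ∂Q) atTop (𝓝 (∫ v, ℓ γ v ∂Q)) := by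
      refine tendsto_integral_of_dominated_convergence (fun _ => C)
        (fun m => (hgm m).1.aestronglyMeasurable) (integrable_const _)
        (fun m => Eventually.of_forall fun v => ?_) (Eventually.of_forall fun v => ?_)
      · rw [Real.norm_of_nonneg (hg0 m v)]
        exact (hgle m v γ (hγU m)).trans ((le_abs_self _).trans (hC v))
      · rw [Metric.tendsto_atTop]
        intro ε hε
        obtain ⟨δ, hδ, hδ'⟩ := Metric.continuousWithinAt_iff.1 (hℓc v γ hγS) (ε / 2) (by positivity)
        obtain ⟨N, hN⟩ := exists_nat_one_div_lt hδ
        refine ⟨N, fun m hm => ?_⟩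
        have h1 : ℓ γ v - ε / 2 ≤ g m v := by
          refine le_csInf (⟨γ, hγU m⟩ |> Nonempty.image _) ?_
          rintro _ ⟨γ', hγ', rfl⟩
          have hd : dist γ' γ < δ := by
            refine (Metric.mem_closedBall.1 hγ'.2).trans_lt (lt_of_le_of_lt ?_ hN)
            have : (N : ℝ) ≤ m := by exact_mod_cast hm
            gcongr
          have := hδ' hγ'.1 hd
          rw [Real.dist_eq, abs_lt] at this
          simp only
          linarith
        have h2 := hgle m v γ (hγU m)
        rw [Real.dist_eq, abs_lt]
        constructor <;> linarith
    -- Half of the gap; the ball is then shrunk until the expected infimum loses less than the other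
    -- half.
    set c := (∫ v, ℓ γ v ∂Q - ∫ v, ℓ γ₀ v ∂Q) / 2 with hc
    have hc0 : 0 < c := by
      have := hmin γ hγS hγd
      rw [hc]; linarith
    obtain ⟨m, hm⟩ := (hlim.eventually_const_lt
      (show ∫ v, ℓ γ₀ v ∂Q + c < ∫ v, ℓ γ v ∂Q by rw [hc] at hc0 ⊢; linarith)).exists
    refine ⟨U m, ?_, c, hc0, ?_⟩
    · exact inter_mem (mem_of_superset self_mem_nhdsWithin inter_subset_left)
        (mem_nhdsWithin_of_mem_nhds (Metric.closedBall_mem_nhds γ (by positivity)))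
    · filter_upwards [(hV.tendsto_mean (hgm m).1 ((hgm m).sq.integrable Q)).eventually_const_lt hm]
        with x hx γ' hγ'
      refine hx.le.trans (mul_le_mul_of_nonneg_left (Finset.sum_le_sum fun i _ => ?_)
        (by positivity))
      exact hgle m _ γ' hγ'

end Infimum

end TransModel

namespace TransModel

/-! ### Second order expansion of the parametric class -/

section Taylor

variable {d : ℕ} {Λ : EuclideanSpace ℝ (Fin d) → ℝ → ℝ} {Θ : Set (EuclideanSpace ℝ (Fin d))}
  {K : Set ℝ} {θ₀ : EuclideanSpace ℝ (Fin d)}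

lemma sum_smul_single (v : EuclideanSpace ℝ (Fin d)) :
    v = ∑ k, v k • EuclideanSpace.single k (1 : ℝ) := by
  simpa using ((EuclideanSpace.basisFun (Fin d) ℝ).sum_repr v).symm

lemma dotΛ_eq {y : ℝ} {θ : EuclideanSpace ℝ (Fin d)} {D : EuclideanSpace ℝ (Fin d) →L[ℝ] ℝ}
    (hD : HasFDerivAt (fun t => Λ t y) D θ) (k : Fin d) :
    dotΛ Λ θ y k = D (EuclideanSpace.single k 1) :=
  (hD.hasLineDerivAt _).lineDeriv

/-- The partial derivative agrees with `D₁` applied to a basis vector on a whole neighbourhood of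
`θ₀`, so the two functions have the same derivative there. -/
lemma ddotΛ_eq {y : ℝ} {D₁ : EuclideanSpace ℝ (Fin d) → EuclideanSpace ℝ (Fin d) →L[ℝ] ℝ}
    {D₂ : EuclideanSpace ℝ (Fin d) →L[ℝ] EuclideanSpace ℝ (Fin d) →L[ℝ] ℝ}
    (hD₁ : ∀ᶠ θ in 𝓝 θ₀, HasFDerivAt (fun t => Λ t y) (D₁ θ) θ) (hD₂ : HasFDerivAt D₁ D₂ θ₀)
    (k l : Fin d) :
    ddotΛ Λ θ₀ y k l = D₂ (EuclideanSpace.single k 1) (EuclideanSpace.single l 1) := by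
  have h1 : HasFDerivAt (fun t => D₁ t (EuclideanSpace.single l 1))
      (D₂.flip (EuclideanSpace.single l 1)) θ₀ :=
    ((ContinuousLinearMap.apply ℝ ℝ (EuclideanSpace.single l (1 : ℝ))).hasFDerivAt.comp θ₀ hD₂)
  have h2 : HasFDerivAt (fun t => dotΛ Λ t y l) (D₂.flip (EuclideanSpace.single l 1)) θ₀ :=
    h1.congr_of_eventuallyEq (hD₁.mono fun θ hθ => dotΛ_eq hθ l)
  exact (h2.hasLineDerivAt _).lineDeriv

/-- The second order Taylor expansion of `θ ↦ Λ_θ(y)` is uniform in `y`. -/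
lemma TwiceContDiffInParam.taylor (hK : IsCompact K) (hΛ : TwiceContDiffInParam K Θ Λ)
    (hθ₀ : θ₀ ∈ interior Θ) :
    (∀ k, ContinuousOn (fun y => dotΛ Λ θ₀ y k) K) ∧
    (∀ k l, ContinuousOn (fun y => ddotΛ Λ θ₀ y k l) K) ∧
    ∀ ε, 0 < ε → ∃ r, 0 < r ∧ ∀ v : EuclideanSpace ℝ (Fin d), ‖v‖ ≤ r → ∀ y ∈ K,
      |Λ (θ₀ + v) y - Λ θ₀ y - ∑ k, v k * dotΛ Λ θ₀ y k
        - 2⁻¹ * ∑ k, ∑ l, v k * v l * ddotΛ Λ θ₀ y k l| ≤ ε * ‖v‖ ^ 2 := by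
  obtain ⟨D₁, D₂, h1, h2, hc1, hc2⟩ := hΛ
  have hθ₀' : θ₀ ∈ Θ := interior_subset hθ₀
  have h1' : ∀ y ∈ K, ∀ θ ∈ interior Θ, HasFDerivAt (fun t => Λ t y) (D₁ y θ) θ :=
    fun y hy θ hθ => (h1 y hy θ (interior_subset hθ)).hasFDerivAt (mem_interior_iff_mem_nhds.1 hθ)
  have h2' : ∀ y ∈ K, ∀ θ ∈ interior Θ, HasFDerivAt (D₁ y) (D₂ y θ) θ :=
    fun y hy θ hθ => (h2 y hy θ (interior_subset hθ)).hasFDerivAt (mem_interior_iff_mem_nhds.1 hθ)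
  have hint : ∀ᶠ θ in 𝓝 θ₀, θ ∈ interior Θ := isOpen_interior.mem_nhds hθ₀
  have hd1 : ∀ y ∈ K, ∀ k, dotΛ Λ θ₀ y k = D₁ y θ₀ (EuclideanSpace.single k 1) :=
    fun y hy k => dotΛ_eq (h1' y hy θ₀ hθ₀) k
  have hd2 : ∀ y ∈ K, ∀ k l, ddotΛ Λ θ₀ y k l =
      D₂ y θ₀ (EuclideanSpace.single k 1) (EuclideanSpace.single l 1) :=
    fun y hy k l => ddotΛ_eq (hint.mono fun θ hθ => h1' y hy θ hθ) (h2' y hy θ₀ hθ₀) k l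
  have hline : ContinuousOn (fun y : ℝ => (y, θ₀)) K :=
    (continuous_id.prodMk continuous_const).continuousOn
  have hc1' : ContinuousOn (fun y => D₁ y θ₀) K := hc1.comp hline fun y hy => ⟨hy, hθ₀'⟩
  have hc2' : ContinuousOn (fun y => D₂ y θ₀) K := hc2.comp hline fun y hy => ⟨hy, hθ₀'⟩
  refine ⟨fun k => ?_, fun k l => ?_, fun ε hε => ?_⟩
  · exact (hc1'.clm_apply continuousOn_const).congr fun y hy => hd1 y hy k
  · exact ((hc2'.clm_apply continuousOn_const).clm_apply continuousOn_const).congr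
      fun y hy => hd2 y hy k l
  obtain ⟨r₀, hr₀, hball⟩ := Metric.nhds_basis_closedBall.mem_iff.1 hint
  -- Uniform continuity of the second derivative on this compact product yields a radius independent
  -- of `y`.
  have hcomp : IsCompact (K ×ˢ Metric.closedBall θ₀ r₀) := hK.prod (isCompact_closedBall _ _)
  have huc : UniformContinuousOn (fun p : ℝ × EuclideanSpace ℝ (Fin d) => D₂ p.1 p.2)
      (K ×ˢ Metric.closedBall θ₀ r₀) := hcomp.uniformContinuousOn_of_continuous
    (hc2.mono (prod_mono_right (hball.trans interior_subset)))
  obtain ⟨δ, hδ, hδ'⟩ := (Metric.uniformContinuousOn_iff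
    (f := fun p : ℝ × EuclideanSpace ℝ (Fin d) => D₂ p.1 p.2)).1 huc ε hε
  refine ⟨min r₀ (δ / 2), by positivity, fun v hv y hy => ?_⟩
  have hvr : ‖v‖ ≤ r₀ := hv.trans (min_le_left _ _)
  have hvδ : ‖v‖ < δ := (hv.trans (min_le_right _ _)).trans_lt (by linarith)
  have hsub : Metric.closedBall θ₀ ‖v‖ ⊆ interior Θ :=
    (Metric.closedBall_subset_closedBall hvr).trans hball
  have hbd : ∀ θ ∈ Metric.closedBall θ₀ ‖v‖, ‖D₂ y θ - D₂ y θ₀‖ ≤ ε := fun θ hθ => by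
    refine (dist_eq_norm (D₂ y θ) (D₂ y θ₀)).symm.trans_le (hδ' (y, θ)
      ⟨hy, Metric.closedBall_subset_closedBall hvr hθ⟩ (y, θ₀)
      ⟨hy, Metric.mem_closedBall_self hr₀.le⟩ ?_).le
    rw [Prod.dist_eq]
    simpa using (Metric.mem_closedBall.1 hθ).trans_lt hvδ
  -- The mean value inequality for the first derivative minus its linearization, whose derivative is
  -- at most `ε` on the ball.
  have hstep : ∀ u, ‖u‖ ≤ ‖v‖ → ‖D₁ y (θ₀ + u) - D₁ y θ₀ - D₂ y θ₀ u‖ ≤ ε * ‖u‖ := by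
    intro u hu
    have hm : θ₀ + u ∈ Metric.closedBall θ₀ ‖v‖ := by simpa [Metric.mem_closedBall] using hu
    have hF := (convex_closedBall θ₀ ‖v‖).norm_image_sub_le_of_norm_hasFDerivWithin_le
      (f := fun θ => D₁ y θ - D₂ y θ₀ θ) (f' := fun θ => D₂ y θ - D₂ y θ₀)
      (fun θ hθ => ((h2' y hy θ (hsub hθ)).sub (D₂ y θ₀).hasFDerivAt).hasFDerivWithinAt) hbd
      (Metric.mem_closedBall_self (norm_nonneg v)) hm
    have he : D₁ y (θ₀ + u) - D₂ y θ₀ (θ₀ + u) - (D₁ y θ₀ - D₂ y θ₀ θ₀) =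
        D₁ y (θ₀ + u) - D₁ y θ₀ - D₂ y θ₀ u := by
      rw [map_add]; abel
    rw [he] at hF
    simpa using hF
  have hline' : ∀ t : ℝ, HasDerivAt (fun t : ℝ => θ₀ + t • v) v t := fun t => by
    simpa using ((hasDerivAt_id t).smul_const v).const_add θ₀
  -- A second use of the mean value inequality, along the segment from `θ₀` to `θ₀ + v`: the
  -- derivative of the Taylor remainder is controlled by `hstep`.
  have hMVT := norm_image_sub_le_of_norm_deriv_le_segment_01' (C := ε * ‖v‖ ^ 2)
    (f := fun t : ℝ => Λ (θ₀ + t • v) y - t * D₁ y θ₀ v - t ^ 2 * (2⁻¹ * D₂ y θ₀ v v))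
    (f' := fun t => D₁ y (θ₀ + t • v) v - D₁ y θ₀ v - t * D₂ y θ₀ v v)
    (fun t ht => by
      have hm : θ₀ + t • v ∈ interior Θ := hsub (by
        simp only [Metric.mem_closedBall, dist_self_add_left, norm_smul, Real.norm_eq_abs,
          abs_of_nonneg ht.1]
        exact mul_le_of_le_one_left (norm_nonneg _) ht.2)
      have e1 := (h1' y hy _ hm).comp_hasDerivAt t (hline' t)
      have e2 := (hasDerivAt_id t).mul_const (D₁ y θ₀ v)
      have e3 := ((hasDerivAt_id t).pow 2).mul_const (2⁻¹ * D₂ y θ₀ v v)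
      refine (((e1.sub e2).sub e3).congr_deriv ?_).hasDerivWithinAt
      simp
      ring)
    (fun t ht => by
      have hn : ‖t • v‖ ≤ ‖v‖ := by
        rw [norm_smul, Real.norm_eq_abs, abs_of_nonneg ht.1]
        exact mul_le_of_le_one_left (norm_nonneg _) ht.2.le
      have h := (hstep (t • v) hn).trans (mul_le_mul_of_nonneg_left hn hε.le)
      have he : D₁ y (θ₀ + t • v) v - D₁ y θ₀ v - t * D₂ y θ₀ v v =
          (D₁ y (θ₀ + t • v) - D₁ y θ₀ - D₂ y θ₀ (t • v)) v := by simp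
      rw [he]
      refine (ContinuousLinearMap.le_opNorm _ _).trans ?_
      rw [pow_two, ← mul_assoc]
      exact mul_le_mul_of_nonneg_right h (norm_nonneg _))
  have hs1 : ∑ k, v k * dotΛ Λ θ₀ y k = D₁ y θ₀ v := by
    conv_rhs => rw [sum_smul_single v]
    simp [hd1 y hy]
  have hs2 : ∑ k, ∑ l, v k * v l * ddotΛ Λ θ₀ y k l = D₂ y θ₀ v v := by
    conv_rhs => rw [sum_smul_single v]
    simp only [map_sum, map_smul, _root_.sum_apply, _root_.smul_apply,
      smul_eq_mul, hd2 y hy, Finset.mul_sum]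
    rw [Finset.sum_comm]
    exact Finset.sum_congr rfl fun k _ => Finset.sum_congr rfl fun l _ => by ring
  rw [hs1, hs2]
  rw [Real.norm_eq_abs] at hMVT
  convert hMVT using 2
  simp
  ring

end Taylor

end TransModel

namespace TransModel

/-! ### Coordinates of the parameter -/

section Coord

variable {d : ℕ}

/-- The coordinates of a parameter with respect to `paramBasis`. -/
def coord (v : Param d) : ParamIdx d → ℝ :=
  Sum.elim (fun _ => v.1) (Sum.elim (fun _ => v.2.1) (fun k => v.2.2 k))

lemma abs_coord_le (v : Param d) (i : ParamIdx d) : |coord v i| ≤ ‖v‖ := by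
  rcases i with i | i | i
  · exact norm_fst_le v
  · exact (norm_fst_le v.2).trans (norm_snd_le v)
  · exact (PiLp.norm_apply_le v.2.2 i).trans ((norm_snd_le v.2).trans (norm_snd_le v))

lemma coord_smul_paramBasis (t : ℝ) (i j : ParamIdx d) :
    coord (t • paramBasis i : Param d) j = if j = i then t else 0 := by
  rcases i with i | i | i <;> rcases j with j | j | j <;>
    simp [coord, paramBasis, eq_comm]

lemma norm_paramBasis_le (i : ParamIdx d) : ‖(paramBasis i : Param d)‖ ≤ 1 := by
  rcases i with i | i | i <;> simp [paramBasis, Prod.norm_def]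

lemma coord_ne_zero {v : Param d} (hv : v ≠ 0) : coord v ≠ 0 := by
  contrapose! hv
  have h1 := congrFun hv (Sum.inl ())
  have h2 := congrFun hv (Sum.inr (Sum.inl ()))
  have h3 := fun k => congrFun hv (Sum.inr (Sum.inr k))
  simp only [coord, Sum.elim_inl, Sum.elim_inr, Pi.zero_apply] at h1 h2 h3
  exact Prod.ext h1 (Prod.ext h2 (by ext k; exact h3 k))

@[fun_prop]
lemma continuous_coord (i : ParamIdx d) : Continuous fun v : Param d => coord v i := by
  rcases i with i | i | i <;> simp only [coord, Sum.elim_inl, Sum.elim_inr] <;> fun_prop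

lemma coord_smul (t : ℝ) (v : Param d) (i : ParamIdx d) :
    coord (t • v) i = t * coord v i := by
  rcases i with i | i | i <;> simp [coord]

/-- A positive definite form is bounded below by a multiple of the squared norm. -/
lemma exists_pos_le_quadratic {G : Matrix (ParamIdx d) (ParamIdx d) ℝ} (hG : G.PosDef) :
    ∃ κ, 0 < κ ∧ ∀ v : Param d,
      κ * ‖v‖ ^ 2 ≤ ∑ i, ∑ j, coord v i * coord v j * G i j := by
  set q : Param d → ℝ := fun v => ∑ i, ∑ j, coord v i * coord v j * G i j with hq
  have hqc : Continuous q := by fun_prop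
  have hpos : ∀ v : Param d, v ≠ 0 → 0 < q v := fun v hv => by
    have h := hG.dotProduct_mulVec_pos (coord_ne_zero hv)
    simp only [dotProduct, Matrix.mulVec, star_trivial, Finset.mul_sum] at h
    refine h.trans_eq (Finset.sum_congr rfl fun i _ => Finset.sum_congr rfl fun j _ => by ring)
  have hne : (Metric.sphere (0 : Param d) 1).Nonempty :=
    ⟨(1, 0, 0), by simp [Prod.norm_def]⟩
  obtain ⟨v₀, hv₀, hmin⟩ := (isCompact_sphere (0 : Param d) 1).exists_isMinOn hne hqc.continuousOn
  have hv₀' : v₀ ≠ 0 := by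
    rintro rfl
    simp at hv₀
  refine ⟨q v₀, hpos v₀ hv₀', fun v => ?_⟩
  rcases eq_or_ne v 0 with rfl | hv
  · have : ∀ i, coord (0 : Param d) i = 0 := fun i => by simpa using coord_smul 0 (0 : Param d) i
    simp [this]
  have hn : 0 < ‖v‖ := norm_pos_iff.2 hv
  have hs : q (‖v‖⁻¹ • v) = (‖v‖ ^ 2)⁻¹ * q v := by
    simp only [hq, coord_smul, Finset.mul_sum]
    refine Finset.sum_congr rfl fun i _ => Finset.sum_congr rfl fun j _ => by
      rw [sq, mul_inv]; ring
  have h1 : q v₀ ≤ q (‖v‖⁻¹ • v) := hmin (by simp [norm_smul, hn.ne'])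
  rw [hs, inv_mul_eq_div, le_div_iff₀ (by positivity)] at h1
  exact h1

end Coord

/-! ### Local behaviour of the criterion -/

/-- Here `r` is the residual at `γ₀`, `L` and `q` are the linear and quadratic terms of its
perturbation, `τ` is the Taylor remainder and `N` is the size of the perturbation. The second order
part of the square is `L² - r q`. The remaining terms are cubic in `N` or contain `τ`, and `N ≤ η`
turns the cubic ones into multiples of `η N²`. The constants are `13 = 4 + 9` and `10 = 2 + 8`. -/
lemma sq_add_sub_sq_bound {r L q τ A N η : ℝ} (hA : 1 ≤ A) (hN0 : 0 ≤ N) (hN : N ≤ η)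
    (hη : η ≤ 1) (hr : |r| ≤ A) (hL : |L| ≤ A * N) (hq : |q| ≤ A * N ^ 2)
    (hτ : |τ| ≤ η * N ^ 2) :
    |L - 2⁻¹ * q + τ| ≤ 3 * A * N ∧
    |(r + (L - 2⁻¹ * q + τ)) ^ 2 - r ^ 2 - 2 * r * L| ≤ 13 * A ^ 2 * N ^ 2 ∧
    2 * r * L + (L ^ 2 - r * q) - 10 * A ^ 2 * (η * N ^ 2) ≤
      (r + (L - 2⁻¹ * q + τ)) ^ 2 - r ^ 2 := by
  have hη0 : 0 ≤ η := hN0.trans hN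
  have hN1 : N ≤ 1 := hN.trans hη
  have hN2 : 0 ≤ N ^ 2 := sq_nonneg N
  have hNN : N ^ 2 ≤ N := by nlinarith
  have hd : |-(2⁻¹ * q) + τ| ≤ 2 * A * N ^ 2 := by
    refine (abs_add_le _ _).trans ?_
    rw [abs_neg, abs_mul, abs_of_pos (by norm_num : (0 : ℝ) < 2⁻¹)]
    nlinarith
  have hAN : A * N ^ 2 ≤ A * N := mul_le_mul_of_nonneg_left hNN (by linarith)
  have hΔ : |L - 2⁻¹ * q + τ| ≤ 3 * A * N := by
    have : L - 2⁻¹ * q + τ = L + (-(2⁻¹ * q) + τ) := by ring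
    rw [this]
    refine (abs_add_le _ _).trans ?_
    linarith
  set D := -(2⁻¹ * q) + τ with hD
  have e : L - 2⁻¹ * q + τ = L + D := by rw [hD]; ring
  rw [e] at hΔ ⊢
  refine ⟨hΔ, ?_, ?_⟩
  · have e1 : (r + (L + D)) ^ 2 - r ^ 2 - 2 * r * L = 2 * r * D + (L + D) ^ 2 := by ring
    rw [e1]
    refine (abs_add_le _ _).trans ?_
    have h1 : |2 * r * D| ≤ 4 * A ^ 2 * N ^ 2 := by
      rw [abs_mul, abs_mul, abs_two]
      calc 2 * |r| * |D| ≤ 2 * A * (2 * A * N ^ 2) := by gcongr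
        _ = 4 * A ^ 2 * N ^ 2 := by ring
    have h2 : |(L + D) ^ 2| ≤ 9 * A ^ 2 * N ^ 2 := by
      rw [abs_pow]
      calc |L + D| ^ 2 ≤ (3 * A * N) ^ 2 := by gcongr
        _ = 9 * A ^ 2 * N ^ 2 := by ring
    linarith
  · have h1 : |2 * r * τ| ≤ 2 * A * (η * N ^ 2) := by
      rw [abs_mul, abs_mul, abs_two]
      gcongr
    have h2 : |D * (2 * L + D)| ≤ 8 * A ^ 2 * (η * N ^ 2) := by
      have h3 : |2 * L + D| ≤ 4 * A * N := by
        refine (abs_add_le _ _).trans ?_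
        rw [abs_mul, abs_two]
        linarith
      rw [abs_mul]
      calc |D| * |2 * L + D| ≤ 2 * A * N ^ 2 * (4 * A * N) := by gcongr
        _ = 8 * A ^ 2 * (N * N ^ 2) := by ring
        _ ≤ 8 * A ^ 2 * (η * N ^ 2) := by gcongr
    have e2 : (r + (L + D)) ^ 2 - r ^ 2 =
        2 * r * L + (L ^ 2 - r * q) + 2 * r * τ + D * (2 * L + D) := by rw [hD]; ring
    rw [e2]
    have h4 : 2 * A * (η * N ^ 2) ≤ 2 * A ^ 2 * (η * N ^ 2) := by
      gcongr
      nlinarith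
    linarith [neg_abs_le (2 * r * τ), neg_abs_le (D * (2 * L + D))]

/-- Here `e` is the error of the estimated transformation and `c₀ + v` its perturbed coefficient.
The contributions `2 r c₀ e` and `c₀² e²` cancel in the difference, and each surviving term carries
a factor `ε N`; `17 = 2 + 12 + 3` collects them. -/
lemma sq_add_error_bound {r Δ c₀ v e A N ε : ℝ} (hA : 1 ≤ A) (hN0 : 0 ≤ N) (hN : N ≤ 1)
    (hr : |r| ≤ A) (hc₀ : |c₀| ≤ A) (hΔ : |Δ| ≤ 3 * A * N) (hv : |v| ≤ N) (he : |e| ≤ ε)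
    (hε : ε ≤ 1) :
    (r + Δ) ^ 2 - r ^ 2 - 17 * A ^ 2 * (ε * N) ≤
      (r + Δ + (c₀ + v) * e) ^ 2 - (r + c₀ * e) ^ 2 := by
  have hε0 : 0 ≤ ε := (abs_nonneg e).trans he
  have hA0 : 0 ≤ A := by linarith
  have h1 : |2 * r * v * e| ≤ 2 * A ^ 2 * (ε * N) := by
    rw [abs_mul, abs_mul, abs_mul, abs_two]
    calc 2 * |r| * |v| * |e| ≤ 2 * A * N * ε := by gcongr
      _ = 2 * A * (ε * N) := by ring
      _ ≤ _ := by gcongr; nlinarith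
  have hcv : |c₀ + v| ≤ 2 * A := (abs_add_le _ _).trans (by linarith)
  have h2 : |2 * Δ * (c₀ + v) * e| ≤ 12 * A ^ 2 * (ε * N) := by
    rw [abs_mul, abs_mul, abs_mul, abs_two]
    calc 2 * |Δ| * |c₀ + v| * |e| ≤ 2 * (3 * A * N) * (2 * A) * ε := by gcongr
      _ = 12 * A ^ 2 * (ε * N) := by ring
  have h3 : |v * (2 * c₀ + v) * (e * e)| ≤ 3 * A ^ 2 * (ε * N) := by
    have h4 : |2 * c₀ + v| ≤ 3 * A := by
      refine (abs_add_le _ _).trans ?_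
      rw [abs_mul, abs_two]
      linarith
    rw [abs_mul, abs_mul, abs_mul]
    calc |v| * |2 * c₀ + v| * (|e| * |e|) ≤ N * (3 * A) * (ε * ε) := by gcongr
      _ ≤ N * (3 * A) * (ε * 1) := by gcongr
      _ = 3 * A * (ε * N) := by ring
      _ ≤ _ := by gcongr; nlinarith
  have e1 : (r + Δ + (c₀ + v) * e) ^ 2 - (r + c₀ * e) ^ 2 = (r + Δ) ^ 2 - r ^ 2 +
      2 * r * v * e + 2 * Δ * (c₀ + v) * e + v * (2 * c₀ + v) * (e * e) := by ring
  rw [e1]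
  linarith [neg_abs_le (2 * r * v * e), neg_abs_le (2 * Δ * (c₀ + v) * e),
    neg_abs_le (v * (2 * c₀ + v) * (e * e))]

section Model

variable {d : ℕ} {w : ℝ → ℝ} {Λ : EuclideanSpace ℝ (Fin d) → ℝ → ℝ}
  {Θ : Set (EuclideanSpace ℝ (Fin d))} {h : ℝ → ℝ} {γ₀ : Param d}

/-- The linear term `∑ᵢ vᵢ sᵢ(y)` in the expansion of the residual. -/
noncomputable def linTerm (Λ : EuclideanSpace ℝ (Fin d) → ℝ → ℝ) (h : ℝ → ℝ) (θ : EuclideanSpace ℝ (Fin d))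
    (v : Param d) (y : ℝ) : ℝ :=
  ∑ i, coord v i * scoreVec Λ h θ y i

/-- The quadratic term `∑ᵢⱼ vᵢ vⱼ Cᵢⱼ(y)` in the expansion of the residual. -/
noncomputable def quadTerm (Λ : EuclideanSpace ℝ (Fin d) → ℝ → ℝ) (θ : EuclideanSpace ℝ (Fin d))
    (v : Param d) (y : ℝ) : ℝ :=
  ∑ i, ∑ j, coord v i * coord v j * curvBlock Λ θ y i j

/-- The residual is affine in `(c₁, c₂)`, so its second order remainder is exactly minus that of
`Λ`. -/
lemma resid_add (v : Param d) (y : ℝ) :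
    resid Λ h (γ₀ + v) y - resid Λ h γ₀ y - linTerm Λ h γ₀.2.2 v y
      + 2⁻¹ * quadTerm Λ γ₀.2.2 v y =
    -(Λ (γ₀.2.2 + v.2.2) y - Λ γ₀.2.2 y - ∑ k, v.2.2 k * dotΛ Λ γ₀.2.2 y k
        - 2⁻¹ * ∑ k, ∑ l, v.2.2 k * v.2.2 l * ddotΛ Λ γ₀.2.2 y k l) := by
  simp only [resid, linTerm, quadTerm, Fintype.sum_sum_type, coord, scoreVec, curvBlock,
    Sum.elim_inl, Sum.elim_inr, Finset.univ_unique, Finset.sum_singleton, mul_zero,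
    Finset.sum_const_zero, zero_add, mul_neg, Finset.sum_neg_distrib, Prod.fst_add, Prod.snd_add]
  ring

lemma continuousOn_scoreVec {K : Set ℝ} (hh : Continuous h) {θ : EuclideanSpace ℝ (Fin d)}
    (hd : ∀ k, ContinuousOn (fun y => dotΛ Λ θ y k) K) (i : ParamIdx d) :
    ContinuousOn (fun y => scoreVec Λ h θ y i) K := by
  rcases i with i | i | i
  · exact hh.continuousOn
  · exact continuousOn_const
  · exact (hd i).neg

lemma continuousOn_curvBlock {K : Set ℝ} {θ : EuclideanSpace ℝ (Fin d)}
    (hd : ∀ k l, ContinuousOn (fun y => ddotΛ Λ θ y k l) K) (i j : ParamIdx d) :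
    ContinuousOn (fun y => curvBlock Λ θ y i j) K := by
  rcases i with i | i | i <;> rcases j with j | j | j <;>
    first | exact hd i j | exact continuousOn_const

lemma isBddMeas_weight (hwc : Continuous w) (hwK : HasCompactSupport w) : IsBddMeas w :=
  ⟨hwc.measurable, hwK.exists_bound_of_continuous hwc⟩

lemma isBddMeas_indicator_resid (hwK : HasCompactSupport w) (hh : Continuous h)
    {γ : Param d} (hΛ : Monotone (Λ γ.2.2)) :
    IsBddMeas ((tsupport w).indicator (resid Λ h γ)) := by
  have h1 := isBddMeas_indicator_of_continuousOn (K := tsupport w) hwK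
    (f := fun y => h y * γ.1 + γ.2.1) (by fun_prop)
  have h2 := isBddMeas_indicator_of_monotone (K := tsupport w) hwK hΛ
  convert h1.sub h2 using 2 with y
  by_cases hy : y ∈ tsupport w <;> simp [hy, resid]

lemma isBddMeas_loss (hwc : Continuous w) (hwK : HasCompactSupport w) (hh : Continuous h)
    {γ : Param d} (hΛ : Monotone (Λ γ.2.2)) : IsBddMeas fun y => w y * resid Λ h γ y ^ 2 := by
  have h1 := (isBddMeas_weight hwc hwK).mul (isBddMeas_indicator_resid hwK hh hΛ).sq
  convert h1 using 2 with y
  by_cases hy : y ∈ tsupport w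
  · simp [hy]
  · simp [image_eq_zero_of_notMem_tsupport hy]

/-- The functions that govern the local behaviour of the criterion at an interior point: the
expansion of the residual is uniform on the support of the weight, with bounded coefficients. -/
structure LocalExpansion (w : ℝ → ℝ) (Λ : EuclideanSpace ℝ (Fin d) → ℝ → ℝ) (h : ℝ → ℝ)
    (γ₀ : Param d) (A : ℝ) : Prop where
  one_le : 1 ≤ A
  nonneg : ∀ y, 0 ≤ w y
  weight_le : ∀ y, w y ≤ A
  abs_fst_le : |γ₀.1| ≤ A
  abs_resid_le : ∀ y ∈ tsupport w, |resid Λ h γ₀ y| ≤ A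
  abs_lin_le : ∀ v, ∀ y ∈ tsupport w, |linTerm Λ h γ₀.2.2 v y| ≤ A * ‖v‖
  abs_quad_le : ∀ v, ∀ y ∈ tsupport w, |quadTerm Λ γ₀.2.2 v y| ≤ A * ‖v‖ ^ 2
  taylor : ∀ ε, 0 < ε → ∃ r, 0 < r ∧ ∀ v : Param d, ‖v‖ ≤ r → ∀ y ∈ tsupport w,
    |resid Λ h (γ₀ + v) y - resid Λ h γ₀ y - linTerm Λ h γ₀.2.2 v y
      + 2⁻¹ * quadTerm Λ γ₀.2.2 v y| ≤ ε * ‖v‖ ^ 2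
  score : ∀ i, IsBddMeas fun y => w y * resid Λ h γ₀ y * scoreVec Λ h γ₀.2.2 y i
  hess : ∀ i j, IsBddMeas fun y => w y * (scoreVec Λ h γ₀.2.2 y i * scoreVec Λ h γ₀.2.2 y j
      - curvBlock Λ γ₀.2.2 y i j * resid Λ h γ₀ y)

lemma exists_localExpansion (hw0 : ∀ y, 0 ≤ w y) (hwc : Continuous w) (hwK : HasCompactSupport w)
    (hh : Continuous h) (hΛdiff : TwiceContDiffInParam (tsupport w) Θ Λ)
    (hγ₀ : γ₀.2.2 ∈ interior Θ) (hΛ : Monotone (Λ γ₀.2.2)) :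
    ∃ A, LocalExpansion w Λ h γ₀ A := by
  obtain ⟨hd1, hd2, htay⟩ := hΛdiff.taylor hwK hγ₀
  have hw := isBddMeas_weight hwc hwK
  have hr := isBddMeas_indicator_resid (w := w) hwK hh hΛ
  have hs := fun i => isBddMeas_indicator_of_continuousOn hwK (continuousOn_scoreVec hh hd1 i)
  have hc := fun i j => isBddMeas_indicator_of_continuousOn hwK
    (continuousOn_curvBlock (Λ := Λ) (θ := γ₀.2.2) hd2 i j)
  obtain ⟨W, hW0, hW⟩ := hw.exists_pos_bound
  obtain ⟨R, hR0, hR⟩ := hr.exists_pos_bound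
  choose S hS0 hS using fun i => (hs i).exists_pos_bound
  choose C hC0 hC using fun i j => (hc i j).exists_pos_bound
  have hSs : 0 ≤ ∑ i, S i := Finset.sum_nonneg fun i _ => (hS0 i).le
  have hCs : 0 ≤ ∑ i, ∑ j, C i j :=
    Finset.sum_nonneg fun i _ => Finset.sum_nonneg fun j _ => (hC0 i j).le
  -- One common constant: the sum of all individual bounds, plus 1 to ensure `1 ≤ A`.
  refine ⟨1 + W + |γ₀.1| + R + ∑ i, S i + ∑ i, ∑ j, C i j, ?_, hw0, ?_, ?_, ?_, ?_, ?_, ?_, ?_, ?_⟩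
  · linarith [abs_nonneg γ₀.1]
  · intro y
    linarith [abs_nonneg γ₀.1, le_abs_self (w y), hW y]
  · linarith
  · intro y hy
    have := hR y
    rw [indicator_of_mem hy] at this
    linarith [abs_nonneg γ₀.1]
  · intro v y hy
    have h1 : |linTerm Λ h γ₀.2.2 v y| ≤ (∑ i, S i) * ‖v‖ := by
      rw [Finset.sum_mul]
      refine (Finset.abs_sum_le_sum_abs _ _).trans (Finset.sum_le_sum fun i _ => ?_)
      have := hS i y
      rw [indicator_of_mem hy] at this
      rw [abs_mul, mul_comm]
      exact mul_le_mul this (abs_coord_le v i) (abs_nonneg _) (hS0 i).le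
    refine h1.trans (mul_le_mul_of_nonneg_right ?_ (norm_nonneg _))
    linarith [abs_nonneg γ₀.1]
  · intro v y hy
    have h1 : |quadTerm Λ γ₀.2.2 v y| ≤ (∑ i, ∑ j, C i j) * ‖v‖ ^ 2 := by
      simp_rw [Finset.sum_mul]
      refine (Finset.abs_sum_le_sum_abs _ _).trans (Finset.sum_le_sum fun i _ =>
        (Finset.abs_sum_le_sum_abs _ _).trans (Finset.sum_le_sum fun j _ => ?_))
      have := hC i j y
      rw [indicator_of_mem hy] at this
      rw [abs_mul, abs_mul, mul_comm, pow_two]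
      exact mul_le_mul this (mul_le_mul (abs_coord_le v i) (abs_coord_le v j) (abs_nonneg _)
        (norm_nonneg _)) (by positivity) (hC0 i j).le
    refine h1.trans (mul_le_mul_of_nonneg_right ?_ (by positivity))
    linarith [abs_nonneg γ₀.1]
  · intro ε hε
    obtain ⟨r, hr0, hr⟩ := htay ε hε
    refine ⟨r, hr0, fun v hv y hy => ?_⟩
    have hn : ‖v.2.2‖ ≤ ‖v‖ := (norm_snd_le v.2).trans (norm_snd_le v)
    rw [resid_add, abs_neg]
    exact (hr v.2.2 (hn.trans hv) y hy).trans (by gcongr)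
  · intro i
    convert (hw.mul hr).mul (hs i) using 2 with y
    by_cases hy : y ∈ tsupport w
    · simp [hy]
    · simp [image_eq_zero_of_notMem_tsupport hy]
  · intro i j
    convert hw.mul (((hs i).mul (hs j)).sub ((hc i j).mul hr)) using 2 with y
    by_cases hy : y ∈ tsupport w
    · simp [hy]
    · simp [image_eq_zero_of_notMem_tsupport hy]

end Model

end TransModel

namespace TransModel

/-! ### First order condition and lower bound for the criterion near its minimizer -/

section Local

variable {d : ℕ} {w : ℝ → ℝ} {Λ : EuclideanSpace ℝ (Fin d) → ℝ → ℝ} {h : ℝ → ℝ}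
  {γ₀ : Param d} {A : ℝ}

/-- The weighted score `w r sᵢ`. -/
noncomputable def scoreFun (w : ℝ → ℝ) (Λ : EuclideanSpace ℝ (Fin d) → ℝ → ℝ) (h : ℝ → ℝ)
    (γ : Param d) (i : ParamIdx d) (y : ℝ) : ℝ :=
  w y * resid Λ h γ y * scoreVec Λ h γ.2.2 y i

/-- The weighted second order coefficient `w (sᵢ sⱼ - Cᵢⱼ r)`. -/
noncomputable def hessFun (w : ℝ → ℝ) (Λ : EuclideanSpace ℝ (Fin d) → ℝ → ℝ) (h : ℝ → ℝ)
    (γ : Param d) (i j : ParamIdx d) (y : ℝ) : ℝ :=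
  w y * (scoreVec Λ h γ.2.2 y i * scoreVec Λ h γ.2.2 y j
      - curvBlock Λ γ.2.2 y i j * resid Λ h γ y)

lemma sum_coord_mul_scoreFun (v : Param d) (y : ℝ) :
    ∑ i, coord v i * scoreFun w Λ h γ₀ i y =
      w y * (resid Λ h γ₀ y * linTerm Λ h γ₀.2.2 v y) := by
  simp only [scoreFun, linTerm, Finset.mul_sum]
  exact Finset.sum_congr rfl fun i _ => by ring

lemma sum_coord_mul_hessFun (v : Param d) (y : ℝ) :
    ∑ i, ∑ j, coord v i * coord v j * hessFun w Λ h γ₀ i j y =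
      w y * (linTerm Λ h γ₀.2.2 v y ^ 2 - resid Λ h γ₀ y * quadTerm Λ γ₀.2.2 v y) := by
  have h1 : linTerm Λ h γ₀.2.2 v y ^ 2 = ∑ i, ∑ j, coord v i * coord v j *
      (scoreVec Λ h γ₀.2.2 y i * scoreVec Λ h γ₀.2.2 y j) := by
    rw [pow_two, linTerm, Finset.sum_mul_sum]
    exact Finset.sum_congr rfl fun i _ => Finset.sum_congr rfl fun j _ => by ring
  rw [h1, quadTerm, Finset.mul_sum, ← Finset.sum_sub_distrib, Finset.mul_sum]
  refine Finset.sum_congr rfl fun i _ => ?_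
  rw [Finset.mul_sum, ← Finset.sum_sub_distrib, Finset.mul_sum]
  exact Finset.sum_congr rfl fun j _ => by rw [hessFun]; ring

lemma resid_eq_add (f : ℝ → ℝ) (γ : Param d) (y : ℝ) :
    resid Λ f γ y = resid Λ h γ y + γ.1 * (f y - h y) := by
  simp only [resid]; ring

namespace LocalExpansion

/-- A first order expansion with an error uniform in `y`, which yields the first order condition
without differentiating under the integral. The third power of `A` is the bound `13 A²` for the
squares times the bound for the weight. -/
lemma abs_loss_sub_le (hE : LocalExpansion w Λ h γ₀ A) :
    ∃ r, 0 < r ∧ ∀ v : Param d, ‖v‖ ≤ r → ∀ y,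
      |w y * resid Λ h (γ₀ + v) y ^ 2 - w y * resid Λ h γ₀ y ^ 2
        - 2 * ∑ i, coord v i * scoreFun w Λ h γ₀ i y| ≤ 13 * A ^ 3 * ‖v‖ ^ 2 := by
  obtain ⟨r, hr0, hr⟩ := hE.taylor 1 one_pos
  have hA := hE.one_le
  refine ⟨min r 1, by positivity, fun v hv y => ?_⟩
  rw [sum_coord_mul_scoreFun]
  by_cases hy : y ∈ tsupport w
  · have hb := (sq_add_sub_sq_bound hA (norm_nonneg v) (hv.trans (min_le_right _ _)) le_rfl
      (hE.abs_resid_le y hy) (hE.abs_lin_le v y hy) (hE.abs_quad_le v y hy)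
      (hr v (hv.trans (min_le_left _ _)) y hy)).2.1
    set R := resid Λ h γ₀ y with hR
    set L := linTerm Λ h γ₀.2.2 v y with hL
    set q := quadTerm Λ γ₀.2.2 v y with hq
    set R' := resid Λ h (γ₀ + v) y with hR'
    have e1 : R + (L - 2⁻¹ * q + (R' - R - L + 2⁻¹ * q)) = R' := by ring
    rw [e1] at hb
    have e2 : w y * R' ^ 2 - w y * R ^ 2 - 2 * (w y * (R * L)) =
        w y * (R' ^ 2 - R ^ 2 - 2 * R * L) := by ring
    rw [e2, abs_mul, abs_of_nonneg (hE.nonneg y)]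
    calc w y * |R' ^ 2 - R ^ 2 - 2 * R * L| ≤ A * (13 * A ^ 2 * ‖v‖ ^ 2) :=
          mul_le_mul (hE.weight_le y) hb (abs_nonneg _) (by linarith)
      _ = _ := by ring
  · simp only [image_eq_zero_of_notMem_tsupport hy, zero_mul, sub_zero, mul_zero, abs_zero]
    positivity

/-- The decisive point is that the estimation error enters only as `ε ‖v‖`: the part of it already
present at `v = 0` cancels in the difference. The Taylor error `η ‖v‖²` can be made small against
the quadratic term. -/
lemma loss_sub_ge (hE : LocalExpansion w Λ h γ₀ A) {η : ℝ} (hη : 0 < η) (hη1 : η ≤ 1) :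
    ∃ r, 0 < r ∧ ∀ v : Param d, ‖v‖ ≤ r → ∀ (f : ℝ → ℝ) (ε : ℝ), 0 ≤ ε → ε ≤ 1 →
      (∀ y ∈ tsupport w, |f y - h y| ≤ ε) → ∀ y,
      2 * ∑ i, coord v i * scoreFun w Λ h γ₀ i y
        + ∑ i, ∑ j, coord v i * coord v j * hessFun w Λ h γ₀ i j y
        - A ^ 3 * (10 * (η * ‖v‖ ^ 2) + 17 * (ε * ‖v‖)) ≤
      w y * resid Λ f (γ₀ + v) y ^ 2 - w y * resid Λ f γ₀ y ^ 2 := by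
  obtain ⟨r, hr0, hr⟩ := hE.taylor η hη
  have hA := hE.one_le
  refine ⟨min r η, by positivity, fun v hv f ε hε0 hε hf y => ?_⟩
  have hvη : ‖v‖ ≤ η := hv.trans (min_le_right _ _)
  rw [sum_coord_mul_scoreFun, sum_coord_mul_hessFun]
  by_cases hy : y ∈ tsupport w
  · obtain ⟨hΔ, -, hb⟩ := sq_add_sub_sq_bound hA (norm_nonneg v) hvη hη1
      (hE.abs_resid_le y hy) (hE.abs_lin_le v y hy) (hE.abs_quad_le v y hy)
      (hr v (hv.trans (min_le_left _ _)) y hy)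
    have hb2 := sq_add_error_bound (c₀ := γ₀.1) hA (norm_nonneg v) (hvη.trans hη1)
      (hE.abs_resid_le y hy) hE.abs_fst_le hΔ (norm_fst_le v) (hf y hy) hε
    rw [resid_eq_add (h := h) f (γ₀ + v), resid_eq_add (h := h) f γ₀, Prod.fst_add]
    set R := resid Λ h γ₀ y with hR
    set L := linTerm Λ h γ₀.2.2 v y with hL
    set q := quadTerm Λ γ₀.2.2 v y with hq
    set R' := resid Λ h (γ₀ + v) y with hR'
    have e1 : R + (L - 2⁻¹ * q + (R' - R - L + 2⁻¹ * q)) = R' := by ring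
    rw [e1] at hb hb2
    have hmain : 2 * R * L + (L ^ 2 - R * q) - A ^ 2 * (10 * (η * ‖v‖ ^ 2) + 17 * (ε * ‖v‖)) ≤
        (R' + (γ₀.1 + v.1) * (f y - h y)) ^ 2 - (R + γ₀.1 * (f y - h y)) ^ 2 := by linarith
    have h1 := mul_le_mul_of_nonneg_left hmain (hE.nonneg y)
    have h2 : w y * (A ^ 2 * (10 * (η * ‖v‖ ^ 2) + 17 * (ε * ‖v‖))) ≤
        A * (A ^ 2 * (10 * (η * ‖v‖ ^ 2) + 17 * (ε * ‖v‖))) :=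
      mul_le_mul_of_nonneg_right (hE.weight_le y) (by positivity)
    linarith
  · simp only [image_eq_zero_of_notMem_tsupport hy, zero_mul, sub_zero, mul_zero, add_zero,
      zero_sub, neg_nonpos]
    positivity

/-- The first order condition at an interior minimizer. -/
lemma integral_scoreFun_eq_zero (hE : LocalExpansion w Λ h γ₀ A) {μ : Measure ℝ}
    [IsProbabilityMeasure μ]
    (hint : ∀ᶠ v in 𝓝 (0 : Param d), Integrable (fun y => w y * resid Λ h (γ₀ + v) y ^ 2) μ)
    (hmin : ∀ᶠ v in 𝓝 (0 : Param d), ∫ y, w y * resid Λ h γ₀ y ^ 2 ∂μ ≤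
      ∫ y, w y * resid Λ h (γ₀ + v) y ^ 2 ∂μ) (i : ParamIdx d) :
    ∫ y, scoreFun w Λ h γ₀ i y ∂μ = 0 := by
  obtain ⟨r, hr0, hr⟩ := hE.abs_loss_sub_le
  set I := ∫ y, scoreFun w Λ h γ₀ i y ∂μ with hI
  have hsc : Integrable (fun y => scoreFun w Λ h γ₀ i y) μ := (hE.score i).integrable μ
  have hA := hE.one_le
  have hlim : Tendsto (fun t : ℝ => (t • paramBasis i : Param d)) (𝓝 0) (𝓝 0) := by
    have : Continuous fun t : ℝ => (t • paramBasis i : Param d) := by fun_prop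
    simpa using this.tendsto 0
  have hint0 : Integrable (fun y => w y * resid Λ h γ₀ y ^ 2) μ := by
    simpa using hint.self_of_nhds
  -- Moving by `t` in the i-th direction changes the expected loss by at most this amount, and
  -- minimality makes the change nonnegative. The polynomial thus has a local minimum at 0, so its
  -- derivative `2 * I` vanishes.
  have hle : ∀ᶠ t in 𝓝 (0 : ℝ), 0 ≤ t * (2 * I) + t ^ 2 * (13 * A ^ 3) := by
    filter_upwards [hlim.eventually hint, hlim.eventually hmin,
      hlim.eventually (Metric.closedBall_mem_nhds (0 : Param d) hr0)] with t h1 h2 h3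
    have hv : ‖(t • paramBasis i : Param d)‖ ≤ r := by simpa using h3
    have hvt : ‖(t • paramBasis i : Param d)‖ ≤ |t| := by
      rw [norm_smul, Real.norm_eq_abs]
      exact mul_le_of_le_one_right (abs_nonneg _) (norm_paramBasis_le i)
    have hpt : ∀ y, w y * resid Λ h (γ₀ + t • paramBasis i) y ^ 2 - w y * resid Λ h γ₀ y ^ 2 ≤
        t * 2 * scoreFun w Λ h γ₀ i y + t ^ 2 * (13 * A ^ 3) := fun y => by
      have h4 := (le_abs_self _).trans (hr _ hv y)
      simp only [coord_smul_paramBasis, ite_mul, zero_mul, Finset.sum_ite_eq', Finset.mem_univ,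
        if_true] at h4
      have h5 : ‖(t • paramBasis i : Param d)‖ ^ 2 ≤ t ^ 2 := by
        rw [← sq_abs t]; gcongr
      have h6 := mul_le_mul_of_nonneg_left h5 (show 0 ≤ 13 * A ^ 3 by positivity)
      linarith
    have h7 := integral_mono (h1.sub hint0) ((hsc.const_mul (t * 2)).add
      (integrable_const (t ^ 2 * (13 * A ^ 3)))) hpt
    simp only [Pi.sub_apply, Pi.add_apply] at h7
    rw [integral_sub h1 hint0, integral_add (hsc.const_mul (t * 2)) (integrable_const _),
      integral_const_mul, ← hI] at h7
    simp only [integral_const, probReal_univ, one_smul] at h7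
    linarith
  have hder : HasDerivAt (fun t : ℝ => t * (2 * I) + t ^ 2 * (13 * A ^ 3)) (2 * I) 0 := by
    have := ((hasDerivAt_id (0 : ℝ)).mul_const (2 * I)).add
      (((hasDerivAt_id (0 : ℝ)).pow 2).mul_const (13 * A ^ 3))
    exact this.congr_deriv (by simp)
  have hloc : IsLocalMin (fun t : ℝ => t * (2 * I) + t ^ 2 * (13 * A ^ 3)) 0 := by
    filter_upwards [hle] with t ht
    simpa using ht
  have := hloc.hasDerivAt_eq_zero hder
  linarith

/-- In a neighbourhood of the minimizer of the population criterion the empirical criterion is,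
up to a term of smaller order than `√n`, not smaller than at the minimizer. -/
lemma eventually_sum_loss_ge (hE : LocalExpansion w Λ h γ₀ A) {Ω : Type*} [MeasurableSpace Ω]
    {P : Measure Ω} [IsProbabilityMeasure P] {Y : ℕ → Ω → ℝ} {μ : Measure ℝ} (hY : IsIID P Y μ)
    (hscore : ∀ i, ∫ y, scoreFun w Λ h γ₀ i y ∂μ = 0)
    {G : Matrix (ParamIdx d) (ParamIdx d) ℝ} (hG : G.PosDef)
    (hGe : ∀ i j, G i j = ∫ y, hessFun w Λ h γ₀ i j y ∂μ)
    {b : ℕ → ℝ} (hb : Tendsto b atTop atTop) (hb' : Tendsto (fun n : ℕ => b n / √n) atTop (𝓝 0))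
    {f : ℕ → Ω → ℝ → ℝ}
    (hf : ∀ᶠ x in whp P, ∀ y ∈ tsupport w, |f x.1 x.2 y - h y| ≤ b x.1 / √x.1) :
    ∃ ρ, 0 < ρ ∧ ∃ C, ∀ᶠ x in whp P, ∀ v : Param d, ‖v‖ ≤ ρ →
      ∑ j ∈ Finset.range x.1, w (Y j x.2) * resid Λ (f x.1 x.2) γ₀ (Y j x.2) ^ 2 - C * b x.1 ^ 2 ≤
      ∑ j ∈ Finset.range x.1, w (Y j x.2) * resid Λ (f x.1 x.2) (γ₀ + v) (Y j x.2) ^ 2 := by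
  have hμ := hY.isProbabilityMeasure
  have hA := hE.one_le
  obtain ⟨κ, hκ, hquad⟩ := exists_pos_le_quadratic hG
  -- Chosen so that the Taylor error consumes at most `κ/4` of the quadratic term; the law of large
  -- numbers for the second order coefficients consumes another `κ/4`, and `κ/2` remains.
  set η := min 1 (κ / (40 * A ^ 3)) with hη
  have hη0 : 0 < η := by positivity
  have hηκ : 10 * A ^ 3 * η ≤ κ / 4 := by
    have : η ≤ κ / (40 * A ^ 3) := min_le_right _ _
    calc 10 * A ^ 3 * η ≤ 10 * A ^ 3 * (κ / (40 * A ^ 3)) := by gcongr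
      _ = κ / 4 := by field_simp; norm_num
  obtain ⟨ρ, hρ, hloss⟩ := hE.loss_sub_ge hη0 (min_le_left _ _)
  -- Chebyshev: the scores are centered, so their sums have standard deviation of order `√n`, which
  -- is negligible against `b n * √n`.
  have hS : ∀ᶠ x in whp P, ∀ i,
      |∑ j ∈ Finset.range x.1, scoreFun w Λ h γ₀ i (Y j x.2)| ≤ b x.1 * √x.1 := by
    rw [eventually_all]
    intro i
    have hsc : IsBddMeas (scoreFun w Λ h γ₀ i) := hE.score i
    have hlim := hY.tendsto_smul_sum (f := fun _ => scoreFun w Λ h γ₀ i)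
      (c := fun n => (b n)⁻¹ * (√(n : ℝ))⁻¹) (fun _ => hsc.1)
      (fun _ => hsc.sq.integrable μ) (fun _ => hscore i) (by
        have h1 : Tendsto (fun n => (b n)⁻¹ ^ 2 * ∫ y, scoreFun w Λ h γ₀ i y ^ 2 ∂μ) atTop
            (𝓝 0) := by
          simpa using ((tendsto_inv_atTop_zero.comp hb).pow 2).mul_const
            (∫ y, scoreFun w Λ h γ₀ i y ^ 2 ∂μ)
        refine h1.congr' ?_
        filter_upwards [eventually_ne_atTop 0] with n hn
        have hn' : (n : ℝ) ≠ 0 := by exact_mod_cast hn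
        rw [mul_pow, inv_pow (√(n : ℝ)), Real.sq_sqrt (Nat.cast_nonneg n)]
        field_simp)
    filter_upwards [hlim.eventually (Metric.closedBall_mem_nhds (0 : ℝ) one_pos),
      eventually_whp_of_eventually (eventually_gt_atTop 0),
      eventually_whp_of_eventually (hb.eventually_gt_atTop 0)] with x hx hn hbx
    have hsn : 0 < √(x.1 : ℝ) := Real.sqrt_pos.2 (by exact_mod_cast hn)
    simp only [dist_zero_right, norm_mul, norm_inv, Real.norm_eq_abs,
      abs_of_pos hsn, abs_of_pos hbx] at hx
    rwa [← mul_inv, inv_mul_le_iff₀ (by positivity), mul_one] at hx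
  have hH : ∀ᶠ x in whp P, ∑ i, ∑ j, |(x.1 : ℝ)⁻¹ *
      ∑ m ∈ Finset.range x.1, hessFun w Λ h γ₀ i j (Y m x.2) - G i j| < κ / 4 := by
    have hlim : Tendsto (fun x : ℕ × Ω => ∑ i, ∑ j, |(x.1 : ℝ)⁻¹ *
        ∑ m ∈ Finset.range x.1, hessFun w Λ h γ₀ i j (Y m x.2) - G i j|) (whp P)
        (𝓝 (∑ i : ParamIdx d, ∑ j : ParamIdx d, 0)) := by
      refine tendsto_finsetSum _ fun i _ => tendsto_finsetSum _ fun j _ => ?_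
      have hh : IsBddMeas (hessFun w Λ h γ₀ i j) := hE.hess i j
      have := (hY.tendsto_mean hh.1 (hh.sq.integrable μ)).sub_const (G i j)
      rw [hGe, sub_self] at this
      simpa [hGe] using this.abs
    simp only [Finset.sum_const_zero] at hlim
    exact hlim.eventually_lt_const (by positivity)
  set D : ℝ := (Fintype.card (ParamIdx d) : ℝ) with hD
  -- Completing the square in `s = √n ‖v‖`: the expression `(κ/2) s² - (2D + 17A³) b s` is at least
  -- `-(2D + 17A³)² b² / (2κ)`.
  refine ⟨ρ, hρ, (2 * D + 17 * A ^ 3) ^ 2 / (2 * κ), ?_⟩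
  filter_upwards [hf, hS, hH, eventually_whp_of_eventually (eventually_gt_atTop 0),
    eventually_whp_of_eventually (hb.eventually_gt_atTop 0),
    eventually_whp_of_eventually (hb'.eventually_le_const one_pos)] with x hfx hSx hHx hn hbx hb1
    v hv
  have hn' : (0 : ℝ) < x.1 := by exact_mod_cast hn
  have hsn : 0 < √(x.1 : ℝ) := Real.sqrt_pos.2 hn'
  have hsq : √(x.1 : ℝ) * √(x.1 : ℝ) = x.1 := Real.mul_self_sqrt hn'.le
  set N := ‖v‖ with hN
  have hN0 : 0 ≤ N := norm_nonneg v
  have hsum := Finset.sum_le_sum fun j (_ : j ∈ Finset.range x.1) =>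
    hloss v hv (f x.1 x.2) (b x.1 / √x.1) (by positivity) hb1 hfx (Y j x.2)
  rw [Finset.sum_sub_distrib, Finset.sum_sub_distrib, Finset.sum_add_distrib, ← Finset.mul_sum,
    Finset.sum_comm, Finset.sum_const, Finset.card_range, nsmul_eq_mul] at hsum
  have hlin : -(D * (N * (b x.1 * √x.1))) ≤ ∑ i, ∑ j ∈ Finset.range x.1,
      coord v i * scoreFun w Λ h γ₀ i (Y j x.2) := by
    have : |∑ i, ∑ j ∈ Finset.range x.1, coord v i * scoreFun w Λ h γ₀ i (Y j x.2)| ≤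
        ∑ _i : ParamIdx d, N * (b x.1 * √x.1) := by
      refine (Finset.abs_sum_le_sum_abs _ _).trans (Finset.sum_le_sum fun i _ => ?_)
      rw [← Finset.mul_sum, abs_mul]
      exact mul_le_mul (abs_coord_le v i) (hSx i) (abs_nonneg _) hN0
    rw [Finset.sum_const, Finset.card_univ, nsmul_eq_mul] at this
    exact (abs_le.1 this).1
  have hqd : x.1 * (κ * N ^ 2 - κ / 4 * N ^ 2) ≤ ∑ m ∈ Finset.range x.1, ∑ i, ∑ j,
      coord v i * coord v j * hessFun w Λ h γ₀ i j (Y m x.2) := by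
    have e1 : ∑ m ∈ Finset.range x.1, ∑ i, ∑ j,
        coord v i * coord v j * hessFun w Λ h γ₀ i j (Y m x.2) =
        x.1 * ∑ i, ∑ j, coord v i * coord v j * ((x.1 : ℝ)⁻¹ *
          ∑ m ∈ Finset.range x.1, hessFun w Λ h γ₀ i j (Y m x.2)) := by
      rw [Finset.sum_comm, Finset.mul_sum]
      refine Finset.sum_congr rfl fun i _ => ?_
      rw [Finset.sum_comm, Finset.mul_sum]
      refine Finset.sum_congr rfl fun j _ => ?_
      rw [← Finset.mul_sum]
      field_simp
    rw [e1]
    refine mul_le_mul_of_nonneg_left ?_ hn'.le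
    have h2 : |∑ i, ∑ j, coord v i * coord v j * ((x.1 : ℝ)⁻¹ *
          ∑ m ∈ Finset.range x.1, hessFun w Λ h γ₀ i j (Y m x.2))
        - ∑ i, ∑ j, coord v i * coord v j * G i j| ≤ κ / 4 * N ^ 2 := by
      simp only [← Finset.sum_sub_distrib, ← mul_sub]
      have h3 : ∑ i, ∑ j, |(x.1 : ℝ)⁻¹ * ∑ m ∈ Finset.range x.1,
          hessFun w Λ h γ₀ i j (Y m x.2) - G i j| * N ^ 2 ≤ κ / 4 * N ^ 2 := by
        simp only [← Finset.sum_mul]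
        exact mul_le_mul_of_nonneg_right hHx.le (sq_nonneg N)
      refine ((Finset.abs_sum_le_sum_abs _ _).trans (Finset.sum_le_sum fun i _ =>
        (Finset.abs_sum_le_sum_abs _ _).trans (Finset.sum_le_sum fun j _ => ?_))).trans h3
      rw [abs_mul, abs_mul, mul_comm, pow_two]
      exact mul_le_mul_of_nonneg_left (mul_le_mul (abs_coord_le v i) (abs_coord_le v j)
        (abs_nonneg _) hN0) (abs_nonneg _)
    linarith [(abs_le.1 h2).1, hquad v]
  have e3 : x.1 * (A ^ 3 * (10 * (η * N ^ 2) + 17 * (b x.1 / √x.1 * N))) =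
      x.1 * N ^ 2 * (10 * A ^ 3 * η) + 17 * A ^ 3 * (b x.1 * √x.1 * N) := by
    have : (x.1 : ℝ) * (b x.1 / √x.1) = b x.1 * √x.1 := by
      rw [mul_div_assoc', div_eq_iff hsn.ne', mul_assoc, hsq, mul_comm]
    linear_combination 17 * A ^ 3 * N * this
  have h4 : x.1 * N ^ 2 * (10 * A ^ 3 * η) ≤ x.1 * N ^ 2 * (κ / 4) := by gcongr
  have h5 : -((2 * D + 17 * A ^ 3) ^ 2 / (2 * κ) * b x.1 ^ 2) ≤
      x.1 * N ^ 2 * (κ / 2) - (2 * D + 17 * A ^ 3) * (b x.1 * √x.1 * N) := by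
    have h6 : 0 ≤ (κ * (√x.1 * N) - (2 * D + 17 * A ^ 3) * b x.1) ^ 2 / (2 * κ) := by positivity
    have e7 : (κ * (√x.1 * N) - (2 * D + 17 * A ^ 3) * b x.1) ^ 2 / (2 * κ) =
        (√x.1 * √x.1) * N ^ 2 * (κ / 2) - (2 * D + 17 * A ^ 3) * (b x.1 * √x.1 * N)
        + (2 * D + 17 * A ^ 3) ^ 2 / (2 * κ) * b x.1 ^ 2 := by
      field_simp
      ring
    rw [e7, hsq] at h6
    linarith
  linarith

end LocalExpansion

end Local

end TransModel

namespace TransModel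

/-! ### Conditioning under independence, and the normalized distribution function -/

/-- By independence, the conditional distribution of `B` given `A` is the constant kernel at the law
of `B`; conditioning freezes `A` and integrates `B` out. -/
lemma condExp_ae_eq_integral_of_indepFun {Ω α : Type*} [MeasurableSpace Ω] [MeasurableSpace α]
    {P : Measure Ω} [IsProbabilityMeasure P] {A : Ω → α} {B : Ω → ℝ} (hA : Measurable A)
    (hB : Measurable B) (hAB : IndepFun A B P) {f : α × ℝ → ℝ} (hf : Measurable f)
    (hfi : Integrable (fun ω => f (A ω, B ω)) P) :
    P[fun ω => f (A ω, B ω) | MeasurableSpace.comap A inferInstance] =ᵐ[P]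
      fun ω => ∫ y, f (A ω, y) ∂(P.map B) := by
  have := Measure.isProbabilityMeasure_map (μ := P) hB.aemeasurable
  have h1 := condExp_prod_ae_eq_integral_condDistrib hA hB.aemeasurable hf.stronglyMeasurable hfi
  have h2 : condDistrib B A P =ᵐ[P.map A] Kernel.const α (P.map B) := by
    rw [condDistrib_ae_eq_iff_measure_eq_compProd _ hB.aemeasurable, Measure.compProd_const]
    exact (indepFun_iff_map_prod_eq_prod_map_map hA.aemeasurable hB.aemeasurable).1 hAB
  filter_upwards [h1, ae_of_ae_map hA.aemeasurable h2] with ω hω hω'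
  rw [hω, hω', Kernel.const_apply]

/-- The events `h(Y) ≤ h(y)` and `Y ≤ y` coincide, and `h` fixes 0 and 1. This identifies
`𝒯_S(h(y))` with `𝒯(y)`, so that the index set `U₀` covers the points occurring in the expansion of
the estimator. -/
lemma normCDF_map_strictMono {Ω : Type*} [MeasurableSpace Ω] {P : Measure Ω}
    [IsProbabilityMeasure P] {Y : Ω → ℝ} (hY : Measurable Y) {h : ℝ → ℝ} (hh : StrictMono h)
    (h0 : h 0 = 0) (h1 : h 1 = 1) (y : ℝ) :
    normCDF (P.map fun ω => h (Y ω)) (h y) = normCDF (P.map Y) y := by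
  have hm : Measurable fun ω => h (Y ω) := hh.monotone.measurable.comp hY
  have := Measure.isProbabilityMeasure_map (μ := P) hY.aemeasurable
  have := Measure.isProbabilityMeasure_map (μ := P) hm.aemeasurable
  have hc : ∀ y, cdf (P.map fun ω => h (Y ω)) (h y) = cdf (P.map Y) y := fun y => by
    rw [cdf_eq_real, cdf_eq_real, map_measureReal_apply hm measurableSet_Iic,
      map_measureReal_apply hY measurableSet_Iic]
    congr 1
    ext ω
    simp [hh.le_iff_le]
  have hc0 := hc 0
  have hc1 := hc 1
  rw [h0] at hc0
  rw [h1] at hc1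
  simp only [normCDF, hc, hc0, hc1]

lemma measurable_normCDF (μ : Measure ℝ) : Measurable (normCDF μ) :=
  (((monotone_cdf μ).measurable).sub_const _).div_const _

/-! ### The estimator of the transformation and the linearization of the statistic -/

/-- The assumptions on the model, the parametric class, the minimizer and the estimator under
which the test statistic is asymptotically normal. -/
structure Assumptions {Ω : Type*} [MeasurableSpace Ω] (P : Measure Ω)
    {dX d : ℕ} (X : ℕ → Ω → EuclideanSpace ℝ (Fin dX)) (Y : ℕ → Ω → ℝ)
    (Λ : EuclideanSpace ℝ (Fin d) → ℝ → ℝ) (Θ : Set (EuclideanSpace ℝ (Fin d))) (C₁ C₂ : Set ℝ)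
    (w h : ℝ → ℝ) (γ₀ : Param d)
    (hhat : (n : ℕ) → (Fin n → EuclideanSpace ℝ (Fin dX) × ℝ) → ℝ → ℝ)
    (ψ : ℝ × EuclideanSpace ℝ (Fin dX) → ℝ → ℝ) (U₀ : Set ℝ) : Prop where
  hX : ∀ i, Measurable (X i)
  hY : ∀ i, Measurable (Y i)
  hindep : iIndepFun (fun i ω => (X i ω, Y i ω)) P
  hident : ∀ i, IdentDistrib (fun ω => (X i ω, Y i ω)) (fun ω => (X 0 ω, Y 0 ω)) P P
  hΛ : ∀ θ ∈ Θ, StrictMono (Λ θ)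
  hC₁ : IsCompact C₁
  hC₂ : IsCompact C₂
  hΘ : IsCompact Θ
  hw0 : ∀ y, 0 ≤ w y
  hwc : Continuous w
  hwK : HasCompactSupport w
  hΛdiff : TwiceContDiffInParam (tsupport w) Θ Λ
  hmono : StrictMono h
  hcont : Continuous h
  h_zero : h 0 = 0
  h_one : h 1 = 1
  hγ₀ : γ₀ ∈ interior (C₁ ×ˢ C₂ ×ˢ Θ)
  hmin : ∀ γ ∈ C₁ ×ˢ C₂ ×ˢ Θ, γ ≠ γ₀ → popCriterion P (Y 0) w Λ h γ₀ < popCriterion P (Y 0) w Λ h γ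
  hhat_meas : ∀ (n : ℕ) (j : Fin n),
      Measurable fun D : Fin n → EuclideanSpace ℝ (Fin dX) × ℝ => hhat n D (D j).2
  hψ : Measurable (Function.uncurry ψ)
  hexp : ∀ ε : ℝ, 0 < ε → Tendsto (fun n : ℕ => P {ω | ∃ y ∈ tsupport w,
      ε < Real.sqrt n * |hhat n (sample X Y n ω) y - h y
        - (n : ℝ)⁻¹ * ∑ i : Fin n, ψ (obsZ P X Y i ω) (normCDF (P.map (Y 0)) y)|})
      atTop (𝓝 0)
  hU₀ : normCDF (P.map fun ω => h (Y 0 ω)) '' (h '' tsupport w) ⊆ U₀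
  hDonsker : IsDonsker ((fun t z => ψ z t) '' U₀) (P.map (obsZ P X Y 0))
  hψmean : ∀ t ∈ U₀, ∫ ω, ψ (obsZ P X Y 0 ω) t ∂P = 0
  hψsq : Integrable (fun ω => ψ (obsZ P X Y 0 ω) (obsZ P X Y 1 ω).1 ^ 2) P
  hΓ' : (GammaPrime P (Y 0) w Λ h γ₀).PosDef

namespace Assumptions

variable {Ω : Type*} [MeasurableSpace Ω] {P : Measure Ω} [IsProbabilityMeasure P]
    {dX d : ℕ} {X : ℕ → Ω → EuclideanSpace ℝ (Fin dX)} {Y : ℕ → Ω → ℝ}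
    {Λ : EuclideanSpace ℝ (Fin d) → ℝ → ℝ} {Θ : Set (EuclideanSpace ℝ (Fin d))} {C₁ C₂ : Set ℝ}
    {w h : ℝ → ℝ} {γ₀ : Param d}
    {hhat : (n : ℕ) → (Fin n → EuclideanSpace ℝ (Fin dX) × ℝ) → ℝ → ℝ}
    {ψ : ℝ × EuclideanSpace ℝ (Fin dX) → ℝ → ℝ} {U₀ : Set ℝ}

/-- The observation `(X_i, Y_i)`. -/
def obs (X : ℕ → Ω → EuclideanSpace ℝ (Fin dX)) (Y : ℕ → Ω → ℝ) (i : ℕ) (ω : Ω) :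
    EuclideanSpace ℝ (Fin dX) × ℝ := (X i ω, Y i ω)

/-- The map that sends `(x, y)` to `(𝒯(y), x)`. -/
noncomputable def toZ (μ : Measure ℝ) (v : EuclideanSpace ℝ (Fin dX) × ℝ) :
    ℝ × EuclideanSpace ℝ (Fin dX) := (normCDF μ v.2, v.1)

lemma measurable_toZ (μ : Measure ℝ) : Measurable (toZ (dX := dX) μ) :=
  ((measurable_normCDF μ).comp measurable_snd).prodMk measurable_fst

/-- The function `w r`, extended by zero, with `r` the residual at `γ₀`. -/
noncomputable def wresid (w : ℝ → ℝ) (Λ : EuclideanSpace ℝ (Fin d) → ℝ → ℝ) (h : ℝ → ℝ)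
    (γ : Param d) (y : ℝ) : ℝ := w y * resid Λ h γ y

/-- The kernel `w(y') r(y') ψ(z, 𝒯(y'))`. -/
noncomputable def kern (μ : Measure ℝ) (w : ℝ → ℝ) (Λ : EuclideanSpace ℝ (Fin d) → ℝ → ℝ)
    (h : ℝ → ℝ) (γ : Param d) (ψ : ℝ × EuclideanSpace ℝ (Fin dX) → ℝ → ℝ)
    (v v' : EuclideanSpace ℝ (Fin dX) × ℝ) : ℝ :=
  wresid w Λ h γ v'.2 * ψ (toZ μ v) (normCDF μ v'.2)

variable (H : Assumptions P X Y Λ Θ C₁ C₂ w h γ₀ hhat ψ U₀)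

include H

omit [IsProbabilityMeasure P] in
lemma isIID_obs : IsIID P (obs X Y) (P.map (obs X Y 0)) where
  meas i := (H.hX i).prodMk (H.hY i)
  indep := H.hindep
  law i := (H.hident i).map_eq

omit [IsProbabilityMeasure P] in
lemma isIID_Y : IsIID P Y (P.map (Y 0)) := by
  have h1 := H.isIID_obs.comp (f := Prod.snd) measurable_snd
  rwa [h1.law 0 |>.symm] at h1

omit [IsProbabilityMeasure P] in
lemma isIID_Z : IsIID P (obsZ P X Y) (P.map (obsZ P X Y 0)) := by
  have h1 := H.isIID_obs.comp (f := toZ (P.map (Y 0))) (measurable_toZ _)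
  rwa [h1.law 0 |>.symm] at h1

lemma normCDF_mem {y : ℝ} (hy : y ∈ tsupport w) : normCDF (P.map (Y 0)) y ∈ U₀ := by
  rw [← normCDF_map_strictMono (H.hY 0) H.hmono H.h_zero H.h_one]
  exact H.hU₀ ⟨h y, ⟨y, hy, rfl⟩, rfl⟩

omit [IsProbabilityMeasure P] in
lemma integral_ψ_map {t : ℝ} (ht : t ∈ U₀) : ∫ z, ψ z t ∂(P.map (obsZ P X Y 0)) = 0 := by
  have hm : Measurable fun z => ψ z t := H.hψ.comp (measurable_id.prodMk measurable_const)
  rw [integral_map (H.isIID_Z.meas 0).aemeasurable hm.aestronglyMeasurable]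
  exact H.hψmean t ht

lemma eventually_abs_sum_ψ_le {b : ℕ → ℝ} (hb : Tendsto b atTop atTop) :
    ∀ᶠ x in whp P, ∀ y ∈ tsupport w,
      |∑ i ∈ Finset.range x.1, ψ (obsZ P X Y i x.2) (normCDF (P.map (Y 0)) y)| ≤ b x.1 * √x.1 := by
  filter_upwards [H.hDonsker.eventually_abs_sum_le H.isIID_Z hb] with x hx y hy
  have h1 := hx _ ⟨_, H.normCDF_mem hy, rfl⟩
  simpa [H.integral_ψ_map (H.normCDF_mem hy)] using h1

omit [IsProbabilityMeasure P] in
lemma eventually_expansion {ε : ℝ} (hε : 0 < ε) :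
    ∀ᶠ x in whp P, ∀ y ∈ tsupport w, √x.1 * |hhat x.1 (sample X Y x.1 x.2) y - h y
        - (x.1 : ℝ)⁻¹ * ∑ i ∈ Finset.range x.1,
          ψ (obsZ P X Y i x.2) (normCDF (P.map (Y 0)) y)| ≤ ε := by
  rw [eventually_whp]
  refine (H.hexp ε hε).congr fun n => ?_
  congr 1
  ext ω
  simp only [mem_ofPred_eq, not_forall, not_le, exists_prop, Finset.sum_range]

/-- The uniform `√n`-rate of the estimator, in the form used throughout. The mean of the `ψ` terms
is controlled by the Donsker property and the remainder by the expansion; each uses up `b/2`. -/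
lemma eventually_abs_hhat_sub_le {b : ℕ → ℝ} (hb : Tendsto b atTop atTop) :
    ∀ᶠ x in whp P, ∀ y ∈ tsupport w,
      |hhat x.1 (sample X Y x.1 x.2) y - h y| ≤ b x.1 / √x.1 := by
  have hb2 : Tendsto (fun n => b n / 2) atTop atTop := hb.atTop_div_const two_pos
  filter_upwards [H.eventually_expansion one_pos, H.eventually_abs_sum_ψ_le hb2,
    eventually_whp_of_eventually (hb.eventually_ge_atTop 2),
    eventually_whp_of_eventually (eventually_gt_atTop 0)] with x h1 h2 hbx hn y hy
  have hn' : (0 : ℝ) < x.1 := by exact_mod_cast hn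
  have hsn : 0 < √(x.1 : ℝ) := Real.sqrt_pos.2 hn'
  have hsq : √(x.1 : ℝ) * √(x.1 : ℝ) = x.1 := Real.mul_self_sqrt hn'.le
  rw [le_div_iff₀ hsn]
  set S := ∑ i ∈ Finset.range x.1, ψ (obsZ P X Y i x.2) (normCDF (P.map (Y 0)) y) with hS
  set e := hhat x.1 (sample X Y x.1 x.2) y - h y with he
  have h3 : |(x.1 : ℝ)⁻¹ * S| * √x.1 ≤ b x.1 / 2 := by
    rw [abs_mul, abs_of_pos (inv_pos.2 hn'), mul_assoc, inv_mul_le_iff₀ hn']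
    calc |S| * √x.1 ≤ b x.1 / 2 * √x.1 * √x.1 := by gcongr; exact h2 y hy
      _ = x.1 * (b x.1 / 2) := by rw [mul_assoc, hsq]; ring
  have h4 := h1 y hy
  have h5 : |e| ≤ |e - (x.1 : ℝ)⁻¹ * S| + |(x.1 : ℝ)⁻¹ * S| := by
    simpa using abs_add_le (e - (x.1 : ℝ)⁻¹ * S) ((x.1 : ℝ)⁻¹ * S)
  calc |e| * √x.1 ≤ (|e - (x.1 : ℝ)⁻¹ * S| + |(x.1 : ℝ)⁻¹ * S|) * √x.1 := by gcongr
    _ ≤ b x.1 := by rw [add_mul]; linarith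

omit [IsProbabilityMeasure P] in
lemma mem_Θ : γ₀.2.2 ∈ interior Θ := by
  have := H.hγ₀
  rw [interior_prod_eq, interior_prod_eq] at this
  exact this.2.2

omit [IsProbabilityMeasure P] in
lemma isBddMeas_wresid : IsBddMeas (wresid w Λ h γ₀) := by
  have h1 := (isBddMeas_weight H.hwc H.hwK).mul (isBddMeas_indicator_resid (w := w) H.hwK H.hcont
    (H.hΛ _ (interior_subset H.mem_Θ)).monotone)
  convert h1 using 2 with y
  by_cases hy : y ∈ tsupport w
  · simp [hy, wresid]
  · simp [image_eq_zero_of_notMem_tsupport hy, wresid]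

omit [IsProbabilityMeasure P] H in
lemma wresid_eq_zero {γ : Param d} {y : ℝ} (hy : y ∉ tsupport w) : wresid w Λ h γ y = 0 := by
  simp [wresid, image_eq_zero_of_notMem_tsupport hy]

/-- The factor `w R̃` is bounded and vanishes off the support of `w`. On the support, `𝒯(y')` lies
in `U₀`, so integrability and centering in the first argument hold for every `y'`. Square
integrability concerns two independent observations only, not the diagonal. -/
lemma isCenteredKernel_kern :
    IsCenteredKernel (P.map (obs X Y 0)) (kern (P.map (Y 0)) w Λ h γ₀ ψ) := by
  have hQ := H.isIID_obs.isProbabilityMeasure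
  set μ := P.map (Y 0) with hμ
  have hψm : Measurable fun z : (EuclideanSpace ℝ (Fin dX) × ℝ) × EuclideanSpace ℝ (Fin dX) × ℝ =>
      ψ (toZ μ z.1) (normCDF μ z.2.2) :=
    H.hψ.comp (((measurable_toZ μ).comp measurable_fst).prodMk
      ((measurable_normCDF μ).comp (measurable_snd.comp measurable_snd)))
  have ha := H.isBddMeas_wresid.comp (β := (EuclideanSpace ℝ (Fin dX) × ℝ) ×
    EuclideanSpace ℝ (Fin dX) × ℝ) (measurable_snd.comp measurable_snd)
  have hmk : ∀ v' : EuclideanSpace ℝ (Fin dX) × ℝ, v'.2 ∈ tsupport w →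
      Integrable (fun v => ψ (toZ μ v) (normCDF μ v'.2)) (P.map (obs X Y 0)) ∧
      ∫ v, ψ (toZ μ v) (normCDF μ v'.2) ∂(P.map (obs X Y 0)) = 0 := fun v' hv' => by
    have hZ : P.map (obsZ P X Y 0) = (P.map (obs X Y 0)).map (toZ μ) := by
      rw [Measure.map_map (measurable_toZ μ) (H.isIID_obs.meas 0)]; rfl
    have h1 := (H.hDonsker.1 _ ⟨_, H.normCDF_mem hv', rfl⟩)
    have h2 := H.integral_ψ_map (H.normCDF_mem hv')
    rw [hZ] at h1 h2
    rw [integral_map (measurable_toZ μ).aemeasurable h1.1.aestronglyMeasurable] at h2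
    exact ⟨h1.2.comp_measurable (measurable_toZ μ), h2⟩
  refine ⟨ha.1.mul hψm, ?_, fun v' => ?_, fun v' => ?_⟩
  · have h1 : Integrable (fun z : (EuclideanSpace ℝ (Fin dX) × ℝ) × EuclideanSpace ℝ (Fin dX) × ℝ =>
        ψ (toZ μ z.1) (normCDF μ z.2.2) ^ 2) ((P.map (obs X Y 0)).prod (P.map (obs X Y 0))) := by
      rw [← (H.isIID_obs.measurePreserving_prodMk zero_ne_one).integrable_comp
        (hψm.pow_const 2).aestronglyMeasurable]
      exact H.hψsq
    obtain ⟨C, hC0, hC⟩ := ha.sq.exists_pos_bound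
    refine (h1.const_mul C).mono' ((ha.1.mul hψm).pow_const 2).aestronglyMeasurable
      (Eventually.of_forall fun z => ?_)
    rw [Real.norm_of_nonneg (sq_nonneg _), kern, mul_pow]
    exact mul_le_mul_of_nonneg_right ((le_abs_self _).trans (hC z)) (sq_nonneg _)
  · by_cases hv' : v'.2 ∈ tsupport w
    · exact (hmk v' hv').1.const_mul _
    · simp [kern, wresid_eq_zero hv']
  · by_cases hv' : v'.2 ∈ tsupport w
    · simp only [kern]
      rw [integral_const_mul, (hmk v' hv').2, mul_zero]
    · simp [kern, wresid_eq_zero hv']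

lemma tendsto_vStatistic_kern :
    Tendsto (fun x : ℕ × Ω =>
      (x.1 : ℝ)⁻¹ * (√x.1)⁻¹ * ∑ i ∈ Finset.range x.1, ∑ j ∈ Finset.range x.1,
        kern (P.map (Y 0)) w Λ h γ₀ ψ (obs X Y i x.2) (obs X Y j x.2)
      - (√x.1)⁻¹ * ∑ i ∈ Finset.range x.1,
        ∫ v', kern (P.map (Y 0)) w Λ h γ₀ ψ (obs X Y i x.2) v' ∂(P.map (obs X Y 0)))
      (whp P) (𝓝 0) := by
  refine H.isIID_obs.tendsto_vStatistic H.isCenteredKernel_kern fun b hb => ?_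
  obtain ⟨C, hC0, hC⟩ := H.isBddMeas_wresid.exists_pos_bound
  filter_upwards [H.eventually_abs_sum_ψ_le (hb.atTop_div_const hC0),
    eventually_whp_of_eventually (hb.eventually_ge_atTop 0)] with x hx hbx v'
  simp only [kern]
  rw [← Finset.mul_sum, abs_mul]
  by_cases hv' : v'.2 ∈ tsupport w
  · calc _ ≤ C * (b x.1 / C * √x.1) :=
          mul_le_mul (hC _) (hx _ hv') (abs_nonneg _) hC0.le
      _ = b x.1 * √x.1 := by field_simp
  · rw [wresid_eq_zero hv']
    simp only [abs_zero, zero_mul]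
    positivity

/-- The conditional expectation that defines `δ(Z₁)`. -/
lemma delta_ae_eq :
    delta P X Y w Λ h ψ γ₀ =ᵐ[P] fun ω => 2 * γ₀.1 *
      ∫ v', kern (P.map (Y 0)) w Λ h γ₀ ψ (obs X Y 0 ω) v' ∂(P.map (obs X Y 0)) := by
  set μ := P.map (Y 0) with hμ
  have hk := H.isCenteredKernel_kern
  have hind : IndepFun (obsZ P X Y 0) (Y 1) P :=
    (H.hindep.indepFun zero_ne_one).comp (measurable_toZ μ) measurable_snd
  have hfm : Measurable fun p : (ℝ × EuclideanSpace ℝ (Fin dX)) × ℝ =>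
      wresid w Λ h γ₀ p.2 * ψ p.1 (normCDF μ p.2) :=
    (H.isBddMeas_wresid.1.comp measurable_snd).mul
      (H.hψ.comp (measurable_fst.prodMk ((measurable_normCDF μ).comp measurable_snd)))
  have hL := (H.isIID_obs.memLp_kernel hk.meas hk.sq_int zero_ne_one)
  have hQ := H.isIID_obs.isProbabilityMeasure
  have hint : Integrable (fun ω => wresid w Λ h γ₀ (Y 1 ω) *
      ψ (obsZ P X Y 0 ω) (normCDF μ (Y 1 ω))) P := hL.integrable (by norm_num)
  have h1 := condExp_ae_eq_integral_of_indepFun (H.isIID_Z.meas 0) (H.hY 1) hind hfm hint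
  have e1 : (fun ω' => w (Y 1 ω') * ψ (obsZ P X Y 0 ω') (obsZ P X Y 1 ω').1 *
      resid Λ h γ₀ (Y 1 ω')) = fun ω => wresid w Λ h γ₀ (Y 1 ω) *
      ψ (obsZ P X Y 0 ω) (normCDF μ (Y 1 ω)) := by
    funext ω
    simp only [wresid, obsZ, ← hμ]
    ring
  filter_upwards [h1] with ω hω
  rw [delta, e1, hω, H.isIID_Y.law 1]
  congr 1
  have h2 : P.map (Y 0) = (P.map (obs X Y 0)).map Prod.snd := by
    rw [Measure.map_map measurable_snd (H.isIID_obs.meas 0)]; rfl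
  have hm2 : Measurable fun y => wresid w Λ h γ₀ y * ψ (obsZ P X Y 0 ω) (normCDF μ y) :=
    hfm.comp (measurable_const.prodMk measurable_id)
  rw [h2, integral_map measurable_snd.aemeasurable hm2.aestronglyMeasurable]
  rfl

end Assumptions

end TransModel

namespace TransModel

/-! ### Asymptotic linearity of the test statistic -/

/-- A slowly growing sequence. -/
noncomputable def slow (n : ℕ) : ℝ := √√√n

lemma tendsto_slow : Tendsto slow atTop atTop :=
  Real.tendsto_sqrt_atTop.comp (Real.tendsto_sqrt_atTop.comp tendsto_sqrt_natCast)

/-- The sequence is `n^{1/8}`. What matters is that it diverges and that its square, the order of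
the accumulated errors, is `o(√n)`. -/
lemma tendsto_slow_sq_div : Tendsto (fun n => slow n ^ 2 / √(n : ℝ)) atTop (𝓝 0) := by
  have h1 : Tendsto (fun n : ℕ => (√√(n : ℝ))⁻¹) atTop (𝓝 0) :=
    tendsto_inv_atTop_zero.comp (Real.tendsto_sqrt_atTop.comp tendsto_sqrt_natCast)
  refine h1.congr' ?_
  filter_upwards [eventually_gt_atTop 0] with n hn
  have hs : 0 < √√(n : ℝ) := Real.sqrt_pos.2 (Real.sqrt_pos.2 (by exact_mod_cast hn))
  have h2 : √(n : ℝ) = √√(n : ℝ) * √√(n : ℝ) := (Real.mul_self_sqrt (Real.sqrt_nonneg _)).symm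
  rw [slow, Real.sq_sqrt (Real.sqrt_nonneg _), eq_div_iff (Real.sqrt_pos.1 hs).ne']
  nth_rw 2 [h2]
  field_simp

lemma tendsto_slow_div : Tendsto (fun n => slow n / √(n : ℝ)) atTop (𝓝 0) := by
  refine squeeze_zero' ?_ ?_ tendsto_slow_sq_div
  · exact Eventually.of_forall fun n => div_nonneg (Real.sqrt_nonneg _) (Real.sqrt_nonneg _)
  · filter_upwards [tendsto_slow.eventually_ge_atTop 1] with n hn
    gcongr
    nlinarith

namespace Assumptions

variable {Ω : Type*} [MeasurableSpace Ω] {P : Measure Ω} [IsProbabilityMeasure P]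
    {dX d : ℕ} {X : ℕ → Ω → EuclideanSpace ℝ (Fin dX)} {Y : ℕ → Ω → ℝ}
    {Λ : EuclideanSpace ℝ (Fin d) → ℝ → ℝ} {Θ : Set (EuclideanSpace ℝ (Fin d))} {C₁ C₂ : Set ℝ}
    {w h : ℝ → ℝ} {γ₀ : Param d}
    {hhat : (n : ℕ) → (Fin n → EuclideanSpace ℝ (Fin dX) × ℝ) → ℝ → ℝ}
    {ψ : ℝ × EuclideanSpace ℝ (Fin dX) → ℝ → ℝ} {U₀ : Set ℝ}

/-- The empirical criterion with the estimated transformation, as a sum over `range n`. -/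
noncomputable def empSum (X : ℕ → Ω → EuclideanSpace ℝ (Fin dX)) (Y : ℕ → Ω → ℝ) (w : ℝ → ℝ)
    (Λ : EuclideanSpace ℝ (Fin d) → ℝ → ℝ)
    (hhat : (n : ℕ) → (Fin n → EuclideanSpace ℝ (Fin dX) × ℝ) → ℝ → ℝ) (γ : Param d)
    (x : ℕ × Ω) : ℝ :=
  ∑ j ∈ Finset.range x.1, w (Y j x.2) * resid Λ (hhat x.1 (sample X Y x.1 x.2)) γ (Y j x.2) ^ 2

omit [MeasurableSpace Ω] in
lemma testStat_eq (n : ℕ) (ω : Ω) :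
    testStat X Y w Λ C₁ C₂ Θ hhat n ω =
      sInf ((fun γ => empSum X Y w Λ hhat γ (n, ω)) '' (C₁ ×ˢ C₂ ×ˢ Θ)) := by
  simp only [testStat, empSum, Finset.sum_range]
  rfl

variable (H : Assumptions P X Y Λ Θ C₁ C₂ w h γ₀ hhat ψ U₀)

include H

omit [IsProbabilityMeasure P] in
lemma empSum_nonneg (γ : Param d) (x : ℕ × Ω) : 0 ≤ empSum X Y w Λ hhat γ x :=
  Finset.sum_nonneg fun _ _ => mul_nonneg (H.hw0 _) (sq_nonneg _)

omit [IsProbabilityMeasure P] in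
lemma bddBelow_empSum (x : ℕ × Ω) :
    BddBelow ((fun γ => empSum X Y w Λ hhat γ x) '' (C₁ ×ˢ C₂ ×ˢ Θ)) :=
  ⟨0, by rintro _ ⟨γ, -, rfl⟩; exact H.empSum_nonneg γ x⟩

omit [IsProbabilityMeasure P] in
lemma mem_Υ : γ₀ ∈ C₁ ×ˢ C₂ ×ˢ Θ := interior_subset H.hγ₀

omit [IsProbabilityMeasure P] in
lemma isCompact_Υ : IsCompact (C₁ ×ˢ C₂ ×ˢ Θ) := H.hC₁.prod (H.hC₂.prod H.hΘ)

omit [IsProbabilityMeasure P] in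
lemma testStat_le (x : ℕ × Ω) :
    testStat X Y w Λ C₁ C₂ Θ hhat x.1 x.2 ≤ empSum X Y w Λ hhat γ₀ x := by
  rw [testStat_eq]
  exact csInf_le (H.bddBelow_empSum x) (mem_image_of_mem _ H.mem_Υ)

omit [IsProbabilityMeasure P] in
lemma continuousOn_weight_mul_resid_sq (f : ℝ → ℝ) (y : ℝ) :
    ContinuousOn (fun γ => w y * resid Λ f γ y ^ 2) (C₁ ×ˢ C₂ ×ˢ Θ) := by
  by_cases hy : y ∈ tsupport w
  · obtain ⟨D₁, -, h1, -⟩ := H.hΛdiff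
    have hc : ContinuousOn (fun θ => Λ θ y) Θ := fun θ hθ => (h1 y hy θ hθ).continuousWithinAt
    have hc' : ContinuousOn (fun γ : Param d => Λ γ.2.2 y) (C₁ ×ˢ C₂ ×ˢ Θ) :=
      hc.comp (by fun_prop) fun γ hγ => hγ.2.2
    simp only [resid]
    exact continuousOn_const.mul (((by fun_prop : ContinuousOn
      (fun γ : Param d => f y * γ.1 + γ.2.1) (C₁ ×ˢ C₂ ×ˢ Θ)).sub hc').pow 2)
  · simp only [image_eq_zero_of_notMem_tsupport hy, zero_mul]
    exact continuousOn_const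

omit [IsProbabilityMeasure P] in
-- The criterion is continuous in the parameter, which handles the uncountable infimum. The
-- estimator enters only through its values at the sample points.
lemma measurable_testStat (n : ℕ) : Measurable (testStat X Y w Λ C₁ C₂ Θ hhat n) := by
  have h0 : testStat X Y w Λ C₁ C₂ Θ hhat n =
      fun ω => sInf ((fun γ => empSum X Y w Λ hhat γ (n, ω)) '' (C₁ ×ˢ C₂ ×ˢ Θ)) :=
    funext fun ω => testStat_eq n ω
  rw [h0]
  refine measurable_sInf_image (f := fun γ ω => empSum X Y w Λ hhat γ (n, ω)) (fun γ hγ => ?_)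
    (fun ω => ?_) fun ω => H.bddBelow_empSum (n, ω)
  · change Measurable fun ω => ∑ j ∈ Finset.range n,
      w (Y j ω) * resid Λ (hhat n (sample X Y n ω)) γ (Y j ω) ^ 2
    refine Finset.measurable_fun_sum _ fun j hj => ?_
    have hs : Measurable (sample X Y n) :=
      measurable_pi_lambda _ fun i => (H.hX i).prodMk (H.hY i)
    have h1 : Measurable fun ω => hhat n (sample X Y n ω) (Y j ω) :=
      (H.hhat_meas n ⟨j, Finset.mem_range.1 hj⟩).comp hs
    have h2 : Measurable fun ω => Λ γ.2.2 (Y j ω) :=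
      (H.hΛ _ hγ.2.2).monotone.measurable.comp (H.hY j)
    simp only [resid]
    exact (H.hwc.measurable.comp (H.hY j)).mul
      ((((h1.mul_const _).add_const _).sub h2).pow_const 2)
  · exact continuousOn_finsetSum _ fun j _ => H.continuousOn_weight_mul_resid_sq _ _

omit [IsProbabilityMeasure P] in
lemma isBddMeas_loss {γ : Param d} (hγ : γ ∈ C₁ ×ˢ C₂ ×ˢ Θ) :
    IsBddMeas fun y => w y * resid Λ h γ y ^ 2 :=
  TransModel.isBddMeas_loss H.hwc H.hwK H.hcont (H.hΛ _ hγ.2.2).monotone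

omit [IsProbabilityMeasure P] in
lemma popCriterion_eq {γ : Param d} (hγ : γ ∈ C₁ ×ˢ C₂ ×ˢ Θ) :
    popCriterion P (Y 0) w Λ h γ = ∫ y, w y * resid Λ h γ y ^ 2 ∂(P.map (Y 0)) := by
  rw [integral_map (H.hY 0).aemeasurable (H.isBddMeas_loss hγ).1.aestronglyMeasurable]
  rfl

omit [IsProbabilityMeasure P] in
lemma exists_localExpansion : ∃ A, LocalExpansion w Λ h γ₀ A :=
  TransModel.exists_localExpansion H.hw0 H.hwc H.hwK H.hcont H.hΛdiff H.mem_Θ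
    (H.hΛ _ (interior_subset H.mem_Θ)).monotone

/-- The empirical criterion at `γ₀` is consistent. -/
lemma tendsto_empSum : Tendsto (fun x => (x.1 : ℝ)⁻¹ * empSum X Y w Λ hhat γ₀ x) (whp P)
    (𝓝 (popCriterion P (Y 0) w Λ h γ₀)) := by
  obtain ⟨A, hE⟩ := H.exists_localExpansion
  have hA := hE.one_le
  have hl := H.isBddMeas_loss H.mem_Υ
  have hμ := H.isIID_Y.isProbabilityMeasure
  have h1 := H.isIID_Y.tendsto_mean hl.1 (hl.sq.integrable _)
  rw [← H.popCriterion_eq H.mem_Υ] at h1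
  -- Each summand changes by at most `w · |c₁ e| · |2r + c₁ e| ≤ A · Aε · 3A` when `h` is replaced
  -- by its estimator.
  have h2 : Tendsto (fun x : ℕ × Ω => 3 * A ^ 3 * (slow x.1 / √x.1)) (whp P) (𝓝 0) := by
    simpa using (tendsto_whp_of_tendsto (P := P) tendsto_slow_div).const_mul (3 * A ^ 3)
  have h3 : Tendsto (fun x : ℕ × Ω => (x.1 : ℝ)⁻¹ * empSum X Y w Λ hhat γ₀ x - (x.1 : ℝ)⁻¹ *
      ∑ i ∈ Finset.range x.1, w (Y i x.2) * resid Λ h γ₀ (Y i x.2) ^ 2) (whp P) (𝓝 0) := by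
    refine squeeze_zero_norm' ?_ h2
    filter_upwards [H.eventually_abs_hhat_sub_le tendsto_slow,
      eventually_whp_of_eventually (tendsto_slow_div.eventually_le_const one_pos)] with x hx hx1
    set ε := slow x.1 / √x.1 with hε
    have hε0 : 0 ≤ ε := div_nonneg (Real.sqrt_nonneg _) (Real.sqrt_nonneg _)
    rw [← mul_sub, empSum, ← Finset.sum_sub_distrib, norm_mul, Real.norm_eq_abs,
      Real.norm_eq_abs, abs_of_nonneg (by positivity : (0 : ℝ) ≤ (x.1 : ℝ)⁻¹)]
    have h4 : |∑ i ∈ Finset.range x.1,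
        (w (Y i x.2) * resid Λ (hhat x.1 (sample X Y x.1 x.2)) γ₀ (Y i x.2) ^ 2 -
          w (Y i x.2) * resid Λ h γ₀ (Y i x.2) ^ 2)| ≤ ∑ i ∈ Finset.range x.1, 3 * A ^ 3 * ε := by
      refine (Finset.abs_sum_le_sum_abs _ _).trans (Finset.sum_le_sum fun i _ => ?_)
      set y := Y i x.2 with hy'
      by_cases hy : y ∈ tsupport w
      · rw [← mul_sub, abs_mul, abs_of_nonneg (hE.nonneg y), resid_eq_add (h := h)]
        set e := hhat x.1 (sample X Y x.1 x.2) y - h y with he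
        have e1 : (resid Λ h γ₀ y + γ₀.1 * e) ^ 2 - resid Λ h γ₀ y ^ 2 =
          γ₀.1 * e * (2 * resid Λ h γ₀ y + γ₀.1 * e) := by ring
        have h5 : |γ₀.1 * e| ≤ A * ε := by
          rw [abs_mul]
          exact mul_le_mul hE.abs_fst_le (hx y hy) (abs_nonneg _) (by linarith)
        have h6 : |2 * resid Λ h γ₀ y + γ₀.1 * e| ≤ 3 * A := by
          refine (abs_add_le _ _).trans ?_
          rw [abs_mul, abs_two]
          have := hE.abs_resid_le y hy
          nlinarith
        rw [e1, abs_mul]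
        calc w y * (|γ₀.1 * e| * |2 * resid Λ h γ₀ y + γ₀.1 * e|) ≤ A * (A * ε * (3 * A)) := by
              gcongr
              exact hE.weight_le y
          _ = 3 * A ^ 3 * ε := by ring
      · simp only [image_eq_zero_of_notMem_tsupport hy, zero_mul, sub_zero, abs_zero]
        positivity
    refine (mul_le_mul_of_nonneg_left h4 (by positivity)).trans ?_
    rw [Finset.sum_const, Finset.card_range, nsmul_eq_mul, ← mul_assoc]
    exact mul_le_of_le_one_left (by positivity) inv_mul_le_one
  simpa using h3.add h1

/-- Away from `γ₀` the empirical criterion is larger than at `γ₀`. -/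
lemma eventually_empSum_le_of_le_dist {ρ : ℝ} (hρ : 0 < ρ) :
    ∀ᶠ x in whp P, ∀ γ ∈ C₁ ×ˢ C₂ ×ˢ Θ, ρ ≤ dist γ γ₀ →
      empSum X Y w Λ hhat γ₀ x ≤ empSum X Y w Λ hhat γ x := by
  obtain ⟨A, hE⟩ := H.exists_localExpansion
  have hA := hE.one_le
  set M := popCriterion P (Y 0) w Λ h γ₀ with hM
  have hM0 : 0 ≤ M := integral_nonneg fun ω => mul_nonneg (H.hw0 _) (sq_nonneg _)
  obtain ⟨c, hc, hfar⟩ := H.isIID_Y.eventually_loss_ge H.isCompact_Υ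
    (ℓ := fun γ y => w y * resid Λ h γ y ^ 2) (fun γ hγ => H.isBddMeas_loss hγ)
    (fun γ y => mul_nonneg (H.hw0 _) (sq_nonneg _))
    (fun y => H.continuousOn_weight_mul_resid_sq h y) (γ₀ := γ₀) (ρ := ρ) (fun γ hγ hd => by
      rw [← H.popCriterion_eq hγ, ← H.popCriterion_eq H.mem_Υ]
      exact H.hmin γ hγ (by rintro rfl; rw [dist_self] at hd; linarith))
  rw [← H.popCriterion_eq H.mem_Υ, ← hM] at hfar
  obtain ⟨B, hB⟩ := H.hC₁.isBounded.exists_norm_le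
  -- Then `(1 - κ)(M + c) = M + 3c/4 + κ²·0 - 0 = M + 3c/4`; after a further loss of `c/4` from the
  -- estimation error, `M + c/2` remains, which still exceeds the mean empirical loss at `γ₀`.
  set κ := c / (4 * (M + c)) with hκ
  have hκ0 : 0 < κ := by positivity
  have hκc : κ * (M + c) = c / 4 := by rw [hκ]; field_simp
  have hlim : Tendsto (fun x : ℕ × Ω => A * (κ⁻¹ * (B * (slow x.1 / √x.1)) ^ 2)) (whp P)
      (𝓝 0) := by
    have := (((tendsto_whp_of_tendsto (P := P) tendsto_slow_div).const_mul B).pow 2).const_mul κ⁻¹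
      |>.const_mul A
    simpa using this
  filter_upwards [hfar, H.eventually_abs_hhat_sub_le tendsto_slow,
    hlim.eventually_lt_const (show 0 < c / 4 by positivity),
    H.tendsto_empSum.eventually_lt_const (show M < M + c / 2 by linarith),
    eventually_whp_of_eventually (eventually_gt_atTop 0)] with x hx he hs hγ₀ hn γ hγ hd
  have hn' : (0 : ℝ) < x.1 := by exact_mod_cast hn
  set ε := slow x.1 / √x.1 with hε
  have hε0 : 0 ≤ ε := div_nonneg (Real.sqrt_nonneg _) (Real.sqrt_nonneg _)
  -- From `(r + e)² ≥ (1 - κ) r² - κ⁻¹ e²`. Giving up a fraction of the loss makes a bound on the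
  -- residuals uniform over the parameter set unnecessary; only `c₁` has to be bounded.
  have hpt : ∀ y, (1 - κ) * (w y * resid Λ h γ y ^ 2) - A * (κ⁻¹ * (B * ε) ^ 2) ≤
      w y * resid Λ (hhat x.1 (sample X Y x.1 x.2)) γ y ^ 2 := by
    intro y
    by_cases hy : y ∈ tsupport w
    · rw [resid_eq_add (h := h) (hhat x.1 (sample X Y x.1 x.2))]
      set r := resid Λ h γ y with hr
      set e := γ.1 * (hhat x.1 (sample X Y x.1 x.2) y - h y) with he'
      have h1 : |e| ≤ B * ε := by
        rw [abs_mul]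
        exact mul_le_mul (hB _ hγ.1) (he y hy) (abs_nonneg _) ((norm_nonneg _).trans (hB _ hγ.1))
      have h2 : e ^ 2 ≤ (B * ε) ^ 2 := by rw [← sq_abs e]; gcongr
      have h3 : (1 - κ) * r ^ 2 - κ⁻¹ * e ^ 2 ≤ (r + e) ^ 2 := by
        have : (r + e) ^ 2 - ((1 - κ) * r ^ 2 - κ⁻¹ * e ^ 2) =
            κ⁻¹ * ((κ * r + e) ^ 2 + κ * e ^ 2) := by field_simp; ring
        have h4 : 0 ≤ κ⁻¹ * ((κ * r + e) ^ 2 + κ * e ^ 2) := by positivity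
        linarith
      have h4 : w y * (κ⁻¹ * e ^ 2) ≤ A * (κ⁻¹ * (B * ε) ^ 2) := by
        gcongr
        exact hE.weight_le y
      have h5 := mul_le_mul_of_nonneg_left h3 (H.hw0 y)
      linarith
    · simp only [image_eq_zero_of_notMem_tsupport hy, zero_mul, mul_zero, zero_sub, neg_nonpos]
      positivity
  have hsum := Finset.sum_le_sum fun j (_ : j ∈ Finset.range x.1) => hpt (Y j x.2)
  rw [Finset.sum_sub_distrib, ← Finset.mul_sum, Finset.sum_const, Finset.card_range,
    nsmul_eq_mul] at hsum
  have hx' := hx γ hγ hd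
  rw [← div_eq_inv_mul, le_div_iff₀ hn'] at hx'
  rw [← div_eq_inv_mul, div_lt_iff₀ hn'] at hγ₀
  have hκ1 : 0 ≤ 1 - κ := by
    have : κ * 1 ≤ 1 / 4 := by
      rw [hκ, mul_one, div_le_div_iff₀ (by positivity) (by norm_num)]; linarith
    linarith
  have h6 := mul_le_mul_of_nonneg_left hx' hκ1
  have h7 : (x.1 : ℝ) * (A * (κ⁻¹ * (B * ε) ^ 2)) ≤ x.1 * (c / 4) := by gcongr
  have h8 : (1 - κ) * ((M + c) * x.1) = (M + c) * x.1 - c / 4 * x.1 := by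
    rw [← hκc]; ring
  have h9 : (x.1 : ℝ) * (c / 4) ≥ 0 := by positivity
  simp only [empSum] at hγ₀ ⊢
  linarith

omit [IsProbabilityMeasure P] in
lemma eventually_add_mem : ∀ᶠ v in 𝓝 (0 : Param d), γ₀ + v ∈ C₁ ×ˢ C₂ ×ˢ Θ := by
  have hc : Tendsto (fun v : Param d => γ₀ + v) (𝓝 0) (𝓝 γ₀) := by
    have : Continuous fun v : Param d => γ₀ + v := by fun_prop
    simpa using this.tendsto 0
  exact hc (mem_interior_iff_mem_nhds.1 H.hγ₀)

lemma integral_scoreFun_eq_zero (i : ParamIdx d) :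
    ∫ y, scoreFun w Λ h γ₀ i y ∂(P.map (Y 0)) = 0 := by
  obtain ⟨A, hE⟩ := H.exists_localExpansion
  have hμ := H.isIID_Y.isProbabilityMeasure
  refine hE.integral_scoreFun_eq_zero
    (H.eventually_add_mem.mono fun v hv => (H.isBddMeas_loss hv).integrable _)
    (H.eventually_add_mem.mono fun v hv => ?_) i
  rw [← H.popCriterion_eq hv, ← H.popCriterion_eq H.mem_Υ]
  rcases eq_or_ne (γ₀ + v) γ₀ with he | he
  · rw [he]
  · exact (H.hmin _ hv he).le

omit [IsProbabilityMeasure P] in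
lemma gammaPrime_eq (i j : ParamIdx d) : GammaPrime P (Y 0) w Λ h γ₀ i j =
    ∫ y, hessFun w Λ h γ₀ i j y ∂(P.map (Y 0)) := by
  obtain ⟨A, hE⟩ := H.exists_localExpansion
  have hm : Measurable (hessFun w Λ h γ₀ i j) := (hE.hess i j).1
  rw [integral_map (H.hY 0).aemeasurable hm.aestronglyMeasurable]
  rfl

/-- The minimum of the empirical criterion is attained at `γ₀` up to a negligible error. -/
lemma exists_eventually_le_testStat : ∃ C, ∀ᶠ x in whp P,
    empSum X Y w Λ hhat γ₀ x - C * slow x.1 ^ 2 ≤ testStat X Y w Λ C₁ C₂ Θ hhat x.1 x.2 := by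
  obtain ⟨A, hE⟩ := H.exists_localExpansion
  obtain ⟨ρ, hρ, C, hC⟩ := hE.eventually_sum_loss_ge H.isIID_Y H.integral_scoreFun_eq_zero
    H.hΓ' H.gammaPrime_eq tendsto_slow tendsto_slow_div
    (f := fun n ω => hhat n (sample X Y n ω)) (H.eventually_abs_hhat_sub_le tendsto_slow)
  -- Far from `γ₀` the criterion is not smaller at all, so the constant has to be nonnegative to
  -- cover both regions.
  refine ⟨max C 0, ?_⟩
  filter_upwards [hC, H.eventually_empSum_le_of_le_dist hρ] with x hx hx'
  rw [testStat_eq]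
  refine le_csInf (⟨γ₀, H.mem_Υ⟩ |> Nonempty.image _) ?_
  rintro _ ⟨γ, hγ, rfl⟩
  rcases le_or_gt ρ (dist γ γ₀) with hd | hd
  · have h1 := hx' γ hγ hd
    have h2 : 0 ≤ max C 0 * slow x.1 ^ 2 := mul_nonneg (le_max_right _ _) (sq_nonneg _)
    simp only
    linarith
  · have h1 := hx (γ - γ₀) (by rw [← dist_eq_norm]; exact hd.le)
    rw [add_sub_cancel] at h1
    have h2 : C * slow x.1 ^ 2 ≤ max C 0 * slow x.1 ^ 2 :=
      mul_le_mul_of_nonneg_right (le_max_left _ _) (sq_nonneg _)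
    simp only [empSum] at h1 ⊢
    linarith

end Assumptions

end TransModel

/-! ### Influence function and asymptotic normality -/

namespace TransModel

namespace Assumptions

variable {Ω : Type*} [MeasurableSpace Ω] {P : Measure Ω} [IsProbabilityMeasure P]
    {dX d : ℕ} {X : ℕ → Ω → EuclideanSpace ℝ (Fin dX)} {Y : ℕ → Ω → ℝ}
    {Λ : EuclideanSpace ℝ (Fin d) → ℝ → ℝ} {Θ : Set (EuclideanSpace ℝ (Fin d))} {C₁ C₂ : Set ℝ}
    {w h : ℝ → ℝ} {γ₀ : Param d}
    {hhat : (n : ℕ) → (Fin n → EuclideanSpace ℝ (Fin dX) × ℝ) → ℝ → ℝ}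
    {ψ : ℝ × EuclideanSpace ℝ (Fin dX) → ℝ → ℝ} {U₀ : Set ℝ}

/-- The influence function `w(y) r(y)² + δ` of the test statistic. -/
noncomputable def influence (Q : Measure (EuclideanSpace ℝ (Fin dX) × ℝ)) (μ : Measure ℝ)
    (w : ℝ → ℝ) (Λ : EuclideanSpace ℝ (Fin d) → ℝ → ℝ) (h : ℝ → ℝ) (γ : Param d)
    (ψ : ℝ × EuclideanSpace ℝ (Fin dX) → ℝ → ℝ) (v : EuclideanSpace ℝ (Fin dX) × ℝ) : ℝ :=
  w v.2 * resid Λ h γ v.2 ^ 2 + 2 * γ.1 * ∫ v', kern μ w Λ h γ ψ v v' ∂Q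

variable (H : Assumptions P X Y Λ Θ C₁ C₂ w h γ₀ hhat ψ U₀)

include H

lemma tendsto_testStat_sub_empSum : Tendsto (fun x : ℕ × Ω => (√x.1)⁻¹ *
    (testStat X Y w Λ C₁ C₂ Θ hhat x.1 x.2 - empSum X Y w Λ hhat γ₀ x)) (whp P) (𝓝 0) := by
  obtain ⟨C, hC⟩ := H.exists_eventually_le_testStat
  have hlim : Tendsto (fun x : ℕ × Ω => C * (slow x.1 ^ 2 / √x.1)) (whp P) (𝓝 0) := by
    simpa using (tendsto_whp_of_tendsto (P := P) tendsto_slow_sq_div).const_mul C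
  refine squeeze_zero_norm' ?_ hlim
  filter_upwards [hC] with x hx
  have h1 := H.testStat_le x
  rw [norm_mul, Real.norm_of_nonneg (by positivity), Real.norm_eq_abs,
    abs_of_nonpos (by linarith), mul_div_assoc', div_eq_inv_mul]
  refine mul_le_mul_of_nonneg_left ?_ (by positivity)
  linarith

/-- Each of the `n` summands is at most `A slow² / n` by the rate of the estimator, so the
normalized sum is of order `slow² / √n`. -/
lemma tendsto_sum_weight_mul_sq : Tendsto (fun x : ℕ × Ω => (√x.1)⁻¹ *
    ∑ j ∈ Finset.range x.1, w (Y j x.2) *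
      (hhat x.1 (sample X Y x.1 x.2) (Y j x.2) - h (Y j x.2)) ^ 2) (whp P) (𝓝 0) := by
  obtain ⟨A, hE⟩ := H.exists_localExpansion
  have hlim : Tendsto (fun x : ℕ × Ω => A * (slow x.1 ^ 2 / √x.1)) (whp P) (𝓝 0) := by
    simpa using (tendsto_whp_of_tendsto (P := P) tendsto_slow_sq_div).const_mul A
  have hA := hE.one_le
  refine squeeze_zero_norm' ?_ hlim
  filter_upwards [H.eventually_abs_hhat_sub_le tendsto_slow,
    eventually_whp_of_eventually (eventually_gt_atTop 0)] with x hx hn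
  have hn' : (0 : ℝ) < x.1 := by exact_mod_cast hn
  have hs0 : 0 ≤ slow x.1 := Real.sqrt_nonneg _
  have hpt : ∀ y, w y * (hhat x.1 (sample X Y x.1 x.2) y - h y) ^ 2 ≤
      A * (slow x.1 ^ 2 / x.1) := fun y => by
    by_cases hy : y ∈ tsupport w
    · have h1 : (hhat x.1 (sample X Y x.1 x.2) y - h y) ^ 2 ≤ slow x.1 ^ 2 / x.1 := by
        rw [← sq_abs]
        refine (pow_le_pow_left₀ (abs_nonneg _) (hx y hy) 2).trans_eq ?_
        rw [div_pow, Real.sq_sqrt hn'.le]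
      exact mul_le_mul (hE.weight_le y) h1 (sq_nonneg _) (by linarith)
    · simp only [image_eq_zero_of_notMem_tsupport hy, zero_mul]
      positivity
  rw [Real.norm_of_nonneg (mul_nonneg (by positivity)
    (Finset.sum_nonneg fun j _ => mul_nonneg (H.hw0 _) (sq_nonneg _)))]
  refine (mul_le_mul_of_nonneg_left (Finset.sum_le_sum fun j _ => hpt _)
    (by positivity)).trans_eq ?_
  rw [Finset.sum_const, Finset.card_range, nsmul_eq_mul]
  field_simp

omit [IsProbabilityMeasure P] in
lemma tendsto_sum_wresid_mul : Tendsto (fun x : ℕ × Ω => (√x.1)⁻¹ *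
    ∑ j ∈ Finset.range x.1, wresid w Λ h γ₀ (Y j x.2) *
      (hhat x.1 (sample X Y x.1 x.2) (Y j x.2) - h (Y j x.2) - (x.1 : ℝ)⁻¹ *
        ∑ i ∈ Finset.range x.1, ψ (obsZ P X Y i x.2) (normCDF (P.map (Y 0)) (Y j x.2))))
    (whp P) (𝓝 0) := by
  obtain ⟨C, hC0, hC⟩ := H.isBddMeas_wresid.exists_pos_bound
  rw [Metric.tendsto_nhds]
  intro ε hε
  -- With `C` bounding `w R̃`, the normalized sum is at most `n^{-1/2} · n · C · (ε / (2C)) / √n = ε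
  -- / 2`.
  filter_upwards [H.eventually_expansion (ε := ε / (2 * C)) (by positivity),
    eventually_whp_of_eventually (eventually_gt_atTop 0)] with x hx hn
  have hn' : (0 : ℝ) < x.1 := by exact_mod_cast hn
  have hsn : 0 < √(x.1 : ℝ) := Real.sqrt_pos.2 hn'
  have hsq : √(x.1 : ℝ) * √(x.1 : ℝ) = x.1 := Real.mul_self_sqrt hn'.le
  rw [dist_zero_right, norm_mul, Real.norm_of_nonneg (by positivity), Real.norm_eq_abs]
  have h1 : |∑ j ∈ Finset.range x.1, wresid w Λ h γ₀ (Y j x.2) *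
      (hhat x.1 (sample X Y x.1 x.2) (Y j x.2) - h (Y j x.2) - (x.1 : ℝ)⁻¹ *
        ∑ i ∈ Finset.range x.1, ψ (obsZ P X Y i x.2) (normCDF (P.map (Y 0)) (Y j x.2)))| ≤
      ∑ j ∈ Finset.range x.1, C * (ε / (2 * C) / √x.1) := by
    refine (Finset.abs_sum_le_sum_abs _ _).trans (Finset.sum_le_sum fun j _ => ?_)
    by_cases hy : Y j x.2 ∈ tsupport w
    · rw [abs_mul]
      refine mul_le_mul (hC _) ?_ (abs_nonneg _) hC0.le
      rw [le_div_iff₀ hsn, mul_comm]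
      exact hx _ hy
    · rw [wresid_eq_zero hy, zero_mul, abs_zero]
      positivity
  refine (mul_le_mul_of_nonneg_left h1 (by positivity)).trans_lt ?_
  rw [Finset.sum_const, Finset.card_range, nsmul_eq_mul]
  have h2 : (√(x.1 : ℝ))⁻¹ * (x.1 * (C * (ε / (2 * C) / √x.1))) = ε / 2 := by
    nth_rw 2 [← hsq]
    field_simp
  rw [h2]
  linarith

/-- The test statistic is asymptotically linear. -/
lemma tendsto_testStat_sub_influence : Tendsto (fun x : ℕ × Ω =>
    √x.1 * (testStat X Y w Λ C₁ C₂ Θ hhat x.1 x.2 / x.1 - popCriterion P (Y 0) w Λ h γ₀)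
    - (√x.1)⁻¹ * (∑ i ∈ Finset.range x.1,
      influence (P.map (obs X Y 0)) (P.map (Y 0)) w Λ h γ₀ ψ (obs X Y i x.2)
      - x.1 * popCriterion P (Y 0) w Λ h γ₀)) (whp P) (𝓝 0) := by
  have hsum := ((H.tendsto_testStat_sub_empSum.add
    (H.tendsto_sum_weight_mul_sq.const_mul (γ₀.1 ^ 2))).add
    (H.tendsto_sum_wresid_mul.const_mul (2 * γ₀.1))).add
    (H.tendsto_vStatistic_kern.const_mul (2 * γ₀.1))
  simp only [mul_zero, add_zero] at hsum
  refine hsum.congr' ?_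
  filter_upwards [eventually_whp_of_eventually (eventually_gt_atTop 0)] with x hn
  have hn' : (0 : ℝ) < x.1 := by exact_mod_cast hn
  have hsn : 0 < √(x.1 : ℝ) := Real.sqrt_pos.2 hn'
  have hsq : √(x.1 : ℝ) * √(x.1 : ℝ) = x.1 := Real.mul_self_sqrt hn'.le
  set T := testStat X Y w Λ C₁ C₂ Θ hhat x.1 x.2 with hT
  set M := popCriterion P (Y 0) w Λ h γ₀ with hM
  set μ := P.map (Y 0) with hμ
  -- An exact identity: the square of `R̃ + c₁ (ĥ - h)` is expanded, and in the linear term `ĥ - h`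
  -- is split into the mean of the `ψ` terms, which gives the `V`-statistic, and the remainder.
  have hemp : empSum X Y w Λ hhat γ₀ x =
      ∑ j ∈ Finset.range x.1, w (Y j x.2) * resid Λ h γ₀ (Y j x.2) ^ 2
      + 2 * γ₀.1 * ∑ j ∈ Finset.range x.1, wresid w Λ h γ₀ (Y j x.2) *
        (hhat x.1 (sample X Y x.1 x.2) (Y j x.2) - h (Y j x.2) - (x.1 : ℝ)⁻¹ *
          ∑ i ∈ Finset.range x.1, ψ (obsZ P X Y i x.2) (normCDF μ (Y j x.2)))
      + 2 * γ₀.1 * ((x.1 : ℝ)⁻¹ * ∑ i ∈ Finset.range x.1, ∑ j ∈ Finset.range x.1,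
        kern μ w Λ h γ₀ ψ (obs X Y i x.2) (obs X Y j x.2))
      + γ₀.1 ^ 2 * ∑ j ∈ Finset.range x.1, w (Y j x.2) *
        (hhat x.1 (sample X Y x.1 x.2) (Y j x.2) - h (Y j x.2)) ^ 2 := by
    rw [Finset.sum_comm]
    simp only [empSum, Finset.mul_sum, ← Finset.sum_add_distrib]
    refine Finset.sum_congr rfl fun j _ => ?_
    have h1 : ∑ i ∈ Finset.range x.1, 2 * γ₀.1 * ((x.1 : ℝ)⁻¹ *
        kern μ w Λ h γ₀ ψ (obs X Y i x.2) (obs X Y j x.2)) =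
        2 * γ₀.1 * (wresid w Λ h γ₀ (Y j x.2) * ∑ i ∈ Finset.range x.1, (x.1 : ℝ)⁻¹ *
          ψ (obsZ P X Y i x.2) (normCDF μ (Y j x.2))) := by
      rw [Finset.mul_sum, Finset.mul_sum]
      refine Finset.sum_congr rfl fun i _ => ?_
      have h2 : kern μ w Λ h γ₀ ψ (obs X Y i x.2) (obs X Y j x.2) =
          wresid w Λ h γ₀ (Y j x.2) * ψ (obsZ P X Y i x.2) (normCDF μ (Y j x.2)) := rfl
      rw [h2]; ring
    rw [h1, resid_eq_add (h := h) (hhat x.1 (sample X Y x.1 x.2)), wresid]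
    ring
  have hinf : ∑ i ∈ Finset.range x.1, influence (P.map (obs X Y 0)) μ w Λ h γ₀ ψ (obs X Y i x.2) =
      ∑ j ∈ Finset.range x.1, w (Y j x.2) * resid Λ h γ₀ (Y j x.2) ^ 2
      + 2 * γ₀.1 * ∑ i ∈ Finset.range x.1,
        ∫ v', kern μ w Λ h γ₀ ψ (obs X Y i x.2) v' ∂(P.map (obs X Y 0)) := by
    rw [Finset.mul_sum, ← Finset.sum_add_distrib]
    rfl
  have e1 : √(x.1 : ℝ) * (T / x.1 - M) = (√x.1)⁻¹ * (T - x.1 * M) := by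
    have : √(x.1 : ℝ) * (x.1 : ℝ)⁻¹ = (√x.1)⁻¹ := by
      nth_rw 2 [← hsq]; field_simp
    rw [← this]
    field_simp
  rw [e1, hinf, hemp]
  ring

lemma memLp_influence : MemLp (influence (P.map (obs X Y 0)) (P.map (Y 0)) w Λ h γ₀ ψ) 2
    (P.map (obs X Y 0)) := by
  have hQ := H.isIID_obs.isProbabilityMeasure
  have hk := H.isCenteredKernel_kern
  have h1 : MemLp (fun v => ∫ v', kern (P.map (Y 0)) w Λ h γ₀ ψ v v' ∂(P.map (obs X Y 0))) 2
      (P.map (obs X Y 0)) :=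
    (memLp_two_iff_integrable_sq hk.measurable_integral.aestronglyMeasurable).2
      hk.integrable_sq_integral
  have hl := (H.isBddMeas_loss H.mem_Υ).comp (β := EuclideanSpace ℝ (Fin dX) × ℝ) measurable_snd
  have h2 := (memLp_two_iff_integrable_sq hl.1.aestronglyMeasurable).2
    (hl.sq.integrable (P.map (obs X Y 0)))
  exact h2.add (h1.const_mul _)

lemma measurable_influence :
    Measurable (influence (P.map (obs X Y 0)) (P.map (Y 0)) w Λ h γ₀ ψ) := by
  have hQ := H.isIID_obs.isProbabilityMeasure
  exact ((H.isBddMeas_loss H.mem_Υ).comp measurable_snd).1.add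
    (H.isCenteredKernel_kern.measurable_integral.const_mul _)

/-- The `δ` part has mean zero because the kernel is centered in its first argument, so the mean is
that of the loss alone. -/
lemma integral_influence :
    ∫ ω, influence (P.map (obs X Y 0)) (P.map (Y 0)) w Λ h γ₀ ψ (obs X Y 0 ω) ∂P =
      popCriterion P (Y 0) w Λ h γ₀ := by
  have hQ := H.isIID_obs.isProbabilityMeasure
  have hk := H.isCenteredKernel_kern
  have hl := (H.isBddMeas_loss H.mem_Υ).comp (β := EuclideanSpace ℝ (Fin dX) × ℝ) measurable_snd
  have hδ : Integrable (fun ω => ∫ v', kern (P.map (Y 0)) w Λ h γ₀ ψ (obs X Y 0 ω) v'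
      ∂(P.map (obs X Y 0))) P :=
    (H.isIID_obs.measurePreserving 0).integrable_comp_of_integrable hk.integrable.integral_prod_left
  have hl' : Integrable (fun ω => w (Y 0 ω) * resid Λ h γ₀ (Y 0 ω) ^ 2) P :=
    ((H.isBddMeas_loss H.mem_Υ).comp (H.hY 0)).integrable P
  have h0 : ∫ ω, ∫ v', kern (P.map (Y 0)) w Λ h γ₀ ψ (obs X Y 0 ω) v'
      ∂(P.map (obs X Y 0)) ∂P = 0 := by
    rw [← hk.integral_integral, integral_map (H.isIID_obs.meas 0).aemeasurable
      hk.measurable_integral.aestronglyMeasurable]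
  have h1 : ∫ ω, influence (P.map (obs X Y 0)) (P.map (Y 0)) w Λ h γ₀ ψ (obs X Y 0 ω) ∂P =
      ∫ ω, w (Y 0 ω) * resid Λ h γ₀ (Y 0 ω) ^ 2 ∂P + ∫ ω, 2 * γ₀.1 *
        ∫ v', kern (P.map (Y 0)) w Λ h γ₀ ψ (obs X Y 0 ω) v' ∂(P.map (obs X Y 0)) ∂P :=
    integral_add hl' (hδ.const_mul _)
  rw [h1, integral_const_mul, h0, mul_zero, add_zero]
  rfl

lemma variance_influence :
    variance (fun ω => influence (P.map (obs X Y 0)) (P.map (Y 0)) w Λ h γ₀ ψ (obs X Y 0 ω)) P =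
      asympVar P X Y w Λ h ψ γ₀ := by
  refine variance_congr ?_
  filter_upwards [H.delta_ae_eq] with ω hω
  rw [hω]
  rfl

/-- The normalized test statistic is asymptotically normal. -/
theorem tendstoInDistribution_testStat :
    TendstoInDistribution
      (fun (n : ℕ) ω => √n * (testStat X Y w Λ C₁ C₂ Θ hhat n ω / n
          - popCriterion P (Y 0) w Λ h γ₀))
      atTop (id : ℝ → ℝ) (fun _ => P)
      (gaussianReal 0 (asympVar P X Y w Λ h ψ γ₀).toNNReal) := by
  set W : ℕ → Ω → ℝ := fun i ω =>
    influence (P.map (obs X Y 0)) (P.map (Y 0)) w Λ h γ₀ ψ (obs X Y i ω) with hW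
  have hIID : IsIID P W _ := H.isIID_obs.comp H.measurable_influence
  have hW2 : MemLp (W 0) 2 P :=
    H.memLp_influence.comp_measurePreserving (H.isIID_obs.measurePreserving 0)
  have hlaw : HasLaw (id : ℝ → ℝ) (gaussianReal 0 Var[W 0; P].toNNReal)
      (gaussianReal 0 (asympVar P X Y w Λ h ψ γ₀).toNNReal) := by
    rw [hW, H.variance_influence]
    exact HasLaw.id
  have hclt := tendstoInDistribution_inv_sqrt_mul_sum_sub hlaw hW2 hIID.indep fun i =>
    ⟨(hIID.meas i).aemeasurable, (hIID.meas 0).aemeasurable, by rw [hIID.law, hIID.law]⟩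
  have hmean : P[W 0] = popCriterion P (Y 0) w Λ h γ₀ := H.integral_influence
  rw [hmean] at hclt
  -- Slutsky: the statistic differs from the normalized sum in the central limit theorem by a term
  -- tending to zero in probability.
  refine tendstoInDistribution_of_tendstoInMeasure_sub _ _ hclt ?_ fun n => ?_
  · have h1 := H.tendsto_testStat_sub_influence
    exact (tendsto_whp_iff_tendstoInMeasure (R := fun n ω =>
      √n * (testStat X Y w Λ C₁ C₂ Θ hhat n ω / n - popCriterion P (Y 0) w Λ h γ₀)
      - (√n)⁻¹ * (∑ i ∈ Finset.range n, W i ω - n * popCriterion P (Y 0) w Λ h γ₀))).1 h1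
  · exact ((((H.measurable_testStat n).div_const _).sub_const _).const_mul _).aemeasurable

end Assumptions

end TransModel

/-! ### The test for relevant deviations -/

namespace TransModel

lemma gaussianReal_Iic_mul_sqrt {v : ℝ} (hv : 0 < v) (u : ℝ) :
    gaussianReal 0 v.toNNReal (Iic (u * √v)) = ENNReal.ofReal (cdf (gaussianReal 0 1) u) := by
  have h1 : gaussianReal 0 v.toNNReal = (gaussianReal 0 1).map (√v * ·) := by
    rw [gaussianReal_map_const_mul, mul_zero, mul_one]
    congr 1
    ext
    simp [Real.sq_sqrt hv.le, hv.le]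
  rw [h1, Measure.map_apply (by fun_prop) measurableSet_Iic, ofReal_cdf]
  congr 1
  ext x
  simp only [mem_preimage, mem_Iic, mul_comm u]
  exact mul_le_mul_iff_of_pos_left (Real.sqrt_pos.2 hv)

section Tests

variable {Ω : Type*} [MeasurableSpace Ω] {P : Measure Ω} [IsProbabilityMeasure P]
  {T s2 : ℕ → Ω → ℝ} {M v η : ℝ}

/-- Positivity of `s` is essential: otherwise the square root is zero, and division by zero turns
the rejection event into `0 < u`. -/
lemma rejects_iff {t s u : ℝ} {n : ℕ} (hn : 0 < n) (hs : 0 < s) :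
    rejects η u t s n ↔ √n * (t / n - η) < u * √s := by
  have hn' : (0 : ℝ) < n := by exact_mod_cast hn
  have hsn : 0 < √(n : ℝ) := Real.sqrt_pos.2 hn'
  have h1 : (t - n * η) / √n = √n * (t / n - η) := by
    have h2 := Real.mul_self_sqrt hn'.le
    rw [div_eq_iff hsn.ne', mul_right_comm, h2]
    field_simp
  rw [rejects, Real.sqrt_mul hn'.le, ← div_div, div_lt_iff₀ (Real.sqrt_pos.2 hs), h1]

/-- The test has asymptotic level `Φ(u)` if `η ≤ M` and `√n (T_n / n - M)` is asymptotically
normal with a variance that `s2` estimates consistently. -/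
lemma limsup_rejects_le (hv : 0 < v)
    (hT : TendstoInDistribution (fun (n : ℕ) ω => √n * (T n ω / n - M)) atTop (id : ℝ → ℝ)
      (fun _ => P) (gaussianReal 0 v.toNNReal))
    (hs : ∀ n, Measurable (s2 n)) (hs2 : TendstoInMeasure P s2 atTop fun _ => v)
    (hη : η ≤ M) (u : ℝ) :
    limsup (fun n : ℕ => P {ω | rejects η u (T n ω) (s2 n ω) n}) atTop
      ≤ ENNReal.ofReal (cdf (gaussianReal 0 1) u) := by
  -- Moving the random critical value to the left places the rejection event, up to nonpositive
  -- variance estimates, inside `D n ≤ 0`. This is a fixed closed half line, to which the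
  -- portmanteau theorem applies.
  set D : ℕ → Ω → ℝ := fun n ω => √n * (T n ω / n - M) - u * √(s2 n ω) with hD
  have hlim : TendstoInDistribution D atTop (fun x : ℝ => x - u * √v) (fun _ => P)
      (gaussianReal 0 v.toNNReal) :=
    hT.continuous_comp_prodMk_of_tendstoInMeasure_const (g := fun p : ℝ × ℝ => p.1 - u * √p.2)
      (by fun_prop) hs2 fun n => (hs n).aemeasurable
  have hcl := ProbabilityMeasure.limsup_measure_closed_le_of_tendsto hlim.tendsto
    (isClosed_Iic (a := (0 : ℝ)))
  have hpos : ∀ᶠ x in whp P, 0 < s2 x.1 x.2 :=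
    (tendsto_whp_iff_tendstoInMeasure.2 hs2).eventually_const_lt hv
  rw [eventually_whp] at hpos
  simp only [ProbabilityMeasure.coe_mk] at hcl
  rw [Measure.map_apply_of_aemeasurable (by fun_prop) measurableSet_Iic] at hcl
  have hpre : (fun x : ℝ => x - u * √v) ⁻¹' Iic 0 = Iic (u * √v) := by
    ext x
    simp
  rw [hpre, gaussianReal_Iic_mul_sqrt hv] at hcl
  -- The event that the variance estimate is not positive has vanishing probability and does not
  -- affect the limsup.
  have hle : ∀ᶠ n : ℕ in atTop, P {ω | rejects η u (T n ω) (s2 n ω) n} ≤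
      P {ω | ¬ 0 < s2 n ω} + P.map (D n) (Iic 0) := by
    filter_upwards [eventually_gt_atTop 0] with n hn
    rw [Measure.map_apply_of_aemeasurable (hlim.forall_aemeasurable n) measurableSet_Iic]
    refine (measure_mono fun ω hω => ?_).trans (measure_union_le _ _)
    by_cases h0 : 0 < s2 n ω
    · right
      have h1 := (rejects_iff hn h0).1 hω
      have h2 : √(n : ℝ) * (T n ω / n - M) ≤ √n * (T n ω / n - η) := by gcongr
      simp only [hD, mem_preimage, mem_Iic]
      linarith
    · exact Or.inl h0
  exact ((limsup_le_limsup hle).trans_eq (ENNReal.limsup_add_of_left_tendsto_zero hpos _)).trans hcl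

/-- The test is consistent if `T_n / n` converges in probability to some `M < η`. -/
lemma tendsto_rejects (hv : 0 < v)
    (hT : Tendsto (fun x : ℕ × Ω => T x.1 x.2 / x.1) (whp P) (𝓝 M))
    (hTm : ∀ n, Measurable (T n)) (hs : ∀ n, Measurable (s2 n))
    (hs2 : TendstoInMeasure P s2 atTop fun _ => v) (hη : M < η) (u : ℝ) :
    Tendsto (fun n : ℕ => P {ω | rejects η u (T n ω) (s2 n ω) n}) atTop (𝓝 1) := by
  have hs2' := tendsto_whp_iff_tendstoInMeasure.2 hs2
  have h0 : Tendsto (fun x : ℕ × Ω => √(x.1 : ℝ)) (whp P) atTop :=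
    tendsto_whp_of_tendsto (u := fun n : ℕ => √(n : ℝ)) tendsto_sqrt_natCast
  -- The standardized statistic tends to minus infinity in probability, since `T_n/n - η` has the
  -- negative limit `M - η`.
  have h1 := h0.atTop_mul_neg (sub_neg.2 hη) (hT.sub_const η)
  have h2 : Tendsto (fun x : ℕ × Ω => u * √(s2 x.1 x.2)) (whp P) (𝓝 (u * √v)) :=
    ((Real.continuous_sqrt.tendsto v).comp hs2').const_mul u
  have h3 : ∀ᶠ x in whp P, rejects η u (T x.1 x.2) (s2 x.1 x.2) x.1 := by
    filter_upwards [h1.eventually_lt_atBot (u * √v - 1),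
      h2.eventually_const_lt (show u * √v - 1 < u * √v by linarith),
      hs2'.eventually_const_lt hv, eventually_whp_of_eventually (eventually_gt_atTop 0)]
      with x hx1 hx2 hx3 hx4
    exact (rejects_iff hx4 hx3).2 (hx1.trans hx2)
  rw [eventually_whp] at h3
  have h4 : ∀ n : ℕ, MeasurableSet {ω | rejects η u (T n ω) (s2 n ω) n} := fun n =>
    measurableSet_lt (((hTm n).sub_const _).div ((hs n).const_mul _).sqrt) measurable_const
  have h5 : ∀ n : ℕ, P {ω | rejects η u (T n ω) (s2 n ω) n} =
      1 - P {ω | ¬ rejects η u (T n ω) (s2 n ω) n} := by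
    intro n
    change _ = 1 - P {ω | rejects η u (T n ω) (s2 n ω) n}ᶜ
    rw [← prob_compl_eq_one_sub (h4 n).compl, compl_compl]
  simp only [h5]
  simpa using ENNReal.Tendsto.sub tendsto_const_nhds h3 (Or.inl ENNReal.one_ne_top)

end Tests

lemma popCriterion_nonneg {Ω : Type*} [MeasurableSpace Ω] (P : Measure Ω) {d : ℕ} (Y : Ω → ℝ)
    {w : ℝ → ℝ} (hw : ∀ y, 0 ≤ w y) (Λ : EuclideanSpace ℝ (Fin d) → ℝ → ℝ) (h : ℝ → ℝ)
    (γ : Param d) : 0 ≤ popCriterion P Y w Λ h γ :=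
  integral_nonneg fun _ => mul_nonneg (hw _) (sq_nonneg _)

namespace Assumptions

variable {Ω : Type*} [MeasurableSpace Ω] {P : Measure Ω} [IsProbabilityMeasure P]
    {dX d : ℕ} {X : ℕ → Ω → EuclideanSpace ℝ (Fin dX)} {Y : ℕ → Ω → ℝ}
    {Λ : EuclideanSpace ℝ (Fin d) → ℝ → ℝ} {Θ : Set (EuclideanSpace ℝ (Fin d))} {C₁ C₂ : Set ℝ}
    {w h : ℝ → ℝ} {γ₀ : Param d}
    {hhat : (n : ℕ) → (Fin n → EuclideanSpace ℝ (Fin dX) × ℝ) → ℝ → ℝ}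
    {ψ : ℝ × EuclideanSpace ℝ (Fin dX) → ℝ → ℝ} {U₀ : Set ℝ}
    (H : Assumptions P X Y Λ Θ C₁ C₂ w h γ₀ hhat ψ U₀)

include H

lemma tendsto_testStat_div : Tendsto
    (fun x : ℕ × Ω => testStat X Y w Λ C₁ C₂ Θ hhat x.1 x.2 / x.1) (whp P)
    (𝓝 (popCriterion P (Y 0) w Λ h γ₀)) := by
  have h1 : Tendsto (fun x : ℕ × Ω => (√(x.1 : ℝ))⁻¹) (whp P) (𝓝 0) :=
    tendsto_whp_of_tendsto (u := fun n : ℕ => (√(n : ℝ))⁻¹)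
      tendsto_sqrt_natCast.inv_tendsto_atTop
  have h2 := (h1.mul H.tendsto_testStat_sub_empSum).add H.tendsto_empSum
  simp only [mul_zero, zero_add] at h2
  refine h2.congr fun x => ?_
  have h3 := Real.mul_self_sqrt (Nat.cast_nonneg (α := ℝ) x.1)
  rw [← mul_assoc, ← mul_inv, h3]
  ring

omit [IsProbabilityMeasure P] in
-- As `C₁` lies in the positive half line, `γ₀` is a competitor in both infima. Under `H₀'` this
-- gives `η ≤ M(γ₀)`.
lemma sInf_sqDist_le (hC : C₁ ⊆ Ioi 0) :
    sInf (sqDist P (Y 0) w Λ h '' Θ) ≤ popCriterion P (Y 0) w Λ h γ₀ := by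
  have hγ := H.mem_Υ
  have h0 : ∀ θ, 0 ≤ sqDist P (Y 0) w Λ h θ := fun θ => by
    refine Real.sInf_nonneg ?_
    rintro _ ⟨c, -, rfl⟩
    exact popCriterion_nonneg P _ H.hw0 Λ h _
  refine (csInf_le ⟨0, ?_⟩ (mem_image_of_mem _ hγ.2.2)).trans (csInf_le ⟨0, ?_⟩ ?_)
  · rintro _ ⟨θ, -, rfl⟩
    exact h0 θ
  · rintro _ ⟨c, -, rfl⟩
    exact popCriterion_nonneg P _ H.hw0 Λ h _
  · exact ⟨(γ₀.1, γ₀.2.1), ⟨hC hγ.1, mem_univ _⟩, rfl⟩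

omit [IsProbabilityMeasure P] in
-- When the distances are infima over `C₁ × C₂`, only points of the parameter set compete, and `γ₀`
-- is minimal there.
lemma popCriterion_le_sInf_sqDist
    (hd : ∀ θ ∈ Θ, sInf ((fun c : ℝ × ℝ => popCriterion P (Y 0) w Λ h (c.1, c.2, θ)) ''
      (C₁ ×ˢ C₂)) = sqDist P (Y 0) w Λ h θ) :
    popCriterion P (Y 0) w Λ h γ₀ ≤ sInf (sqDist P (Y 0) w Λ h '' Θ) := by
  have hγ := H.mem_Υ
  refine le_csInf ⟨_, mem_image_of_mem _ hγ.2.2⟩ ?_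
  rintro _ ⟨θ, hθ, rfl⟩
  rw [← hd θ hθ]
  refine le_csInf ⟨_, (γ₀.1, γ₀.2.1), ⟨hγ.1, hγ.2.1⟩, rfl⟩ ?_
  rintro _ ⟨c, hc, rfl⟩
  by_cases he : (c.1, c.2, θ) = γ₀
  · simp [he]
  · exact (H.hmin _ ⟨hc.1, hc.2, hθ⟩ he).le

end Assumptions

end TransModel

/-! ### The theorem -/

theorem mainTheorem3
    {Ω : Type*} [MeasurableSpace Ω] (P : Measure Ω) [IsProbabilityMeasure P]
    {dX d : ℕ}
    -- the observations: independent copies of `(X, Y)`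
    (X : ℕ → Ω → EuclideanSpace ℝ (Fin dX)) (Y : ℕ → Ω → ℝ)
    (hX : ∀ i, Measurable (X i)) (hY : ∀ i, Measurable (Y i))
    (hindep : iIndepFun (fun i ω => (X i ω, Y i ω)) P)
    (hident : ∀ i, IdentDistrib (fun ω => (X i ω, Y i ω)) (fun ω => (X 0 ω, Y 0 ω)) P P)
    -- `F_Y` is strictly increasing on the support of `Y`, which contains `0` and `1`
    (hFY : StrictMonoOn (cdf (P.map (Y 0))) (P.map (Y 0)).support)
    (h0supp : (0 : ℝ) ∈ (P.map (Y 0)).support) (h1supp : (1 : ℝ) ∈ (P.map (Y 0)).support)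
    -- the parametric class of strictly increasing transformations, and the parameter sets
    (Λ : EuclideanSpace ℝ (Fin d) → ℝ → ℝ) (Θ : Set (EuclideanSpace ℝ (Fin d)))
    (C₁ C₂ : Set ℝ) (hΛ : ∀ θ ∈ Θ, StrictMono (Λ θ)) (hC₁pos : C₁ ⊆ Ioi 0)
    -- compact parameter sets
    (hC₁ : IsCompact C₁) (hC₂ : IsCompact C₂) (hΘ : IsCompact Θ)
    -- the weight function
    (w : ℝ → ℝ) (hw0 : ∀ y, 0 ≤ w y) (hwc : Continuous w) (hwK : HasCompactSupport w)
    (hwY : tsupport w ⊆ (P.map (Y 0)).support)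
    -- smoothness of the class in the parameter
    (hΛdiff : TransModel.TwiceContDiffInParam (tsupport w) Θ Λ)
    -- the true transformation, unique on the support of `Y`
    (h : ℝ → ℝ) (hh : TransModel.IsTransformation P (X 0) (Y 0) h)
    (huniq : ∀ h', TransModel.IsTransformation P (X 0) (Y 0) h' →
      EqOn h' h (P.map (Y 0)).support)
    -- `γ₀` is the unique minimizer of `M`, an interior point; the class is identifiable
    (γ₀ : TransModel.Param d) (hγ₀ : γ₀ ∈ interior (C₁ ×ˢ C₂ ×ˢ Θ))
    (hmin : ∀ γ ∈ C₁ ×ˢ C₂ ×ˢ Θ, γ ≠ γ₀ →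
      TransModel.popCriterion P (Y 0) w Λ h γ₀ < TransModel.popCriterion P (Y 0) w Λ h γ)
    (hΛident : ∀ θ ∈ Θ, ∀ θ' ∈ Θ, θ ≠ θ' → ∃ y ∈ tsupport w,
      0 < |(Λ θ y - Λ θ 0) / (Λ θ 1 - Λ θ 0) - (Λ θ' y - Λ θ' 0) / (Λ θ' 1 - Λ θ' 0)|)
    -- the Hessian matrix of `M` at `γ₀` is positive definite
    (hHess : (TransModel.hessian (TransModel.popCriterion P (Y 0) w Λ h) γ₀).PosDef)
    -- the estimator and its linear expansion, uniformly on the support of `w`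
    (hhat : (n : ℕ) → (Fin n → EuclideanSpace ℝ (Fin dX) × ℝ) → ℝ → ℝ)
    (hhat_meas : ∀ (n : ℕ) (j : Fin n),
      Measurable fun D : Fin n → EuclideanSpace ℝ (Fin dX) × ℝ => hhat n D (D j).2)
    (ψ : ℝ × EuclideanSpace ℝ (Fin dX) → ℝ → ℝ) (hψ : Measurable (Function.uncurry ψ))
    (hexp : ∀ ε : ℝ, 0 < ε → Tendsto (fun n : ℕ => P {ω | ∃ y ∈ tsupport w,
      ε < Real.sqrt n * |hhat n (TransModel.sample X Y n ω) y - h y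
        - (n : ℝ)⁻¹ * ∑ i : Fin n,
            ψ (TransModel.obsZ P X Y i ω) (TransModel.normCDF (P.map (Y 0)) y)|})
      atTop (𝓝 0))
    (U₀ : Set ℝ)
    (hU₀ : TransModel.normCDF (P.map fun ω => h (Y 0 ω)) '' (h '' tsupport w) ⊆ U₀)
    (hDonsker :
      TransModel.IsDonsker ((fun t z => ψ z t) '' U₀) (P.map (TransModel.obsZ P X Y 0)))
    (hψmean : ∀ t ∈ U₀, ∫ ω, ψ (TransModel.obsZ P X Y 0 ω) t ∂P = 0)
    (hψsq : Integrable
      (fun ω => ψ (TransModel.obsZ P X Y 0 ω) (TransModel.obsZ P X Y 1 ω).1 ^ 2) P)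
    -- `Γ'` is positive definite
    (hΓ' : (TransModel.GammaPrime P (Y 0) w Λ h γ₀).PosDef) :
    -- asymptotic normality
    TendstoInDistribution
      (fun (n : ℕ) ω => Real.sqrt n *
        (TransModel.testStat X Y w Λ C₁ C₂ Θ hhat n ω / n
          - TransModel.popCriterion P (Y 0) w Λ h γ₀))
      atTop (id : ℝ → ℝ) (fun _ => P)
      (gaussianReal 0 (TransModel.asympVar P X Y w Λ h ψ γ₀).toNNReal)
    ∧
    -- the resulting test for relevant deviations, with a consistent estimator `s2` of `σ²` and
    -- the `α`-quantile `u` of the standard normal distribution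
    (∀ (s2 : ℕ → Ω → ℝ) (η u α : ℝ), (∀ n, Measurable (s2 n)) →
      0 < TransModel.asympVar P X Y w Λ h ψ γ₀ →
      TendstoInMeasure P s2 atTop (fun _ => TransModel.asympVar P X Y w Λ h ψ γ₀) →
      cdf (gaussianReal 0 1) u = α →
      -- asymptotic level `α` under `H₀'`
      (η ≤ sInf (TransModel.sqDist P (Y 0) w Λ h '' Θ) →
        limsup (fun n : ℕ => P {ω | TransModel.rejects η u
          (TransModel.testStat X Y w Λ C₁ C₂ Θ hhat n ω) (s2 n ω) n}) atTop
          ≤ ENNReal.ofReal α) ∧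
      -- consistency under `H₁'`, if `C₁` and `C₂` are large enough for the constrained minima to
      -- be the distances `d(Λ_θ, h)`
      ((∀ θ ∈ Θ, sInf ((fun c : ℝ × ℝ => TransModel.popCriterion P (Y 0) w Λ h (c.1, c.2, θ)) ''
            (C₁ ×ˢ C₂)) = TransModel.sqDist P (Y 0) w Λ h θ) →
        sInf (TransModel.sqDist P (Y 0) w Λ h '' Θ) < η →
        Tendsto (fun n : ℕ => P {ω | TransModel.rejects η u
          (TransModel.testStat X Y w Λ C₁ C₂ Θ hhat n ω) (s2 n ω) n}) atTop (𝓝 1))) := by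
  have H : TransModel.Assumptions P X Y Λ Θ C₁ C₂ w h γ₀ hhat ψ U₀ :=
    ⟨hX, hY, hindep, hident, hΛ, hC₁, hC₂, hΘ, hw0, hwc, hwK, hΛdiff, hh.1, hh.2.1, hh.2.2.1,
      hh.2.2.2.1, hγ₀, hmin, hhat_meas, hψ, hexp, hU₀, hDonsker, hψmean, hψsq, hΓ'⟩
  refine ⟨H.tendstoInDistribution_testStat, ?_⟩
  rintro s2 η u α hs hv hs2 rfl
  -- The level needs only that the infimum of the distances is at most `M(γ₀)`. Consistency needs
  -- the reverse inequality, and this is where the size of `C₁` and `C₂` enters.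
  exact ⟨fun hη => TransModel.limsup_rejects_le hv H.tendstoInDistribution_testStat hs hs2
      (hη.trans (H.sInf_sqDist_le hC₁pos)) u,
    fun hd hη => TransModel.tendsto_rejects hv H.tendsto_testStat_div H.measurable_testStat hs hs2
      ((H.popCriterion_le_sInf_sqDist hd).trans_lt hη) u⟩
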